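/- Let $K$ be a field, $n\ge 2$, and let $\mathfrak g=\mathfrak g_{\bar 0}\oplus\mathfrak g_{\bar 1}$ be a first-class $n$-Lie superalgebra over $K$: a $\mathbb Z_2$-graded vector space with an $n$-linear bracket such that, for homogeneous elements, $|[x_1,\dots,x_n]|=\sum_i|x_i|$, $[x_1,\dots,x_i,x_{i+1},\dots,x_n]=-(-1)^{|x_i||x_{i+1}|}[x_1,\dots,x_{i+1},x_i,\dots,x_n]$ and $$[x_1,\dots,x_{n-1},[y_1,\dots,y_n]]=\sum_{i=1}^n(-1)^{(|x_1|+\dots+|x_{n-1}|)(|y_1|+\dots+|y_{i-1}|)}[y_1,\dots,[x_1,\dots,x_{n-1},y_i],\dots,y_n].$$ Here $\mathfrak g^{\wedge(n-1)}$ is the super exterior power, i.e. linear maps on it are the multilinear maps of $n-1$ variables with $\varphi(\dots,x_i,x_{i+1},\dots)=-(-1)^{|x_i||x_{i+1}|}\varphi(\dots,x_{i+1},x_i,\dots)$ for homogeneous $x_i,x_{i+1}$. For $\mathbf x=x_1\wedge\dots\wedge x_{n-1}$ and $\mathbf y=y_1\wedge\dots\wedge y_{n-1}$ with homogeneous entries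 put $|\mathbf x|=\sum_i|x_i|$, $\mathbf x\cdot z=[x_1,\dots,x_{n-1},z]$ and $\mathbf x\cdot\mathbf y=\sum_{i=1}^{n-1}(-1)^{|\mathbf x|(|y_1|+\dots+|y_{i-1}|)}y_1\wedge\dots\wedge\mathbf x\cdot y_i\wedge\dots\wedge y_{n-1}$. Let $V=V_{\bar 0}\oplus V_{\bar 1}$ be a graded $\mathfrak g$-module: a $\mathbb Z_2$-graded vector space with a linear map $\rho:\mathfrak g^{\wedge(n-1)}\to\mathrm{End}(V)$ such that, for homogeneous entries, $\rho(\mathbf x)V_\alpha\subseteq V_{\alpha+|\mathbf x|}$, $\rho(\mathbf x)\rho(\mathbf y)=\rho(\mathbf x\cdot\mathbf y)+(-1)^{|\mathbf x||\mathbf y|}\rho(\mathbf y)\rho(\mathbf x)$ and $$\rho(x_1,\dots,x_{n-2},[y_1,\dots,y_n])=\sum_{i=1}^n(-1)^{n-i}(-1)^{(|x_1|+\dots+|x_{n-2}|)\sum_{k\ne i}|y_k|}(-1)^{|y_i|(|y_{i+1}|+\dots+|y_n|)}\rho(y_1,\dots,\widehat{y_i},\dots,y_n)\,\rho(x_1,\dots,x_{n-2},y_i).$$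 Write $\mathbf x\cdot v=[x_1,\dots,x_{n-1},v]=\rho(\mathbf x)v$, and define brackets with one entry $v\in V$ in any other position by the same super-skew-symmetry rule. For $m\ge 0$ let $C^m(\mathfrak g,V)=\mathrm{Hom}((\mathfrak g^{\wedge(n-1)})^{\otimes m}\wedge\mathfrak g,V)$ be the space of multilinear maps $f(\mathbf x_1,\dots,\mathbf x_m,z)$, $\mathbf x_i=x_i^1\wedge\dots\wedge x_i^{n-1}$, that are super-skew-symmetric in the entries of each $\mathbf x_i$ and, if $m\ge 1$, in the $n$ arguments $x_m^1,\dots,x_m^{n-1},z$. Let $C^m(\mathfrak g,V)_\alpha$ be the subspace of those $f$ with $|f(\mathbf x_1,\dots,\mathbf x_m,z)|=\alpha+\sum_i|\mathbf x_i|+|z|$ on homogeneous arguments. Define the linear operator $\delta$ on $C^m(\mathfrak g,V)$ by the following formula for homogeneous $f$ and homogeneous arguments, extended linearly in $f$ and in all arguments: $$\begin{aligned}(\delta f)(\mathbf x_1,\dots,\mathbf x_{m+1},z)={}&\sum_{i<j}(-1)^i(-1)^{|\mathbf x_i|(|\mathbf x_{i+1}|+\dots+|\mathbf x_{j-1}|)}f(\mathbf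 x_1,\dots,\widehat{\mathbf x_i},\dots,\mathbf x_i\cdot\mathbf x_j,\dots,\mathbf x_{m+1},z)\\&+\sum_{i=1}^{m+1}(-1)^i(-1)^{|\mathbf x_i|(|\mathbf x_{i+1}|+\dots+|\mathbf x_{m+1}|)}f(\mathbf x_1,\dots,\widehat{\mathbf x_i},\dots,\mathbf x_{m+1},\mathbf x_i\cdot z)\\&+\sum_{i=1}^{m+1}(-1)^{i+1}(-1)^{|\mathbf x_i|(|f|+|\mathbf x_1|+\dots+|\mathbf x_{i-1}|)}\mathbf x_i\cdot f(\mathbf x_1,\dots,\widehat{\mathbf x_i},\dots,\mathbf x_{m+1},z)\\&+(-1)^m\sum_{i=1}^{n-1}(-1)^{(|f|+|\mathbf x_1|+\dots+|\mathbf x_m|)(|x_{m+1}^1|+\dots+|x_{m+1}^{i-1}|)}[x_{m+1}^1,\dots,f(\mathbf x_1,\dots,\mathbf x_m,x_{m+1}^i),\dots,x_{m+1}^{n-1},z].\end{aligned}$$ Then for all $m\ge 0$: $C^m(\mathfrak g,V)=C^m(\mathfrak g,V)_{\bar 0}\oplus C^m(\mathfrak g,V)_{\bar 1}$; $\delta$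 is a well-defined linear map $C^m(\mathfrak g,V)\to C^{m+1}(\mathfrak g,V)$ given by this formula on homogeneous cochains and arguments, and it preserves degrees; and $$\delta^2 f=0\qquad\text{for all } f\in C^m(\mathfrak g,V).$$ Consequently, with $Z^m(\mathfrak g,V)=\{f\in C^m(\mathfrak g,V):\delta f=0\}$ and $C^{-1}(\mathfrak g,V)=0$, the space $\delta C^{m-1}(\mathfrak g,V)$ is a graded subspace of the graded space $Z^m(\mathfrak g,V)$, and $H^m(\mathfrak g,V)=Z^m(\mathfrak g,V)/\delta C^{m-1}(\mathfrak g,V)$ is $\mathbb Z_2$-graded, the direct sum of the classes of cocycles of degree $\bar 0$ and those of degree $\bar 1$. -/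

import Mathlib

namespace NLieSuper

/-- The sign `(-1)^a` for `a ∈ ℤ/2ℤ`. -/
def sgn (a : ZMod 2) : ℤˣ := (-1 : ℤˣ) ^ a

section Algebra

variable (K : Type*) [Field K] {g : Type*} [AddCommGroup g] [Module K g]

/-- A first-class `n`-Lie superalgebra structure, `n = N + 2 ≥ 2`, on the `ℤ/2ℤ`-graded vector space
`g = 𝒢 0 ⊕ 𝒢 1`: an `n`-linear bracket of parity `0` that is super-skew-symmetric and satisfies the
super Filippov identity. -/
structure FirstClassNLieSuperalgebra (N : ℕ) (𝒢 : ZMod 2 → Submodule K g) where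
  /-- the bracket `[x_1, …, x_n]` -/
  bracket : MultilinearMap K (fun _ : Fin (N + 2) => g) g
  bracket_mem : ∀ (d : Fin (N + 2) → ZMod 2) (x : Fin (N + 2) → g),
    (∀ i, x i ∈ 𝒢 (d i)) → bracket x ∈ 𝒢 (∑ i, d i)
  bracket_skew : ∀ (x : Fin (N + 2) → g) (i : Fin (N + 1)) (p q : ZMod 2),
    x i.castSucc ∈ 𝒢 p → x i.succ ∈ 𝒢 q →
      bracket x = -(sgn (p * q) • bracket (x ∘ Equiv.swap i.castSucc i.succ))
  filippov : ∀ (dx : Fin (N + 1) → ZMod 2) (dy : Fin (N + 2) → ZMod 2)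
    (x : Fin (N + 1) → g) (y : Fin (N + 2) → g),
    (∀ i, x i ∈ 𝒢 (dx i)) → (∀ i, y i ∈ 𝒢 (dy i)) →
      bracket (Fin.snoc (α := fun _ => g) x (bracket y)) =
        ∑ i, sgn ((∑ k, dx k) * ∑ k ∈ Finset.Iio i, dy k) •
          bracket (Function.update y i (bracket (Fin.snoc (α := fun _ => g) x (y i))))

variable {K}

/-- `𝐱 · z = [x_1, …, x_{n-1}, z]` for `𝐱 = x_1 ∧ ⋯ ∧ x_{n-1}`. -/
def FirstClassNLieSuperalgebra.act {N : ℕ} {𝒢 : ZMod 2 → Submodule K g}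
    (L : FirstClassNLieSuperalgebra K N 𝒢) (x : Fin (N + 1) → g) (z : g) : g :=
  L.bracket (Fin.snoc (α := fun _ => g) x z)

variable {V : Type*} [AddCommGroup V] [Module K V]

/-- A graded representation of the first-class `n`-Lie superalgebra `L` (with `n = N + 2`) on the
`ℤ/2ℤ`-graded vector space `V = 𝒱 0 ⊕ 𝒱 1`. A linear map on the super exterior power
`g^{∧(n-1)}` is given as a super-skew-symmetric multilinear map in `n - 1` variables. -/
structure GradedRep {N : ℕ} {𝒢 : ZMod 2 → Submodule K g}
    (L : FirstClassNLieSuperalgebra K N 𝒢) (𝒱 : ZMod 2 → Submodule K V) where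
  /-- `ρ(x_1, …, x_{n-1})` -/
  rho : MultilinearMap K (fun _ : Fin (N + 1) => g) (Module.End K V)
  rho_skew : ∀ (x : Fin (N + 1) → g) (i : Fin N) (p q : ZMod 2),
    x i.castSucc ∈ 𝒢 p → x i.succ ∈ 𝒢 q →
      rho x = -(sgn (p * q) • rho (x ∘ Equiv.swap i.castSucc i.succ))
  rho_mem : ∀ (d : Fin (N + 1) → ZMod 2) (x : Fin (N + 1) → g), (∀ i, x i ∈ 𝒢 (d i)) →
    ∀ (α : ZMod 2) (v : V), v ∈ 𝒱 α → rho x v ∈ 𝒱 (α + ∑ i, d i)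
  /-- `ρ(𝐱) ρ(𝐲) = ρ(𝐱 · 𝐲) + (-1)^{|𝐱||𝐲|} ρ(𝐲) ρ(𝐱)`, where `𝐱 · 𝐲` is the sum over `i` of
  `(-1)^{|𝐱|(|y_1| + ⋯ + |y_{i-1}|)} y_1 ∧ ⋯ ∧ 𝐱 · y_i ∧ ⋯ ∧ y_{n-1}` -/
  rho_mul : ∀ (dx dy : Fin (N + 1) → ZMod 2) (x y : Fin (N + 1) → g),
    (∀ i, x i ∈ 𝒢 (dx i)) → (∀ i, y i ∈ 𝒢 (dy i)) →
      rho x * rho y =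
        (∑ i, sgn ((∑ k, dx k) * ∑ k ∈ Finset.Iio i, dy k) •
          rho (Function.update y i (L.act x (y i)))) +
        sgn ((∑ k, dx k) * ∑ k, dy k) • (rho y * rho x)
  /-- the expansion of `ρ(x_1, …, x_{n-2}, [y_1, …, y_n])`; as `i : Fin n` counts from `0`, the sign
  `(-1)^{n-i}` reads `(-1)^{n-1-i}` here -/
  rho_bracket : ∀ (dx : Fin N → ZMod 2) (dy : Fin (N + 2) → ZMod 2)
    (x : Fin N → g) (y : Fin (N + 2) → g),
    (∀ i, x i ∈ 𝒢 (dx i)) → (∀ i, y i ∈ 𝒢 (dy i)) →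
      rho (Fin.snoc (α := fun _ => g) x (L.bracket y)) =
        ∑ i : Fin (N + 2),
          ((-1 : ℤˣ) ^ (N + 1 - (i : ℕ)) *
            sgn ((∑ k, dx k) * ∑ k : Fin (N + 1), dy (i.succAbove k)) *
            sgn (dy i * ∑ k ∈ Finset.Ioi i, dy k)) •
          (rho (fun k => y (i.succAbove k)) * rho (Fin.snoc (α := fun _ => g) x (y i)))

/-- The bracket `[y_1, …, y_{i-1}, v, y_{i+1}, …, y_n]` of `g ⊕ V` with one entry `v ∈ V` of degree
`e`, in position `i`, and all other entries `y_k` of degree `d k` in `g`: by supersymmetry,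
`v` is moved to the last position, where the bracket is the action of `g` on `V`.
The entry `y i` is not used. -/
def GradedRep.mixedBracket {N : ℕ} {𝒢 : ZMod 2 → Submodule K g}
    {L : FirstClassNLieSuperalgebra K N 𝒢} {𝒱 : ZMod 2 → Submodule K V} (R : GradedRep L 𝒱)
    (i : Fin (N + 2)) (e : ZMod 2) (d : Fin (N + 2) → ZMod 2) (y : Fin (N + 2) → g) (v : V) : V :=
  ((-1 : ℤˣ) ^ (N + 1 - (i : ℕ)) * sgn (e * ∑ k ∈ Finset.Ioi i, d k)) •
    R.rho (fun k => y (i.succAbove k)) v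

end Algebra

section Cochains

/-- Functions of `m` tuples `𝐱_1, …, 𝐱_m ∈ g^{n-1}` and one further argument `z ∈ g`, with values in
`V` (`n = N + 2`). The supercochains are the subspace `supercochains` below. -/
abbrev PreCochain (N : ℕ) (g V : Type*) (m : ℕ) : Type _ :=
  (Fin m → Fin (N + 1) → g) → g → V

variable {K : Type*} [Field K] {g : Type*} [AddCommGroup g] [Module K g]
  {V : Type*} [AddCommGroup V] [Module K V]

/-- The space `C^m(g, V) = Hom((g^{∧(n-1)})^{⊗m} ∧ g, V)` of `m`-supercochains: the multilinear
functions `f(𝐱_1, …, 𝐱_m, z)` that are super-skew-symmetric in the entries of each `𝐱_i` and, if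
`m ≥ 1`, in the `n` arguments `x_m^1, …, x_m^{n-1}, z`. -/
def supercochains (N : ℕ) (𝒢 : ZMod 2 → Submodule K g) (V : Type*) [AddCommGroup V] [Module K V]
    (m : ℕ) : Submodule K (PreCochain N g V m) where
  carrier := {f |
    (∀ (x : Fin m → Fin (N + 1) → g) (z : g) (i : Fin m) (a : Fin (N + 1)),
      IsLinearMap K (fun u => f (Function.update x i (Function.update (x i) a u)) z)) ∧
    (∀ x : Fin m → Fin (N + 1) → g, IsLinearMap K (f x)) ∧
    (∀ (x : Fin m → Fin (N + 1) → g) (z : g) (i : Fin m) (a : Fin N) (p q : ZMod 2),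
      x i a.castSucc ∈ 𝒢 p → x i a.succ ∈ 𝒢 q →
        f x z = -(sgn (p * q) •
          f (Function.update x i (x i ∘ Equiv.swap a.castSucc a.succ)) z)) ∧
    (∀ (x : Fin m → Fin (N + 1) → g) (z : g) (i : Fin m) (p q : ZMod 2), (i : ℕ) + 1 = m →
      x i (Fin.last N) ∈ 𝒢 p → z ∈ 𝒢 q →
        f x z = -(sgn (p * q) •
          f (Function.update x i (Function.update (x i) (Fin.last N) z)) (x i (Fin.last N))))}
  zero_mem' := ⟨fun _ _ _ _ => ⟨by simp, by simp⟩, fun _ => ⟨by simp, by simp⟩, by simp, by simp⟩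
  add_mem' := by
    rintro f f' ⟨h1, h2, h3, h4⟩ ⟨k1, k2, k3, k4⟩
    refine ⟨fun x z i a => ⟨fun u v => ?_, fun c u => ?_⟩, fun x => ⟨fun u v => ?_, fun c u => ?_⟩,
      fun x z i a p q hp hq => ?_, fun x z i p q hi hp hq => ?_⟩
    · simp only [Pi.add_apply, (h1 x z i a).map_add, (k1 x z i a).map_add]; abel
    · simp only [Pi.add_apply, (h1 x z i a).map_smul, (k1 x z i a).map_smul, smul_add]
    · simp only [Pi.add_apply, (h2 x).map_add, (k2 x).map_add]; abel
    · simp only [Pi.add_apply, (h2 x).map_smul, (k2 x).map_smul, smul_add]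
    · simp only [Pi.add_apply]
      rw [h3 x z i a p q hp hq, k3 x z i a p q hp hq, smul_add, neg_add]
    · simp only [Pi.add_apply]
      rw [h4 x z i p q hi hp hq, k4 x z i p q hi hp hq, smul_add, neg_add]
  smul_mem' := by
    rintro r f ⟨h1, h2, h3, h4⟩
    refine ⟨fun x z i a => ⟨fun u v => ?_, fun c u => ?_⟩, fun x => ⟨fun u v => ?_, fun c u => ?_⟩,
      fun x z i a p q hp hq => ?_, fun x z i p q hi hp hq => ?_⟩
    · simp only [Pi.smul_apply, (h1 x z i a).map_add, smul_add]
    · simp only [Pi.smul_apply, (h1 x z i a).map_smul]; rw [smul_comm]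
    · simp only [Pi.smul_apply, (h2 x).map_add, smul_add]
    · simp only [Pi.smul_apply, (h2 x).map_smul]; rw [smul_comm]
    · simp only [Pi.smul_apply]
      rw [h3 x z i a p q hp hq, smul_neg, smul_comm]
    · simp only [Pi.smul_apply]
      rw [h4 x z i p q hi hp hq, smul_neg, smul_comm]

/-- The functions that are homogeneous of degree `α`:
`|f(𝐱_1, …, 𝐱_m, z)| = α + |𝐱_1| + ⋯ + |𝐱_m| + |z|` on homogeneous arguments. -/
def homogeneous (N : ℕ) (𝒢 : ZMod 2 → Submodule K g) (𝒱 : ZMod 2 → Submodule K V) (m : ℕ)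
    (α : ZMod 2) : Submodule K (PreCochain N g V m) where
  carrier := {f | ∀ (d : Fin m → Fin (N + 1) → ZMod 2) (c : ZMod 2)
    (x : Fin m → Fin (N + 1) → g) (z : g), (∀ i a, x i a ∈ 𝒢 (d i a)) → z ∈ 𝒢 c →
      f x z ∈ 𝒱 (α + (∑ i, ∑ a, d i a) + c)}
  zero_mem' := fun _ _ _ _ _ _ => Submodule.zero_mem _
  add_mem' := fun hf hf' d c x z hx hz =>
    Submodule.add_mem _ (hf d c x z hx hz) (hf' d c x z hx hz)
  smul_mem' := fun r _ hf d c x z hx hz => Submodule.smul_mem _ r (hf d c x z hx hz)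

/-- The degree-`α` part `W_α` of a space `W` of cochains, as a subspace of `W`. -/
def degreePart {N : ℕ} (𝒢 : ZMod 2 → Submodule K g) (𝒱 : ZMod 2 → Submodule K V) {m : ℕ}
    (W : Submodule K (PreCochain N g V m)) (α : ZMod 2) : Submodule K W :=
  (homogeneous N 𝒢 𝒱 m α).submoduleOf W

/-- `W` is a graded subspace: it is the direct sum of its parts `W_0` and `W_1`. -/
def IsGraded {N : ℕ} (𝒢 : ZMod 2 → Submodule K g) (𝒱 : ZMod 2 → Submodule K V) {m : ℕ}
    (W : Submodule K (PreCochain N g V m)) : Prop :=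
  DirectSum.IsInternal (degreePart 𝒢 𝒱 W)

variable {N : ℕ} {𝒢 : ZMod 2 → Submodule K g} {𝒱 : ZMod 2 → Submodule K V}

/-- The value `(δf)(𝐱_1, …, 𝐱_{m+1}, z)` for `f` homogeneous of degree `e` and homogeneous arguments
with `|x_i^a| = d i a` and `|z| = c`. All indices count from `0`. -/
def coboundaryFormula {L : FirstClassNLieSuperalgebra K N 𝒢} (R : GradedRep L 𝒱) {m : ℕ}
    (e : ZMod 2) (f : PreCochain N g V m) (d : Fin (m + 1) → Fin (N + 1) → ZMod 2) (c : ZMod 2)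
    (x : Fin (m + 1) → Fin (N + 1) → g) (z : g) : V :=
  -- the terms `f(𝐱_1, …, 𝐱_i omitted, …, 𝐱_i · 𝐱_j, …, 𝐱_{m+1}, z)` with `i < j`
  (∑ i : Fin (m + 1), ∑ j ∈ Finset.Ioi i, ∑ a : Fin (N + 1),
    ((-1 : ℤˣ) ^ ((i : ℕ) + 1) *
      sgn ((∑ b, d i b) * ∑ k ∈ Finset.Ioo i j, ∑ b, d k b) *
      sgn ((∑ b, d i b) * ∑ b ∈ Finset.Iio a, d j b)) •
    f (fun k => Function.update x j (Function.update (x j) a (L.act (x i) (x j a)))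
        (i.succAbove k)) z) +
  -- the terms `f(𝐱_1, …, 𝐱_i omitted, …, 𝐱_{m+1}, 𝐱_i · z)`
  (∑ i : Fin (m + 1),
    ((-1 : ℤˣ) ^ ((i : ℕ) + 1) * sgn ((∑ b, d i b) * ∑ k ∈ Finset.Ioi i, ∑ b, d k b)) •
    f (fun k => x (i.succAbove k)) (L.act (x i) z)) +
  -- the terms `𝐱_i · f(𝐱_1, …, 𝐱_i omitted, …, 𝐱_{m+1}, z)`
  (∑ i : Fin (m + 1),
    ((-1 : ℤˣ) ^ ((i : ℕ) + 2) * sgn ((∑ b, d i b) * (e + ∑ k ∈ Finset.Iio i, ∑ b, d k b))) •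
    R.rho (x i) (f (fun k => x (i.succAbove k)) z)) +
  -- the term `(f(𝐱_1, …, 𝐱_m, -) · 𝐱_{m+1}) · z`
  (-1 : ℤˣ) ^ m • ∑ a : Fin (N + 1),
    sgn ((e + ∑ k : Fin m, ∑ b, d k.castSucc b) *
      ∑ b ∈ Finset.Iio a, d (Fin.last m) b) •
    R.mixedBracket a.castSucc (e + (∑ k : Fin m, ∑ b, d k.castSucc b) + d (Fin.last m) a)
      (Fin.snoc (α := fun _ => ZMod 2) (d (Fin.last m)) c)
      (Fin.snoc (α := fun _ => g) (x (Fin.last m)) z)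
      (f (fun k => x k.castSucc) (x (Fin.last m) a))

theorem coboundaryFormula_add {L : FirstClassNLieSuperalgebra K N 𝒢} (R : GradedRep L 𝒱) {m : ℕ}
    (e : ZMod 2) (f f' : PreCochain N g V m) (d : Fin (m + 1) → Fin (N + 1) → ZMod 2) (c : ZMod 2)
    (x : Fin (m + 1) → Fin (N + 1) → g) (z : g) :
    coboundaryFormula R e (f + f') d c x z =
      coboundaryFormula R e f d c x z + coboundaryFormula R e f' d c x z := by
  simp only [coboundaryFormula, GradedRep.mixedBracket, Pi.add_apply, map_add, smul_add,
    Finset.sum_add_distrib]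
  abel

theorem coboundaryFormula_smul {L : FirstClassNLieSuperalgebra K N 𝒢} (R : GradedRep L 𝒱) {m : ℕ}
    (e : ZMod 2) (r : K) (f : PreCochain N g V m) (d : Fin (m + 1) → Fin (N + 1) → ZMod 2)
    (c : ZMod 2) (x : Fin (m + 1) → Fin (N + 1) → g) (z : g) :
    coboundaryFormula R e (r • f) d c x z = r • coboundaryFormula R e f d c x z := by
  have hc : ∀ (u : ℤˣ) (v : V), u • r • v = r • u • v := fun u v => smul_comm u r v
  simp only [coboundaryFormula, GradedRep.mixedBracket, Pi.smul_apply, map_smul, hc,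
    ← Finset.smul_sum, ← smul_add]

variable [DirectSum.Decomposition 𝒢] [DirectSum.Decomposition 𝒱]

/-- The component of degree `d` of a vector of a graded space. -/
def component {M : Type*} [AddCommGroup M] [Module K M] (ℳ : ZMod 2 → Submodule K M)
    [DirectSum.Decomposition ℳ] (d : ZMod 2) (v : M) : M :=
  (DirectSum.decompose ℳ v d : M)

theorem component_add {M : Type*} [AddCommGroup M] [Module K M] (ℳ : ZMod 2 → Submodule K M)
    [DirectSum.Decomposition ℳ] (d : ZMod 2) (v w : M) :
    component ℳ d (v + w) = component ℳ d v + component ℳ d w := by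
  simp [component, DirectSum.decompose_add]

theorem component_smul {M : Type*} [AddCommGroup M] [Module K M] (ℳ : ZMod 2 → Submodule K M)
    [DirectSum.Decomposition ℳ] (d : ZMod 2) (r : K) (v : M) :
    component ℳ d (r • v) = r • component ℳ d v := by
  simp only [component, DirectSum.decompose_smul]
  rfl

/-- The component of degree `e` of `f`: the part of degree `e + |𝐱_1| + ⋯ + |𝐱_m| + |z|` of
`f(𝐱_1, …, 𝐱_m, z)` on homogeneous arguments, extended multilinearly. -/
def cochainComponent (𝒢 : ZMod 2 → Submodule K g) (𝒱 : ZMod 2 → Submodule K V)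
    [DirectSum.Decomposition 𝒢] [DirectSum.Decomposition 𝒱] {m : ℕ} (e : ZMod 2)
    (f : PreCochain N g V m) : PreCochain N g V m := fun x z =>
  ∑ d : Fin m → Fin (N + 1) → ZMod 2, ∑ c : ZMod 2,
    component 𝒱 (e + (∑ i, ∑ a, d i a) + c)
      (f (fun i a => component 𝒢 (d i a) (x i a)) (component 𝒢 c z))

/-- The coboundary operator `δ`: the linear operator given by `coboundaryFormula` on homogeneous
`f`, `𝐱_i`, `z`, extended to all `f` and all arguments by splitting them into homogeneous
components. -/
def coboundary {L : FirstClassNLieSuperalgebra K N 𝒢} (R : GradedRep L 𝒱) (m : ℕ) :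
    PreCochain N g V m →ₗ[K] PreCochain N g V (m + 1) where
  toFun f := fun x z =>
    ∑ e : ZMod 2, ∑ d : Fin (m + 1) → Fin (N + 1) → ZMod 2, ∑ c : ZMod 2,
      coboundaryFormula R e (cochainComponent 𝒢 𝒱 e f) d c
        (fun i a => component 𝒢 (d i a) (x i a)) (component 𝒢 c z)
  map_add' f f' := by
    have h : ∀ e, cochainComponent 𝒢 𝒱 e (f + f') =
        cochainComponent 𝒢 𝒱 e f + cochainComponent 𝒢 𝒱 e f' := by
      intro e
      funext x z
      simp only [cochainComponent, Pi.add_apply, component_add, Finset.sum_add_distrib]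
    funext x z
    simp only [h, coboundaryFormula_add, Pi.add_apply, Finset.sum_add_distrib]
  map_smul' r f := by
    have h : ∀ e, cochainComponent 𝒢 𝒱 e (r • f) = r • cochainComponent 𝒢 𝒱 e f := by
      intro e
      funext x z
      simp only [cochainComponent, Pi.smul_apply, component_smul, Finset.smul_sum]
    funext x z
    simp only [h, coboundaryFormula_smul, Pi.smul_apply, Finset.smul_sum, RingHom.id_apply]

/-- The supercocycles `Z^m(g, V) = {f ∈ C^m(g, V) | δf = 0}`. -/
def cocycles {L : FirstClassNLieSuperalgebra K N 𝒢} (R : GradedRep L 𝒱) (m : ℕ) :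
    Submodule K (PreCochain N g V m) :=
  supercochains N 𝒢 V m ⊓ LinearMap.ker (coboundary R m)

/-- The supercoboundaries `δ C^{m-1}(g, V)`, with `C^{-1}(g, V) = 0`. -/
def coboundaries {L : FirstClassNLieSuperalgebra K N 𝒢} (R : GradedRep L 𝒱) :
    (m : ℕ) → Submodule K (PreCochain N g V m)
  | 0 => ⊥
  | m + 1 => (supercochains N 𝒢 V m).map (coboundary R m)

/-- The cohomology space `H^m(g, V) = Z^m(g, V) / δ C^{m-1}(g, V)`. -/
abbrev Cohomology {L : FirstClassNLieSuperalgebra K N 𝒢} (R : GradedRep L 𝒱) (m : ℕ) : Type _ :=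
  cocycles R m ⧸ (coboundaries R m).submoduleOf (cocycles R m)

/-- The degree-`α` part of `H^m(g, V)`: the classes of the supercocycles of degree `α`. -/
def cohomologyPart {L : FirstClassNLieSuperalgebra K N 𝒢} (R : GradedRep L 𝒱) (m : ℕ)
    (α : ZMod 2) : Submodule K (Cohomology R m) :=
  (degreePart 𝒢 𝒱 (cocycles R m) α).map ((coboundaries R m).submoduleOf (cocycles R m)).mkQ

end Cochains

end NLieSuper

namespace NLieSuper

set_option linter.unusedSectionVars false

/-! The proof is a super version of Cartan calculus. Write `ι_y` for contraction with a homogeneous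
first tuple `y` (`insertFirst`), `L_y` for the action of the operators of `y` on cochains
(`lieDerivative` applied to `actions R y`), and `δ_e` for the coboundary with the signs of degree
`e` (`homCoboundary`). Separating the summands `i = 1` of the defining formula from the others gives
a recursion on the number of tuples, the Cartan formula `ι_y δ_e = -δ_{e+|y|} ι_y + L_y`. Since a
multilinear function is determined by its contractions, the identities are reduced to fewer tuples
until only a linear map `φ : g → V` is left. There the coboundary is the sum of the `±[y_1, …,
φ(y_a), …, y_n]` minus `φ([y_1, …, y_n])` (`linearCoboundary`).

Three facts carry `δ² = 0`. The super commutator of the operators of `x` and `y` is the operator of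
`x · y` (`actions_comm`, from the Filippov identity and the first module axiom). Hence `L_x`
commutes with `δ` (`lieDerivative_homCoboundary`), by induction from linear maps. Then `ι_y δ δ f =
-δ ι_y δ f + δ L_y f`. If `f` has at least one tuple, a second use of the Cartan formula turns this
into `δ δ ι_y f`, which vanishes by induction. If `f` has none, the expression is `δ(L_y f - ι_y δ
f)`, and `L_y f - ι_y δ f` is a sum of maps `z ↦ ±ρ(y_1, …, ŷ_a, …, y_{n-1}, z) f(y_a)`; these are
cocycles by the second module axiom (`linearCoboundary_inner_term`).

In these identities `e` is only a parameter in the signs, and no skew-symmetry of the cochain is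
used: they hold for every multilinear function and every `e`. Skew-symmetry of `δf` follows from the
Cartan formula and from the skew-symmetry of the coboundary of a linear map. For the gradings, every
multilinear function is the sum of its two homogeneous components, and taking components preserves
supercochains and commutes with `δ`, hence preserves cocycles and coboundaries. -/

theorem sgn_add (a b : ZMod 2) : sgn (a + b) = sgn a * sgn b := by
  revert a b; decide

@[simp] theorem sgn_zero : sgn 0 = 1 := by decide

theorem sgn_mul_self (a : ZMod 2) : sgn a * sgn a = 1 := by
  revert a; decide

theorem sgn_smul_sgn_smul {M : Type*} [AddCommGroup M] (a b : ZMod 2) (v : M) :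
    sgn a • sgn b • v = sgn (a + b) • v := by
  rw [smul_smul, sgn_add]

theorem map_units_smul {F M M' : Type*} [AddCommGroup M] [AddCommGroup M'] [FunLike F M M']
    [AddMonoidHomClass F M M'] (f : F) (u : ℤˣ) (v : M) : f (u • v) = u • f v := by
  rcases Int.units_eq_one_or u with rfl | rfl <;> simp

theorem units_smul_mem {R M : Type*} [Ring R] [AddCommGroup M] [Module R M] (S : Submodule R M)
    (u : ℤˣ) {v : M} (hv : v ∈ S) : u • v ∈ S := by
  rcases Int.units_eq_one_or u with rfl | rfl <;> simpa

/-! ### Homogeneous components of vectors -/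

section Components

variable {K : Type*} [Field K] {M : Type*} [AddCommGroup M] [Module K M]
  (ℳ : ZMod 2 → Submodule K M) [DirectSum.Decomposition ℳ]

theorem component_mem (d : ZMod 2) (v : M) : component ℳ d v ∈ ℳ d :=
  (DirectSum.decompose ℳ v d).2

theorem sum_component (v : M) : ∑ d, component ℳ d v = v := by
  classical
  conv_rhs => rw [← DirectSum.sum_support_decompose ℳ v]
  refine (Finset.sum_subset (Finset.subset_univ _) fun d _ hd => ?_).symm
  simpa [component] using hd

theorem component_of_mem {d : ZMod 2} {v : M} (hv : v ∈ ℳ d) : component ℳ d v = v :=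
  DirectSum.decompose_of_mem_same ℳ hv

theorem component_of_mem_ne {d e : ZMod 2} {v : M} (hv : v ∈ ℳ d) (h : d ≠ e) :
    component ℳ e v = 0 :=
  DirectSum.decompose_of_mem_ne ℳ hv h

end Components

/-! ### Multilinear cochains: reduction to homogeneous arguments and contraction with the first
tuple -/

section Multilinear

variable {K : Type*} [Field K] {g : Type*} [AddCommGroup g] [Module K g]
  {V : Type*} [AddCommGroup V] [Module K V]

/-- The multilinear functions of the entries of `𝐱_1, …, 𝐱_m` and of `z`. -/
def multilinearCochains (K : Type*) [Field K] (N : ℕ) (g : Type*) [AddCommGroup g] [Module K g]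
    (V : Type*) [AddCommGroup V] [Module K V] (m : ℕ) : Submodule K (PreCochain N g V m) where
  carrier := {f |
    (∀ (x : Fin m → Fin (N + 1) → g) (z : g) (i : Fin m) (a : Fin (N + 1)),
      IsLinearMap K (fun u => f (Function.update x i (Function.update (x i) a u)) z)) ∧
    (∀ x : Fin m → Fin (N + 1) → g, IsLinearMap K (f x))}
  zero_mem' := ⟨fun _ _ _ _ => ⟨by simp, by simp⟩, fun _ => ⟨by simp, by simp⟩⟩
  add_mem' := by
    rintro f f' ⟨h1, h2⟩ ⟨k1, k2⟩
    refine ⟨fun x z i a => ⟨fun u v => ?_, fun c u => ?_⟩, fun x => ⟨fun u v => ?_, fun c u => ?_⟩⟩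
    · simp only [Pi.add_apply, (h1 x z i a).map_add, (k1 x z i a).map_add]; abel
    · simp only [Pi.add_apply, (h1 x z i a).map_smul, (k1 x z i a).map_smul, smul_add]
    · simp only [Pi.add_apply, (h2 x).map_add, (k2 x).map_add]; abel
    · simp only [Pi.add_apply, (h2 x).map_smul, (k2 x).map_smul, smul_add]
  smul_mem' := by
    rintro r f ⟨h1, h2⟩
    refine ⟨fun x z i a => ⟨fun u v => ?_, fun c u => ?_⟩, fun x => ⟨fun u v => ?_, fun c u => ?_⟩⟩
    · simp only [Pi.smul_apply, (h1 x z i a).map_add, smul_add]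
    · simp only [Pi.smul_apply, (h1 x z i a).map_smul]; rw [smul_comm]
    · simp only [Pi.smul_apply, (h2 x).map_add, smul_add]
    · simp only [Pi.smul_apply, (h2 x).map_smul]; rw [smul_comm]

variable {N m : ℕ}

theorem supercochains_le_multilinear (𝒢 : ZMod 2 → Submodule K g) :
    supercochains N 𝒢 V m ≤ multilinearCochains K N g V m :=
  fun _ hf => ⟨hf.1, hf.2.1⟩

/-- A multilinear function of `𝐱_1, …, 𝐱_m, z`, as a multilinear map on a single family. -/
def toMultilinearMap (f : PreCochain N g V m) (hf : f ∈ multilinearCochains K N g V m) :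
    MultilinearMap K (fun _ : Option (Fin m × Fin (N + 1)) => g) V :=
  MultilinearMap.mk' (fun w => f (fun i a => w (some (i, a))) (w none))
    (by
      have key : ∀ (w : Option (Fin m × Fin (N + 1)) → g) (i : Fin m) (a : Fin (N + 1)) (u : g),
          (fun i' a' => Function.update w (some (i, a)) u (some (i', a'))) =
            Function.update (fun i' a' => w (some (i', a'))) i
              (Function.update (fun a' => w (some (i, a'))) a u) := by
        intro w i a u
        funext i' a'
        by_cases hi : i' = i
        · subst hi
          by_cases ha : a' = a
          · subst ha; simp
          · simp [ha]
        · simp [hi]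
      rintro w (_ | ⟨i, a⟩) u v
      · simpa using (hf.2 _).map_add u v
      · simp only [key]
        simpa using (hf.1 (fun i a => w (some (i, a))) (w none) i a).map_add u v)
    (by
      have key : ∀ (w : Option (Fin m × Fin (N + 1)) → g) (i : Fin m) (a : Fin (N + 1)) (u : g),
          (fun i' a' => Function.update w (some (i, a)) u (some (i', a'))) =
            Function.update (fun i' a' => w (some (i', a'))) i
              (Function.update (fun a' => w (some (i, a'))) a u) := by
        intro w i a u
        funext i' a'
        by_cases hi : i' = i
        · subst hi
          by_cases ha : a' = a
          · subst ha; simp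
          · simp [ha]
        · simp [hi]
      rintro w (_ | ⟨i, a⟩) c u
      · simpa using (hf.2 _).map_smul c u
      · simp only [key]
        simpa using (hf.1 (fun i a => w (some (i, a))) (w none) i a).map_smul c u)

theorem toMultilinearMap_apply (f : PreCochain N g V m) (hf : f ∈ multilinearCochains K N g V m)
    (w : Option (Fin m × Fin (N + 1)) → g) :
    toMultilinearMap f hf w = f (fun i a => w (some (i, a))) (w none) := rfl

variable (𝒢 : ZMod 2 → Submodule K g) [DirectSum.Decomposition 𝒢]

/-- All entries are expanded at once, which is why the arguments are gathered into one family. -/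
theorem multilinear_eq_sum_component {f : PreCochain N g V m}
    (hf : f ∈ multilinearCochains K N g V m) (x : Fin m → Fin (N + 1) → g) (z : g) :
    f x z = ∑ d : Fin m → Fin (N + 1) → ZMod 2, ∑ c : ZMod 2,
      f (fun i a => component 𝒢 (d i a) (x i a)) (component 𝒢 c z) := by
  -- The index `none` stands for the last argument `z`, and `some (i, a)` for the entry `x_i^a`.
  let w : Option (Fin m × Fin (N + 1)) → g := fun o => o.elim z fun p => x p.1 p.2
  have h := (toMultilinearMap f hf).map_sum (fun o (c : ZMod 2) => component 𝒢 c (w o))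
  simp only [sum_component] at h
  rw [toMultilinearMap_apply] at h
  refine h.trans ?_
  rw [← Finset.sum_product', Finset.univ_product_univ]
  refine Fintype.sum_equiv ((Equiv.piOptionEquivProd.trans
    (Equiv.prodComm _ _)).trans ((Equiv.curry _ _ _).prodCongr (Equiv.refl _))) _ _ fun r => ?_
  rfl

theorem multilinear_apply_eq_zero {f : PreCochain N g V m}
    (hf : f ∈ multilinearCochains K N g V m) {x : Fin m → Fin (N + 1) → g} {z : g}
    {i : Fin m} {a : Fin (N + 1)} (h : x i a = 0) : f x z = 0 := by
  have := (toMultilinearMap f hf).map_coord_zero (m := fun o => o.elim z fun p => x p.1 p.2)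
    (some (i, a)) h
  exact this

/-- The signs make sense only on homogeneous arguments, so identities between cochains are checked
there; multilinearity does the rest. -/
theorem multilinear_ext {f f' : PreCochain N g V m}
    (hf : f ∈ multilinearCochains K N g V m) (hf' : f' ∈ multilinearCochains K N g V m)
    (h : ∀ (d : Fin m → Fin (N + 1) → ZMod 2) (c : ZMod 2) (x : Fin m → Fin (N + 1) → g) (z : g),
      (∀ i a, x i a ∈ 𝒢 (d i a)) → z ∈ 𝒢 c → f x z = f' x z) : f = f' := by
  funext x z
  rw [multilinear_eq_sum_component 𝒢 hf, multilinear_eq_sum_component 𝒢 hf']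
  exact Finset.sum_congr rfl fun d _ => Finset.sum_congr rfl fun c _ =>
    h d c _ _ (fun i a => component_mem 𝒢 _ _) (component_mem 𝒢 _ _)

/-- The function of all arguments that is given by `Φ d c` on the homogeneous arguments of
degrees `d` and `c`. -/
def extend (Φ : (Fin m → Fin (N + 1) → ZMod 2) → ZMod 2 → PreCochain N g V m) :
    PreCochain N g V m := fun x z =>
  ∑ d : Fin m → Fin (N + 1) → ZMod 2, ∑ c : ZMod 2,
    Φ d c (fun i a => component 𝒢 (d i a) (x i a)) (component 𝒢 c z)

theorem update_component (d : Fin m → Fin (N + 1) → ZMod 2) (x : Fin m → Fin (N + 1) → g)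
    (i : Fin m) (a : Fin (N + 1)) (u : g) :
    (fun i' a' => component 𝒢 (d i' a')
      (Function.update x i (Function.update (x i) a u) i' a')) =
    Function.update (fun i' a' => component 𝒢 (d i' a') (x i' a')) i
      (Function.update (fun a' => component 𝒢 (d i a') (x i a')) a (component 𝒢 (d i a) u)) := by
  funext i' a'
  by_cases hi : i' = i
  · subst hi
    by_cases ha : a' = a
    · subst ha; simp
    · simp [ha]
  · simp [hi]

theorem component_comp_mem {f : PreCochain N g V m} (hf : f ∈ multilinearCochains K N g V m)
    (d : Fin m → Fin (N + 1) → ZMod 2) (c : ZMod 2) :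
    (fun x z => f (fun i a => component 𝒢 (d i a) (x i a)) (component 𝒢 c z)) ∈
      multilinearCochains K N g V m := by
  refine ⟨fun x z i a => ⟨fun u v => ?_, fun r u => ?_⟩, fun x => ⟨fun u v => ?_, fun r u => ?_⟩⟩
  · simp only [update_component, component_add]
    exact (hf.1 (fun i' a' => component 𝒢 (d i' a') (x i' a')) _ i a).map_add _ _
  · simp only [update_component, component_smul]
    exact (hf.1 (fun i' a' => component 𝒢 (d i' a') (x i' a')) _ i a).map_smul _ _
  · simp only [component_add]
    exact (hf.2 _).map_add _ _
  · simp only [component_smul]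
    exact (hf.2 _).map_smul _ _

variable {Φ : (Fin m → Fin (N + 1) → ZMod 2) → ZMod 2 → PreCochain N g V m}

theorem extend_mem (hΦ : ∀ d c, Φ d c ∈ multilinearCochains K N g V m) :
    extend 𝒢 Φ ∈ multilinearCochains K N g V m := by
  have : extend 𝒢 Φ = ∑ d, ∑ c, fun x z =>
      Φ d c (fun i a => component 𝒢 (d i a) (x i a)) (component 𝒢 c z) := by
    funext x z
    simp only [extend, Finset.sum_apply]
  rw [this]
  exact Submodule.sum_mem _ fun d _ => Submodule.sum_mem _ fun c _ =>
    component_comp_mem 𝒢 (hΦ d c) d c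

/-- On homogeneous arguments every other degree pattern assigns some entry a degree that it does not
have; that component is zero, and so is the summand. -/
theorem extend_apply (hΦ : ∀ d c, Φ d c ∈ multilinearCochains K N g V m)
    {d : Fin m → Fin (N + 1) → ZMod 2} {c : ZMod 2} {x : Fin m → Fin (N + 1) → g} {z : g}
    (hx : ∀ i a, x i a ∈ 𝒢 (d i a)) (hz : z ∈ 𝒢 c) : extend 𝒢 Φ x z = Φ d c x z := by
  unfold extend
  rw [Finset.sum_eq_single d, Finset.sum_eq_single c]
  · rw [component_of_mem 𝒢 hz]
    congr 1
    funext i a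
    exact component_of_mem 𝒢 (hx i a)
  · intro c' _ hc
    rw [component_of_mem_ne 𝒢 hz hc.symm]
    exact ((hΦ d c').2 _).map_zero
  · simp
  · intro d' _ hd
    refine Finset.sum_eq_zero fun c' _ => ?_
    obtain ⟨i, hi⟩ := Function.ne_iff.1 hd
    obtain ⟨a, ha⟩ := Function.ne_iff.1 hi
    exact multilinear_apply_eq_zero (hΦ d' c') (i := i) (a := a)
      (component_of_mem_ne 𝒢 (hx i a) (Ne.symm ha))
  · simp

/-- Fixing the first tuple `𝐱_1`. -/
def insertFirst (K : Type*) [Field K] {N : ℕ} {g : Type*} {V : Type*} [AddCommGroup V]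
    [Module K V] {m : ℕ} (y : Fin (N + 1) → g) :
    PreCochain N g V (m + 1) →ₗ[K] PreCochain N g V m where
  toFun f := fun x z => f (Fin.cons y x) z
  map_add' _ _ := rfl
  map_smul' _ _ := rfl

theorem insertFirst_apply (y : Fin (N + 1) → g) (f : PreCochain N g V (m + 1))
    (x : Fin m → Fin (N + 1) → g) (z : g) : insertFirst K y f x z = f (Fin.cons y x) z := rfl

theorem insertFirst_tail (x : Fin (m + 1) → Fin (N + 1) → g) (f : PreCochain N g V (m + 1))
    (z : g) : insertFirst K (x 0) f (Fin.tail x) z = f x z := by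
  rw [insertFirst_apply, Fin.cons_self_tail]

theorem insertFirst_mem {f : PreCochain N g V (m + 1)}
    (hf : f ∈ multilinearCochains K N g V (m + 1)) (y : Fin (N + 1) → g) :
    insertFirst K y f ∈ multilinearCochains K N g V m := by
  refine ⟨fun x z i a => ?_, fun x => hf.2 _⟩
  have := hf.1 (Fin.cons y x) z i.succ a
  simpa only [insertFirst_apply, Fin.cons_update, Fin.cons_succ] using this

theorem isLinearMap_insertFirst {f : PreCochain N g V (m + 1)}
    (hf : f ∈ multilinearCochains K N g V (m + 1)) (y : Fin (N + 1) → g) (a : Fin (N + 1)) :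
    IsLinearMap K (fun u => insertFirst K (Function.update y a u) f) := by
  have key : ∀ (x : Fin m → Fin (N + 1) → g) (u : g), (Fin.cons (Function.update y a u) x :
      Fin (m + 1) → Fin (N + 1) → g) =
      Function.update (Fin.cons y x : Fin (m + 1) → Fin (N + 1) → g) 0
        (Function.update ((Fin.cons y x : Fin (m + 1) → Fin (N + 1) → g) 0) a u) := by
    intro x u
    rw [Fin.update_cons_zero, Fin.cons_zero]
  constructor
  · intro u v
    funext x z
    simp only [Pi.add_apply, insertFirst_apply, key]
    exact (hf.1 _ _ _ _).map_add _ _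
  · intro r u
    funext x z
    simp only [Pi.smul_apply, insertFirst_apply, key]
    exact (hf.1 _ _ _ _).map_smul _ _

/-- This is what makes induction on the number of tuples possible: only contractions with
homogeneous tuples have to be compared. -/
theorem multilinear_ext_insertFirst {f f' : PreCochain N g V (m + 1)}
    (hf : f ∈ multilinearCochains K N g V (m + 1))
    (hf' : f' ∈ multilinearCochains K N g V (m + 1))
    (h : ∀ (d : Fin (N + 1) → ZMod 2) (y : Fin (N + 1) → g), (∀ a, y a ∈ 𝒢 (d a)) →
      insertFirst K y f = insertFirst K y f') : f = f' := by
  refine multilinear_ext 𝒢 hf hf' fun d c x z hx hz => ?_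
  rw [← insertFirst_tail (K := K) x f, h (d 0) (x 0) (hx 0), insertFirst_tail]

/-- Multilinearity in `𝐱_1` and in the other arguments. -/
theorem mem_multilinear_of_insertFirst {f : PreCochain N g V (m + 1)}
    (h : ∀ y, insertFirst K y f ∈ multilinearCochains K N g V m)
    (h' : ∀ y a, IsLinearMap K (fun u => insertFirst K (Function.update y a u) f)) :
    f ∈ multilinearCochains K N g V (m + 1) := by
  refine ⟨fun x z i a => ?_, fun x => ?_⟩
  · induction i using Fin.cases with
    | zero =>
      have key : ∀ u : g, f (Function.update x 0 (Function.update (x 0) a u)) z =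
          insertFirst K (Function.update (x 0) a u) f (Fin.tail x) z := by
        intro u
        rw [insertFirst_apply]
        congr 1
        conv_lhs => rw [← Fin.cons_self_tail x, Fin.update_cons_zero]
        simp
      have h1 := h' (x 0) a
      constructor
      · intro u v
        simp only [key]
        rw [h1.map_add]; rfl
      · intro u v
        simp only [key]
        rw [h1.map_smul]; rfl
    | succ i =>
      have h1 := (h (x 0)).1 (Fin.tail x) z i a
      have key : ∀ u : g, f (Function.update x i.succ (Function.update (x i.succ) a u)) z =
          insertFirst K (x 0) f (Function.update (Fin.tail x) i
            (Function.update (Fin.tail x i) a u)) z := by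
        intro u
        rw [insertFirst_apply, Fin.cons_update, Fin.cons_self_tail]; rfl
      simp only [key]
      exact h1
  · have h1 := (h (x 0)).2 (Fin.tail x)
    have key : f x = insertFirst K (x 0) f (Fin.tail x) := by
      funext z; rw [insertFirst_tail]
    rw [key]; exact h1

end Multilinear

/-! ### Operators acting as derivations on tuples -/

section TupleDerivation

variable {K : Type*} [Field K] {g : Type*} [AddCommGroup g] [Module K g]
  {W : Type*} [AddCommGroup W] [Module K W] {k : ℕ}

/-- `F` is linear in each entry. -/
def LinearInEntries (K : Type*) [Field K] {g : Type*} [AddCommGroup g] [Module K g]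
    {W : Type*} [AddCommGroup W] [Module K W] {k : ℕ} (F : (Fin k → g) → W) : Prop :=
  ∀ y b, IsLinearMap K fun u => F (Function.update y b u)

theorem linearInEntries_multilinearMap (F : MultilinearMap K (fun _ : Fin k => g) W) :
    LinearInEntries K F := fun y b => ⟨F.map_update_add y b, F.map_update_smul y b⟩

theorem LinearInEntries.comp {W' : Type*} [AddCommGroup W'] [Module K W'] {F : (Fin k → g) → W}
    (hF : LinearInEntries K F) {G : W → W'} (hG : IsLinearMap K G) :
    LinearInEntries K fun y => G (F y) := fun y b => by
  constructor
  · intro u v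
    dsimp only
    rw [(hF y b).map_add, hG.map_add]
  · intro c u
    dsimp only
    rw [(hF y b).map_smul, hG.map_smul]

theorem LinearInEntries.add {F G : (Fin k → g) → W} (hF : LinearInEntries K F)
    (hG : LinearInEntries K G) : LinearInEntries K fun y => F y + G y := fun y b => by
  constructor
  · intro u v
    dsimp only
    rw [(hF y b).map_add, (hG y b).map_add]; abel
  · intro c u
    dsimp only
    rw [(hF y b).map_smul, (hG y b).map_smul, smul_add]

theorem LinearInEntries.units_smul {F : (Fin k → g) → W} (hF : LinearInEntries K F) (u : ℤˣ) :
    LinearInEntries K fun y => u • F y :=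
  hF.comp ⟨smul_add u, fun c v => smul_comm u c v⟩

theorem LinearInEntries.neg {F : (Fin k → g) → W} (hF : LinearInEntries K F) :
    LinearInEntries K fun y => -F y :=
  hF.comp ⟨neg_add, fun c v => (smul_neg c v).symm⟩

theorem LinearInEntries.sub {F G : (Fin k → g) → W} (hF : LinearInEntries K F)
    (hG : LinearInEntries K G) : LinearInEntries K fun y => F y - G y := by
  simpa only [sub_eq_add_neg] using hF.add hG.neg

theorem LinearInEntries.sum {ι : Type*} (s : Finset ι) {F : ι → (Fin k → g) → W}
    (hF : ∀ i, LinearInEntries K (F i)) : LinearInEntries K fun y => ∑ i ∈ s, F i y := by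
  intro y b
  constructor
  · intro u v
    simp only [(hF _ y b).map_add, Finset.sum_add_distrib]
  · intro c u
    simp only [(hF _ y b).map_smul, Finset.smul_sum]

/-- The action of the operator `A` of degree `p` on `y_1 ∧ ⋯ ∧ y_k`, composed with `F`. -/
def tupleDeriv (p : ZMod 2) (A : Module.End K g) (d : Fin k → ZMod 2) (F : (Fin k → g) → W)
    (y : Fin k → g) : W :=
  ∑ a, sgn (p * ∑ b ∈ Finset.Iio a, d b) • F (Function.update y a (A (y a)))

theorem LinearInEntries.update_apply {F : (Fin k → g) → W} (hF : LinearInEntries K F)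
    (A : Module.End K g) (a : Fin k) :
    LinearInEntries K fun y => F (Function.update y a (A (y a))) := by
  intro y b
  by_cases h : b = a
  · subst h
    simp only [Function.update_self, Function.update_idem]
    constructor
    · intro u v
      rw [map_add, (hF y b).map_add]
    · intro c u
      rw [map_smul, (hF y b).map_smul]
  · simp only [Function.update_of_ne (Ne.symm h), Function.update_comm h]
    exact hF _ b

theorem LinearInEntries.tupleDeriv {F : (Fin k → g) → W} (hF : LinearInEntries K F)
    (p : ZMod 2) (A : Module.End K g) (d : Fin k → ZMod 2) :
    LinearInEntries K (NLieSuper.tupleDeriv p A d F) :=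
  LinearInEntries.sum _ fun a => (hF.update_apply A a).units_smul _

theorem map_tupleDeriv {W' : Type*} [AddCommGroup W'] [Module K W'] (G : W →ₗ[K] W')
    (p : ZMod 2) (A : Module.End K g) (d : Fin k → ZMod 2) (F : (Fin k → g) → W)
    (y : Fin k → g) :
    G (tupleDeriv p A d F y) = tupleDeriv p A d (fun y => G (F y)) y := by
  simp only [tupleDeriv, map_sum, map_units_smul]

end TupleDerivation

/-! ### Lie action and coboundary at fixed degrees, by recursion on the number of tuples -/

section Operators

variable {K : Type*} [Field K] {g : Type*} [AddCommGroup g] [Module K g]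
  {V : Type*} [AddCommGroup V] [Module K V] {N : ℕ}

theorem linearInEntries_insertFirst {m : ℕ} {f : PreCochain N g V (m + 1)}
    (hf : f ∈ multilinearCochains K N g V (m + 1)) :
    LinearInEntries K fun y => insertFirst K y f :=
  fun y b => isLinearMap_insertFirst hf y b

/-- The action of a pair of operators of degree `p` on `g` and on `V` on functions of degree `e`,
evaluated at homogeneous arguments of degrees `d`. -/
def lieFormula (p : ZMod 2) (T : Module.End K g × Module.End K V) :
    (m : ℕ) → ZMod 2 → PreCochain N g V m → (Fin m → Fin (N + 1) → ZMod 2) → PreCochain N g V m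
  | 0, e, f, _ => fun x z => sgn (p * e) • T.2 (f x z) - f x (T.1 z)
  | m + 1, e, f, d => fun x z =>
      sgn (p * ∑ b, d 0 b) • lieFormula p T m (e + ∑ b, d 0 b) (insertFirst K (x 0) f)
          (Fin.tail d) (Fin.tail x) z -
        tupleDeriv p T.1 (d 0) (fun y => insertFirst K y f) (x 0) (Fin.tail x) z

theorem lieFormula_add (p : ZMod 2) (T : Module.End K g × Module.End K V) {m : ℕ} (e : ZMod 2)
    (f f' : PreCochain N g V m) (d : Fin m → Fin (N + 1) → ZMod 2) :
    lieFormula p T m e (f + f') d = lieFormula p T m e f d + lieFormula p T m e f' d := by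
  induction m generalizing e with
  | zero =>
    funext x z
    simp only [lieFormula, Pi.add_apply, map_add, smul_add]; abel
  | succ m ih =>
    funext x z
    simp only [lieFormula, map_add, ih, Pi.add_apply, smul_add, tupleDeriv,
      Finset.sum_add_distrib]
    abel

theorem lieFormula_smul (p : ZMod 2) (T : Module.End K g × Module.End K V) {m : ℕ} (e : ZMod 2)
    (r : K) (f : PreCochain N g V m) (d : Fin m → Fin (N + 1) → ZMod 2) :
    lieFormula p T m e (r • f) d = r • lieFormula p T m e f d := by
  induction m generalizing e with
  | zero =>
    funext x z
    simp only [lieFormula, Pi.smul_apply, map_smul, smul_sub, smul_comm r]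
  | succ m ih =>
    funext x z
    simp only [lieFormula, map_smul, ih, Pi.smul_apply, tupleDeriv, smul_comm _ r,
      ← Finset.smul_sum, smul_sub]

/-- Unlike additivity in `f`, this needs `f` multilinear, because the operator on `g` acts inside
its arguments. -/
theorem lieFormula_op_add (p : ZMod 2) (T T' : Module.End K g × Module.End K V) {m : ℕ}
    (e : ZMod 2) {f : PreCochain N g V m} (hf : f ∈ multilinearCochains K N g V m)
    (d : Fin m → Fin (N + 1) → ZMod 2) :
    lieFormula p (T + T') m e f d = lieFormula p T m e f d + lieFormula p T' m e f d := by
  induction m generalizing e with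
  | zero =>
    funext x z
    simp only [lieFormula, Pi.add_apply, Prod.fst_add, Prod.snd_add, LinearMap.add_apply,
      (hf.2 x).map_add, smul_add]
    abel
  | succ m ih =>
    funext x z
    simp only [lieFormula, ih _ (insertFirst_mem hf _), Pi.add_apply, smul_add, tupleDeriv,
      Prod.fst_add, LinearMap.add_apply, (isLinearMap_insertFirst hf _ _).map_add,
      Finset.sum_add_distrib]
    abel

theorem lieFormula_op_smul (p : ZMod 2) (T : Module.End K g × Module.End K V) {m : ℕ}
    (e : ZMod 2) (r : K) {f : PreCochain N g V m} (hf : f ∈ multilinearCochains K N g V m)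
    (d : Fin m → Fin (N + 1) → ZMod 2) :
    lieFormula p (r • T) m e f d = r • lieFormula p T m e f d := by
  induction m generalizing e with
  | zero =>
    funext x z
    simp only [lieFormula, Pi.smul_apply, Prod.smul_fst, Prod.smul_snd, LinearMap.smul_apply,
      (hf.2 x).map_smul, smul_sub, smul_comm r]
  | succ m ih =>
    funext x z
    simp only [lieFormula, ih _ (insertFirst_mem hf _), Pi.smul_apply, tupleDeriv,
      Prod.smul_fst, LinearMap.smul_apply, (isLinearMap_insertFirst hf _ _).map_smul,
      smul_comm _ r, ← Finset.smul_sum, smul_sub]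

/-- The Leibniz rule: the operator either passes the contracted tuple, at the cost of a sign and a
shift of the degree of `f`, or acts on that tuple. -/
theorem insertFirst_lieFormula (p : ZMod 2) (T : Module.End K g × Module.End K V) {m : ℕ}
    (e : ZMod 2) (f : PreCochain N g V (m + 1)) (d : Fin (m + 1) → Fin (N + 1) → ZMod 2)
    (y : Fin (N + 1) → g) :
    insertFirst K y (lieFormula p T (m + 1) e f d) =
      sgn (p * ∑ b, d 0 b) • lieFormula p T m (e + ∑ b, d 0 b) (insertFirst K y f) (Fin.tail d) -
        tupleDeriv p T.1 (d 0) (fun y => insertFirst K y f) y := by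
  funext x z
  simp only [insertFirst_apply, lieFormula, Fin.cons_zero, Fin.tail_cons, Pi.sub_apply,
    Pi.smul_apply]

theorem isLinearMap_lieFormula (p : ZMod 2) (T : Module.End K g × Module.End K V) {m : ℕ}
    (e : ZMod 2) (d : Fin m → Fin (N + 1) → ZMod 2) :
    IsLinearMap K fun f : PreCochain N g V m => lieFormula p T m e f d :=
  ⟨fun f f' => lieFormula_add p T e f f' d, fun r f => lieFormula_smul p T e r f d⟩

theorem lieFormula_mem (p : ZMod 2) (T : Module.End K g × Module.End K V) {m : ℕ}
    (e : ZMod 2) {f : PreCochain N g V m} (hf : f ∈ multilinearCochains K N g V m)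
    (d : Fin m → Fin (N + 1) → ZMod 2) :
    lieFormula p T m e f d ∈ multilinearCochains K N g V m := by
  induction m generalizing e with
  | zero =>
    refine ⟨fun x z i => i.elim0, fun x => ⟨fun u v => ?_, fun r u => ?_⟩⟩
    · simp only [lieFormula, map_add, (hf.2 x).map_add, smul_add]; abel
    · simp only [lieFormula, map_smul, (hf.2 x).map_smul, smul_sub, smul_comm r]
  | succ m ih =>
    refine mem_multilinear_of_insertFirst (fun y => ?_) ?_
    · rw [insertFirst_lieFormula]
      exact Submodule.sub_mem _ (units_smul_mem _ _ (ih _ (insertFirst_mem hf y) _))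
        (Submodule.sum_mem _ fun a _ => units_smul_mem _ _ (insertFirst_mem hf _))
    · simp only [insertFirst_lieFormula]
      exact (((linearInEntries_insertFirst hf).comp
        (isLinearMap_lieFormula p T _ _)).units_smul _).sub
        ((linearInEntries_insertFirst hf).tupleDeriv p T.1 _)

variable {𝒢 : ZMod 2 → Submodule K g} {𝒱 : ZMod 2 → Submodule K V}
  {L : FirstClassNLieSuperalgebra K N 𝒢} (R : GradedRep L 𝒱)

/-- The operators `𝐱 · z` on `g` and `ρ(𝐱)` on `V`. -/
def actions : MultilinearMap K (fun _ : Fin (N + 1) => g) (Module.End K g × Module.End K V) :=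
  MultilinearMap.prod (L.bracket.curryRight) R.rho

theorem actions_fst_apply (x : Fin (N + 1) → g) (z : g) :
    (actions R x).1 z = L.bracket (Fin.snoc (α := fun _ => g) x z) := rfl

theorem actions_snd (x : Fin (N + 1) → g) : (actions R x).2 = R.rho x := rfl

/-- The coboundary of the linear map `φ : g → V` of degree `e` at homogeneous arguments
`y_1, …, y_n` of degrees `d`. -/
def linearCoboundary (e : ZMod 2) (φ : g → V) (d : Fin (N + 2) → ZMod 2) (y : Fin (N + 2) → g) :
    V :=
  ∑ a, sgn (e * ∑ b ∈ Finset.Iio a, d b) • R.mixedBracket a (e + d a) d y (φ (y a)) -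
    φ (L.bracket y)

theorem linearInEntries_linearCoboundary (e : ZMod 2) {φ : g → V} (hφ : IsLinearMap K φ)
    (d : Fin (N + 2) → ZMod 2) : LinearInEntries K (linearCoboundary R e φ d) := by
  refine (LinearInEntries.sum _ fun a => LinearInEntries.units_smul
    (LinearInEntries.units_smul ?_ _) _).sub ((linearInEntries_multilinearMap L.bracket).comp hφ)
  intro y b
  induction b using Fin.succAboveCases a with
  | x =>
    have : ∀ u, (fun k => Function.update y a u (a.succAbove k)) = fun k => y (a.succAbove k) := by
      intro u; funext k; simp
    simp only [this, Function.update_self]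
    constructor
    · intro u v
      rw [hφ.map_add, map_add]
    · intro r u
      rw [hφ.map_smul, map_smul]
  | p b =>
    have : ∀ u, (fun k => Function.update y (a.succAbove b) u (a.succAbove k)) =
        Function.update (fun k => y (a.succAbove k)) b u := by
      intro u; funext k
      by_cases h : k = b
      · subst h; simp
      · simp [h]
    simp only [this, ne_eq, (Fin.succAbove_ne a b).symm, not_false_eq_true,
      Function.update_of_ne]
    constructor
    · intro u v
      rw [MultilinearMap.map_update_add]; rfl
    · intro r u
      rw [MultilinearMap.map_update_smul]; rfl

/-- The coboundary formula, by recursion on the number of arguments. -/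
def recFormula : (m : ℕ) → ZMod 2 → PreCochain N g V m → (Fin (m + 1) → Fin (N + 1) → ZMod 2) →
    ZMod 2 → PreCochain N g V (m + 1)
  | 0, e, f, d, c => fun x z => linearCoboundary R e (f Fin.elim0)
      (Fin.snoc (α := fun _ => ZMod 2) (d 0) c) (Fin.snoc (α := fun _ => g) (x 0) z)
  | m + 1, e, f, d, c => fun x z =>
      -recFormula m (e + ∑ b, d 0 b) (insertFirst K (x 0) f) (Fin.tail d) c (Fin.tail x) z +
        lieFormula (∑ b, d 0 b) (actions R (x 0)) (m + 1) e f (Fin.tail d) (Fin.tail x) z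

/-- The Cartan formula before the degrees are summed over; contraction with `y` shifts the degree of
`f` by `|y|`. -/
theorem insertFirst_recFormula {m : ℕ} (e : ZMod 2) (f : PreCochain N g V (m + 1))
    (d : Fin (m + 2) → Fin (N + 1) → ZMod 2) (c : ZMod 2) (y : Fin (N + 1) → g) :
    insertFirst K y (recFormula R (m + 1) e f d c) =
      -recFormula R m (e + ∑ b, d 0 b) (insertFirst K y f) (Fin.tail d) c +
        lieFormula (∑ b, d 0 b) (actions R y) (m + 1) e f (Fin.tail d) := by
  funext x z
  simp only [insertFirst_apply, recFormula, Fin.cons_zero, Fin.tail_cons, Pi.add_apply,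
    Pi.neg_apply]

theorem recFormula_add {m : ℕ} (e : ZMod 2) (f f' : PreCochain N g V m)
    (d : Fin (m + 1) → Fin (N + 1) → ZMod 2) (c : ZMod 2) :
    recFormula R m e (f + f') d c = recFormula R m e f d c + recFormula R m e f' d c := by
  induction m generalizing e with
  | zero =>
    funext x z
    simp only [recFormula, linearCoboundary, GradedRep.mixedBracket, Pi.add_apply, map_add,
      smul_add, Finset.sum_add_distrib]
    abel
  | succ m ih =>
    funext x z
    simp only [recFormula, map_add, ih, lieFormula_add, Pi.add_apply]
    abel

theorem recFormula_smul {m : ℕ} (e : ZMod 2) (r : K) (f : PreCochain N g V m)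
    (d : Fin (m + 1) → Fin (N + 1) → ZMod 2) (c : ZMod 2) :
    recFormula R m e (r • f) d c = r • recFormula R m e f d c := by
  induction m generalizing e with
  | zero =>
    funext x z
    simp only [recFormula, linearCoboundary, GradedRep.mixedBracket, Pi.smul_apply, map_smul,
      smul_comm _ r, ← Finset.smul_sum, smul_sub]
  | succ m ih =>
    funext x z
    simp only [recFormula, map_smul, ih, lieFormula_smul, Pi.smul_apply, smul_add, smul_neg]

theorem isLinearMap_recFormula {m : ℕ} (e : ZMod 2) (d : Fin (m + 1) → Fin (N + 1) → ZMod 2)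
    (c : ZMod 2) : IsLinearMap K fun f : PreCochain N g V m => recFormula R m e f d c :=
  ⟨fun f f' => recFormula_add R e f f' d c, fun r f => recFormula_smul R e r f d c⟩

/-- In the recursive step, linearity in the first tuple has two sources: `f` itself in the first
term, and the operators of that tuple in the second. -/
theorem recFormula_mem {m : ℕ} (e : ZMod 2) {f : PreCochain N g V m}
    (hf : f ∈ multilinearCochains K N g V m) (d : Fin (m + 1) → Fin (N + 1) → ZMod 2)
    (c : ZMod 2) : recFormula R m e f d c ∈ multilinearCochains K N g V (m + 1) := by
  induction m generalizing e with
  | zero =>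
    have h := linearInEntries_linearCoboundary R e (hf.2 Fin.elim0)
      (Fin.snoc (α := fun _ => ZMod 2) (d 0) c)
    refine mem_multilinear_of_insertFirst (fun y => ⟨fun x z i => i.elim0, fun x => ?_⟩) ?_
    · have h' := h (Fin.snoc (α := fun _ => g) y 0) (Fin.last (N + 1))
      simp only [Fin.update_snoc_last] at h'
      exact h'
    · intro y a
      constructor
      · intro u v
        funext x z
        simp only [insertFirst_apply, recFormula, Fin.cons_zero, Fin.snoc_update, Pi.add_apply]
        exact (h _ _).map_add _ _
      · intro r u
        funext x z
        simp only [insertFirst_apply, recFormula, Fin.cons_zero, Fin.snoc_update, Pi.smul_apply]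
        exact (h _ _).map_smul _ _
  | succ m ih =>
    refine mem_multilinear_of_insertFirst (fun y => ?_) ?_
    · rw [insertFirst_recFormula]
      exact Submodule.add_mem _ (Submodule.neg_mem _ (ih _ (insertFirst_mem hf y) _))
        (lieFormula_mem _ _ _ hf _)
    · simp only [insertFirst_recFormula]
      have h : LinearInEntries K fun y =>
          lieFormula (∑ b, d 0 b) (actions R y) (m + 1) e f (Fin.tail d) :=
        (linearInEntries_multilinearMap (actions R)).comp
          (G := fun T => lieFormula (∑ b, d 0 b) T (m + 1) e f (Fin.tail d))
          ⟨fun T T' => lieFormula_op_add _ T T' e hf _, fun r T => lieFormula_op_smul _ T e r hf _⟩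
      exact (((linearInEntries_insertFirst hf).comp (isLinearMap_recFormula R _ _ _)).neg).add h

end Operators

/-! ### Super commutators of derivations of tuples -/

section TupleSums

variable {K : Type*} [Field K] {g : Type*} [AddCommGroup g] [Module K g]
  {W : Type*} [AddCommGroup W] [Module K W] {k : ℕ}

theorem sum_update_add {ι : Type*} [DecidableEq ι] (s : Finset ι) (d : ι → ZMod 2) (a : ι)
    (p : ZMod 2) :
    ∑ b ∈ s, Function.update d a (d a + p) b = ∑ b ∈ s, d b + if a ∈ s then p else 0 := by
  have : ∀ b, Function.update d a (d a + p) b = d b + if b = a then p else 0 := by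
    intro b
    by_cases h : b = a
    · subst h; simp
    · simp [h]
  simp only [this, Finset.sum_add_distrib, Finset.sum_ite_eq']

/-- The super commutator of two derivations of tuples. -/
theorem tupleDeriv_comm (p q : ZMod 2) (A B : Module.End K g) (d : Fin k → ZMod 2)
    {F : (Fin k → g) → W} (hF : LinearInEntries K F) (w : Fin k → g) :
    sgn (p * q) • ∑ a, sgn (p * ∑ b ∈ Finset.Iio a, d b) •
        tupleDeriv q B (Function.update d a (d a + p)) F (Function.update w a (A (w a))) -
      ∑ a, sgn (q * ∑ b ∈ Finset.Iio a, d b) •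
        tupleDeriv p A (Function.update d a (d a + q)) F (Function.update w a (B (w a))) =
    -tupleDeriv (p + q) (A * B - sgn (p * q) • (B * A)) d F w := by
  simp only [tupleDeriv, Finset.smul_sum, sum_update_add, Finset.mem_Iio]
  -- After this exchange the outer index is the position of `A` and the inner one that of `B` in
  -- both double sums. Different positions cancel, with the factor `sgn (p * q)` making up for the
  -- degree already added by the operator on the left; equal positions give the commutator.
  conv_lhs => enter [2]; rw [Finset.sum_comm]
  rw [← Finset.sum_sub_distrib, ← Finset.sum_neg_distrib]
  refine Finset.sum_congr rfl fun a _ => ?_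
  rw [← Finset.sum_sub_distrib, Finset.sum_eq_single a]
  · have hlin : ∀ u v : g, F (Function.update w a (u - sgn (p * q) • v)) =
        F (Function.update w a u) - sgn (p * q) • F (Function.update w a v) := by
      intro u v
      have := hF w a
      rw [this.map_sub]
      congr 1
      exact map_units_smul (IsLinearMap.mk' _ this) _ _
    have h1 : (A * B - sgn (p * q) • (B * A)) (w a) =
      A (B (w a)) - sgn (p * q) • B (A (w a)) := rfl
    rw [h1, hlin]
    simp only [Function.update_self, Function.update_idem, lt_irrefl, if_false, add_zero,
      sgn_smul_sgn_smul, smul_sub]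
    rw [neg_sub]
    congr 2
    · congr 1; ring
    · congr 1; ring
  · intro c _ hc
    rw [Function.update_of_ne hc, Function.update_of_ne (Ne.symm hc), Function.update_comm hc,
      sub_eq_zero]
    simp only [sgn_smul_sgn_smul]
    congr 2
    rcases lt_or_gt_of_ne hc with h | h
    · rw [if_neg (not_lt_of_gt h), if_pos h]; ring
    · rw [if_neg (not_lt_of_gt h), if_pos h]; grind
  · simp

/-- `A` is homogeneous of degree `p`. -/
def HasDegree (𝒢 : ZMod 2 → Submodule K g) (p : ZMod 2) (A : Module.End K g) : Prop :=
  ∀ (d : ZMod 2) (z : g), z ∈ 𝒢 d → A z ∈ 𝒢 (d + p)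

theorem HasDegree.update_mem {𝒢 : ZMod 2 → Submodule K g} {p : ZMod 2} {A : Module.End K g} (hA : HasDegree 𝒢 p A) {k : ℕ}
    {d : Fin k → ZMod 2} {y : Fin k → g} (hy : ∀ a, y a ∈ 𝒢 (d a)) (a : Fin k) :
    ∀ b, Function.update y a (A (y a)) b ∈ 𝒢 (Function.update d a (d a + p) b) := by
  intro b
  by_cases h : b = a
  · subst h; simpa using hA _ _ (hy b)
  · simpa [h] using hy b

theorem cons_mem (𝒢 : ZMod 2 → Submodule K g) {m k : ℕ} {d : Fin k → ZMod 2} {d' : Fin m → Fin k → ZMod 2}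
    {y : Fin k → g} {x : Fin m → Fin k → g} (hy : ∀ a, y a ∈ 𝒢 (d a))
    (hx : ∀ i a, x i a ∈ 𝒢 (d' i a)) :
    ∀ i a, (Fin.cons y x : Fin (m + 1) → Fin k → g) i a ∈
      𝒢 ((Fin.cons d d' : Fin (m + 1) → Fin k → ZMod 2) i a) := by
  intro i a
  induction i using Fin.cases with
  | zero => exact hy a
  | succ i => exact hx i a

end TupleSums

/-! ### Lie derivatives and their super commutators -/

section Operators

variable {K : Type*} [Field K] {g : Type*} [AddCommGroup g] [Module K g]
  {V : Type*} [AddCommGroup V] [Module K V] {N : ℕ}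
  (𝒢 : ZMod 2 → Submodule K g) [DirectSum.Decomposition 𝒢]

/-- The action of a pair of operators of degree `p` on the functions of degree `e`. -/
def lieDerivative (p : ZMod 2) (T : Module.End K g × Module.End K V) {m : ℕ} (e : ZMod 2) :
    PreCochain N g V m →ₗ[K] PreCochain N g V m where
  toFun f := extend 𝒢 fun d _ => lieFormula p T m e f d
  map_add' f f' := by
    funext x z
    simp only [extend, lieFormula_add, Pi.add_apply, Finset.sum_add_distrib]
  map_smul' r f := by
    funext x z
    simp only [extend, lieFormula_smul, Pi.smul_apply, Finset.smul_sum, RingHom.id_apply]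

theorem lieDerivative_mem (p : ZMod 2) (T : Module.End K g × Module.End K V) {m : ℕ}
    (e : ZMod 2) {f : PreCochain N g V m} (hf : f ∈ multilinearCochains K N g V m) :
    lieDerivative 𝒢 p T e f ∈ multilinearCochains K N g V m :=
  extend_mem 𝒢 fun d _ => lieFormula_mem p T e hf d

theorem lieDerivative_apply (p : ZMod 2) (T : Module.End K g × Module.End K V) {m : ℕ}
    (e : ZMod 2) {f : PreCochain N g V m} (hf : f ∈ multilinearCochains K N g V m)
    {d : Fin m → Fin (N + 1) → ZMod 2} {c : ZMod 2} {x : Fin m → Fin (N + 1) → g} {z : g}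
    (hx : ∀ i a, x i a ∈ 𝒢 (d i a)) (hz : z ∈ 𝒢 c) :
    lieDerivative 𝒢 p T e f x z = lieFormula p T m e f d x z :=
  extend_apply 𝒢 (Φ := fun d _ => lieFormula p T m e f d)
    (fun d _ => lieFormula_mem p T e hf d) hx hz

theorem lieDerivative_zero_apply (p : ZMod 2) (T : Module.End K g × Module.End K V)
    (e : ZMod 2) {f : PreCochain N g V 0} (hf : f ∈ multilinearCochains K N g V 0)
    (x : Fin 0 → Fin (N + 1) → g) (z : g) :
    lieDerivative 𝒢 p T e f x z = sgn (p * e) • T.2 (f x z) - f x (T.1 z) := by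
  have : lieDerivative 𝒢 p T e f = lieFormula p T 0 e f Fin.elim0 :=
    multilinear_ext 𝒢 (lieDerivative_mem 𝒢 p T e hf) (lieFormula_mem p T e hf _)
      fun d c x z hx hz => by
        rw [lieDerivative_apply 𝒢 p T e hf hx hz]; rfl
  rw [this]; rfl

theorem isLinearMap_lieDerivative (p : ZMod 2) {m : ℕ} (e : ZMod 2) {f : PreCochain N g V m}
    (hf : f ∈ multilinearCochains K N g V m) :
    IsLinearMap K fun T : Module.End K g × Module.End K V => lieDerivative 𝒢 p T e f := by
  constructor
  · intro T T'
    funext x z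
    simp only [lieDerivative, LinearMap.coe_mk, AddHom.coe_mk, extend, lieFormula_op_add p T T' e hf,
      Pi.add_apply, Finset.sum_add_distrib]
  · intro r T
    funext x z
    simp only [lieDerivative, LinearMap.coe_mk, AddHom.coe_mk, extend, lieFormula_op_smul p T e r hf,
      Pi.smul_apply, Finset.smul_sum]

/-- The commutation rule of Lie derivative and contraction, valid for homogeneous `y`. It drives
every induction on Lie derivatives below. -/
theorem insertFirst_lieDerivative (p : ZMod 2) (T : Module.End K g × Module.End K V) {m : ℕ}
    (e : ZMod 2) {f : PreCochain N g V (m + 1)}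
    (hf : f ∈ multilinearCochains K N g V (m + 1)) {d : Fin (N + 1) → ZMod 2}
    {y : Fin (N + 1) → g} (hy : ∀ a, y a ∈ 𝒢 (d a)) :
    insertFirst K y (lieDerivative 𝒢 p T e f) =
      sgn (p * ∑ b, d b) • lieDerivative 𝒢 p T (e + ∑ b, d b) (insertFirst K y f) -
        tupleDeriv p T.1 d (fun y => insertFirst K y f) y := by
  refine multilinear_ext 𝒢 (insertFirst_mem (lieDerivative_mem 𝒢 p T e hf) y)
    (Submodule.sub_mem _ (units_smul_mem _ _ (lieDerivative_mem 𝒢 _ _ _ (insertFirst_mem hf y)))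
      (Submodule.sum_mem _ fun a _ => units_smul_mem _ _ (insertFirst_mem hf _)))
    fun d' c x z hx hz => ?_
  rw [insertFirst_apply, lieDerivative_apply 𝒢 p T e hf (cons_mem 𝒢 hy hx) hz, Pi.sub_apply,
    Pi.sub_apply, Pi.smul_apply, Pi.smul_apply,
    lieDerivative_apply 𝒢 p T _ (insertFirst_mem hf y) hx hz]
  simp only [lieFormula, Fin.cons_zero, Fin.tail_cons]

/-- The super commutator of two Lie derivatives is the Lie derivative of the super commutator. -/
theorem lieDerivative_comm (p q : ZMod 2) (T T' : Module.End K g × Module.End K V)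
    (hT : HasDegree 𝒢 p T.1) (hT' : HasDegree 𝒢 q T'.1) {m : ℕ} (e : ZMod 2)
    {f : PreCochain N g V m} (hf : f ∈ multilinearCochains K N g V m) :
    sgn (p * q) • lieDerivative 𝒢 p T (e + q) (lieDerivative 𝒢 q T' e f) -
      lieDerivative 𝒢 q T' (e + p) (lieDerivative 𝒢 p T e f) =
    lieDerivative 𝒢 (p + q) (T * T' - sgn (p * q) • (T' * T)) e f := by
  induction m generalizing e with
  | zero =>
    funext x z
    have h := lieDerivative_mem 𝒢 p T e hf
    have h' := lieDerivative_mem 𝒢 q T' e hf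
    have hlin : ∀ u v : g, f x (u - sgn (p * q) • v) = f x u - sgn (p * q) • f x v := by
      intro u v
      rw [(hf.2 x).map_sub]
      congr 1
      exact map_units_smul (IsLinearMap.mk' _ (hf.2 x)) _ _
    have e1 : (T * T' - sgn (p * q) • (T' * T)).1 z =
      T.1 (T'.1 z) - sgn (p * q) • T'.1 (T.1 z) := rfl
    have e2 : (T * T' - sgn (p * q) • (T' * T)).2 (f x z) =
      T.2 (T'.2 (f x z)) - sgn (p * q) • T'.2 (T.2 (f x z)) := rfl
    simp only [Pi.sub_apply, Pi.smul_apply, lieDerivative_zero_apply 𝒢 _ _ _ h,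
      lieDerivative_zero_apply 𝒢 _ _ _ h', lieDerivative_zero_apply 𝒢 _ _ _ hf, e1, e2, hlin,
      map_sub, map_units_smul, smul_sub, sgn_smul_sgn_smul]
    have s1 : p * q + (p * (e + q) + q * e) = (p + q) * e := by grind
    have s2 : p * q + p * (e + q) = p * e := by grind
    have s3 : q * (e + p) + p * e = (p + q) * e + p * q := by ring
    have s4 : q * (e + p) = p * q + q * e := by ring
    rw [s1, s2, s3, s4]
    abel
  | succ m ih =>
    have hmem : ∀ (p q : ZMod 2) (T T' : Module.End K g × Module.End K V) (e e' : ZMod 2),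
        lieDerivative 𝒢 p T e (lieDerivative 𝒢 q T' e' f) ∈ multilinearCochains K N g V (m + 1) :=
      fun p q T T' e e' => lieDerivative_mem 𝒢 _ _ _ (lieDerivative_mem 𝒢 _ _ _ hf)
    refine multilinear_ext_insertFirst 𝒢
      (Submodule.sub_mem _ (units_smul_mem _ _ (hmem ..)) (hmem ..))
      (lieDerivative_mem 𝒢 _ _ _ hf) fun d w hw => ?_
    -- Contraction of a composite of two Lie derivatives, for arbitrary pairs so that it serves both
    -- orders. Both operators pass `w`, or exactly one of them acts on it, or both do.
    have key : ∀ (p q : ZMod 2) (T T' : Module.End K g × Module.End K V),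
        HasDegree 𝒢 p T.1 →
        insertFirst K w (lieDerivative 𝒢 p T (e + q) (lieDerivative 𝒢 q T' e f)) =
          sgn (p * ∑ b, d b) • (sgn (q * ∑ b, d b) •
            lieDerivative 𝒢 p T (e + ∑ b, d b + q)
              (lieDerivative 𝒢 q T' (e + ∑ b, d b) (insertFirst K w f)) -
            lieDerivative 𝒢 p T (e + q + ∑ b, d b)
              (tupleDeriv q T'.1 d (fun y => insertFirst K y f) w)) -
          (sgn (q * (∑ b, d b + p)) • lieDerivative 𝒢 q T' (e + ∑ b, d b + p)
              (tupleDeriv p T.1 d (fun y => insertFirst K y f) w) -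
            ∑ a, sgn (p * ∑ b ∈ Finset.Iio a, d b) •
              tupleDeriv q T'.1 (Function.update d a (d a + p)) (fun y => insertFirst K y f)
                (Function.update w a (T.1 (w a)))) := by
      intro p q T T' hT
      rw [insertFirst_lieDerivative 𝒢 p T _ (lieDerivative_mem 𝒢 _ _ _ hf) hw,
        insertFirst_lieDerivative 𝒢 q T' _ hf hw, map_sub, map_units_smul]
      congr 2
      · congr 4; ring
      · simp only [tupleDeriv, map_sum, map_units_smul, Finset.smul_sum]
        rw [← Finset.sum_sub_distrib]
        refine Finset.sum_congr rfl fun a _ => ?_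
        rw [insertFirst_lieDerivative 𝒢 q T' e hf (hT.update_mem hw a), sum_update_add,
          if_pos (Finset.mem_univ a), smul_sub]
        congr 1
        · rw [smul_comm, add_assoc]
        · simp only [tupleDeriv, Finset.smul_sum]
    rw [map_sub, map_units_smul, key p q T T' hT, key q p T' T hT',
      insertFirst_lieDerivative 𝒢 _ _ _ hf hw]
    -- The terms with both operators on `w` form the commutator derivation `h1`, those with none are
    -- the induction hypothesis `h2`, and the mixed ones cancel between the two orders.
    have h1 := tupleDeriv_comm p q T.1 T'.1 d (linearInEntries_insertFirst hf) w
    have h2 := ih (e + ∑ b, d b) (insertFirst_mem hf w)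
    have e1 : (T * T' - sgn (p * q) • (T' * T)).1 =
      T.1 * T'.1 - sgn (p * q) • (T'.1 * T.1) := rfl
    rw [e1, ← h2, sub_eq_add_neg _ (tupleDeriv (p + q) _ _ _ _), ← h1]
    simp only [smul_sub, sgn_smul_sgn_smul]
    generalize ∑ b, d b = s
    have s1 : p * q + (p * s + q * s) = (p + q) * s + p * q := by ring
    have s2 : p * q + p * s = p * (s + q) := by ring
    have s3 : p * q + q * (s + p) = q * s := by grind
    have s4 : q * s + p * s = (p + q) * s := by ring
    rw [s1, s2, s3, s4, add_right_comm e q s, add_right_comm e p s]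
    abel

end Operators

/-! ### Sums of degrees on the two sides of a position -/

section Sums

theorem sum_Iio_succAbove {n : ℕ} (a : Fin (n + 1)) (b : Fin n) (d : Fin (n + 1) → ZMod 2) :
    ∑ k ∈ Finset.Iio (a.succAbove b), d k =
      (if a < a.succAbove b then d a else 0) + ∑ k ∈ Finset.Iio b, d (a.succAbove k) := by
  have h : ∀ {n : ℕ} (c : Fin n) (f : Fin n → ZMod 2),
      ∑ k ∈ Finset.Iio c, f k = ∑ k, if k < c then f k else 0 := by
    intro n c f
    rw [← Finset.sum_filter]
    congr 1
    ext k; simp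
  rw [h, h, Fin.sum_univ_succAbove _ a]
  simp only [Fin.succAbove_lt_succAbove_iff]

theorem sum_succAbove_eq {n : ℕ} (a : Fin (n + 1)) (d : Fin (n + 1) → ZMod 2) :
    ∑ k, d (a.succAbove k) = ∑ k ∈ Finset.Iio a, d k + ∑ k ∈ Finset.Ioi a, d k := by
  have h : ∑ k ∈ Finset.Iio a, d k = ∑ k, if k < a then d k else 0 := by
    rw [← Finset.sum_filter]
    congr 1
    ext k; simp
  have h' : ∑ k ∈ Finset.Ioi a, d k = ∑ k, if a < k then d k else 0 := by
    rw [← Finset.sum_filter]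
    congr 1
    ext k; simp
  rw [h, h', Fin.sum_univ_succAbove _ a, Fin.sum_univ_succAbove (fun k => if a < k then d k else 0) a]
  simp only [lt_irrefl, if_false, zero_add, ← Finset.sum_add_distrib]
  refine Finset.sum_congr rfl fun k _ => ?_
  rcases lt_or_gt_of_ne (Fin.succAbove_ne a k) with h | h
  · rw [if_pos h, if_neg (not_lt_of_gt h), add_zero]
  · rw [if_pos h, if_neg (not_lt_of_gt h), zero_add]

theorem sum_eq_Iio_add_Ioi {n : ℕ} (a : Fin (n + 1)) (d : Fin (n + 1) → ZMod 2) :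
    ∑ k, d k = d a + (∑ k ∈ Finset.Iio a, d k + ∑ k ∈ Finset.Ioi a, d k) := by
  rw [Fin.sum_univ_succAbove _ a, sum_succAbove_eq]

end Sums

/-! ### Coboundaries of linear maps and the module axioms -/

section Base

variable {K : Type*} [Field K] {g : Type*} [AddCommGroup g] [Module K g]
  {V : Type*} [AddCommGroup V] [Module K V] {N : ℕ}
  {𝒢 : ZMod 2 → Submodule K g} {𝒱 : ZMod 2 → Submodule K V}
  {L : FirstClassNLieSuperalgebra K N 𝒢} (R : GradedRep L 𝒱)

theorem snoc_mem {k : ℕ} {d : Fin k → ZMod 2} {c : ZMod 2} {y : Fin k → g} {z : g}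
    (hy : ∀ a, y a ∈ 𝒢 (d a)) (hz : z ∈ 𝒢 c) (a : Fin (k + 1)) :
    Fin.snoc (α := fun _ => g) y z a ∈ 𝒢 (Fin.snoc (α := fun _ => ZMod 2) d c a) := by
  induction a using Fin.lastCases with
  | last => simpa using hz
  | cast a => simpa using hy a

theorem actions_hasDegree {d : Fin (N + 1) → ZMod 2} {x : Fin (N + 1) → g}
    (hx : ∀ a, x a ∈ 𝒢 (d a)) : HasDegree 𝒢 (∑ a, d a) (actions R x).1 := by
  intro c z hz
  have := L.bracket_mem _ _ (snoc_mem hx hz)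
  rw [Fin.sum_univ_castSucc] at this
  simp only [Fin.snoc_castSucc, Fin.snoc_last] at this
  rwa [add_comm c]

variable (𝒢) in
theorem linearMap_ext_homogeneous [DirectSum.Decomposition 𝒢] {W : Type*} [AddCommGroup W]
    [Module K W] {A B : g →ₗ[K] W} (h : ∀ c, ∀ z ∈ 𝒢 c, A z = B z) : A = B := by
  ext z
  rw [← sum_component 𝒢 z, map_sum, map_sum]
  exact Finset.sum_congr rfl fun c _ => h c _ (component_mem 𝒢 c z)

theorem filippov_tupleDeriv {dx : Fin (N + 1) → ZMod 2} {dy : Fin (N + 2) → ZMod 2}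
    {x : Fin (N + 1) → g} {y : Fin (N + 2) → g} (hx : ∀ a, x a ∈ 𝒢 (dx a))
    (hy : ∀ a, y a ∈ 𝒢 (dy a)) :
    (actions R x).1 (L.bracket y) = tupleDeriv (∑ a, dx a) (actions R x).1 dy L.bracket y :=
  L.filippov dx dy x y hx hy

/-- The operators of `𝐱 · 𝐲` are the super commutator of those of `𝐱` and `𝐲`. -/
theorem actions_comm [DirectSum.Decomposition 𝒢] {dx dy : Fin (N + 1) → ZMod 2}
    {x y : Fin (N + 1) → g}
    (hx : ∀ a, x a ∈ 𝒢 (dx a)) (hy : ∀ a, y a ∈ 𝒢 (dy a)) :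
    actions R x * actions R y - sgn ((∑ a, dx a) * ∑ a, dy a) • (actions R y * actions R x) =
      tupleDeriv (∑ a, dx a) (actions R x).1 dy (actions R) y := by
  rw [sub_eq_iff_eq_add]
  refine Prod.ext ?_ ?_
  · refine linearMap_ext_homogeneous 𝒢 fun c z hz => ?_
    -- The Filippov identity for the `n`-tuple `(y, z)`: its last summand is `±y · (x · z)`, and the
    -- others make up `(x · y) · z`.
    have h := filippov_tupleDeriv R hx (snoc_mem hy hz)
    rw [tupleDeriv, Fin.sum_univ_castSucc] at h
    have e1 : (tupleDeriv (∑ a, dx a) (actions R x).1 dy (actions R) y).1 z =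
        tupleDeriv (∑ a, dx a) (actions R x).1 dy (fun y => (actions R y).1 z) y :=
      map_tupleDeriv ((LinearMap.applyₗ z : Module.End K g →ₗ[K] g).comp
        (LinearMap.fst K (Module.End K g) (Module.End K V))) _ _ dy (actions R) y
    have e2 : Finset.Iio (Fin.last (N + 1)) = Finset.univ.map Fin.castSuccEmb := by
      ext k; induction k using Fin.lastCases <;> simp
    simp only [Fin.sum_Iio_castSucc, e2, Finset.sum_map, Fin.coe_castSuccEmb, Fin.snoc_castSucc,
      Fin.snoc_last, ← Fin.snoc_update, Fin.update_snoc_last] at h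
    rw [Prod.fst_add, LinearMap.add_apply, e1]
    exact h
  · have h := R.rho_mul dx dy x y hx hy
    have e1 : (tupleDeriv (∑ a, dx a) (actions R x).1 dy (actions R) y).2 =
        tupleDeriv (∑ a, dx a) (actions R x).1 dy R.rho y :=
      map_tupleDeriv (LinearMap.snd K (Module.End K g) (Module.End K V)) _ _ dy (actions R) y
    rw [Prod.snd_add, e1]
    exact h

/-- The sign of the term of `linearCoboundary` with the value of `φ` in position `a`. -/
def linearCoboundarySign (a : Fin (N + 2)) (e : ZMod 2) (d : Fin (N + 2) → ZMod 2) : ℤˣ :=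
  (-1 : ℤˣ) ^ (N + 1 - (a : ℕ)) *
    sgn (e * ∑ b ∈ Finset.Iio a, d b + (e + d a) * ∑ b ∈ Finset.Ioi a, d b)

theorem linearCoboundary_eq (e : ZMod 2) (φ : g → V) (d : Fin (N + 2) → ZMod 2)
    (y : Fin (N + 2) → g) :
    linearCoboundary R e φ d y = ∑ a, linearCoboundarySign a e d •
      R.rho (fun k => y (a.succAbove k)) (φ (y a)) - φ (L.bracket y) := by
  simp only [linearCoboundary, GradedRep.mixedBracket, linearCoboundarySign, smul_smul, sgn_add]
  congr 1
  refine Finset.sum_congr rfl fun a _ => ?_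
  congr 1
  rw [mul_left_comm]

theorem update_succAbove_comp {n : ℕ} (a : Fin (n + 1)) (b : Fin n) (y : Fin (n + 1) → g) (u : g) :
    (fun k => Function.update y (a.succAbove b) u (a.succAbove k)) =
      Function.update (fun k => y (a.succAbove k)) b u := by
  funext k
  by_cases h : k = b
  · subst h; simp
  · simp [h]

theorem update_comp_succAbove {n : ℕ} (a : Fin (n + 1)) (y : Fin (n + 1) → g) (u : g) :
    (fun k => Function.update y a u (a.succAbove k)) = fun k => y (a.succAbove k) := by
  funext k
  simp

/-- The module axiom for `ρ(x) ρ(y)` moves `ρ(x)` past the action of the entries other than `y_a`.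
The resulting terms in which `x` acts on an entry `b ≠ a` cancel against those of the sum, while `b
= a` supplies `φ(x · y_a)`. -/
theorem linearCoboundary_lie_term {dx : Fin (N + 1) → ZMod 2} {d : Fin (N + 2) → ZMod 2}
    {x : Fin (N + 1) → g} {y : Fin (N + 2) → g} (hx : ∀ a, x a ∈ 𝒢 (dx a))
    (hy : ∀ a, y a ∈ 𝒢 (d a)) (e : ZMod 2) (φ : g → V) (a : Fin (N + 2)) :
    sgn ((∑ b, dx b) * e) • R.rho x (linearCoboundarySign a e d •
        R.rho (fun k => y (a.succAbove k)) (φ (y a))) -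
      ∑ b, sgn ((∑ b, dx b) * ∑ k ∈ Finset.Iio b, d k) •
        linearCoboundarySign a e (Function.update d b (d b + ∑ b, dx b)) •
          R.rho (fun k => Function.update y b ((actions R x).1 (y b)) (a.succAbove k))
            (φ (Function.update y b ((actions R x).1 (y b)) a)) =
      linearCoboundarySign a (e + ∑ b, dx b) d • R.rho (fun k => y (a.succAbove k))
        (sgn ((∑ b, dx b) * e) • R.rho x (φ (y a)) - φ ((actions R x).1 (y a))) := by
  have h := LinearMap.congr_fun (R.rho_mul dx (fun k => d (a.succAbove k)) x
    (fun k => y (a.succAbove k)) hx (fun k => hy _)) (φ (y a))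
  rw [Module.End.mul_apply, LinearMap.add_apply, LinearMap.sum_apply] at h
  rw [Fin.sum_univ_succAbove _ a, map_units_smul, h, sum_succAbove_eq]
  simp only [update_succAbove_comp, update_comp_succAbove, Function.update_self, ne_eq,
    (Fin.succAbove_ne a _).symm, not_false_eq_true, Function.update_of_ne, smul_add, map_sub,
    map_units_smul, smul_sub, Finset.smul_sum, linearCoboundarySign, sum_update_add]
  have e2 : ∀ (u : ℤˣ) (T : Module.End K V) (v : V), (u • T) v = u • T v := fun _ _ _ => rfl
  simp only [e2, Module.End.mul_apply, smul_smul]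
  have m2 : ∀ (u : ℤˣ) (a b : ZMod 2), sgn a * (u * sgn b) = u * sgn (a + b) := by
    intro u a b; simp only [sgn_add]; ac_rfl
  have m3 : ∀ (u : ℤˣ) (a b : ZMod 2), u * sgn a * sgn b = u * sgn (a + b) := by
    intro u a b; simp only [sgn_add]; ac_rfl
  have key : ∀ S S' A A' B B' : V, S = S' → A = A' → B = B' → S + A - (B + S') = A' - B' := by
    rintro S _ A _ B _ rfl rfl rfl; abel
  simp only [m2, m3, Finset.mem_Iio, Finset.mem_Ioi, lt_irrefl, if_false, add_zero]
  generalize (∑ a, dx a) = p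
  refine key _ _ _ _ _ _ (Finset.sum_congr rfl fun b _ => ?_) ?_ ?_
  · rw [sum_Iio_succAbove]
    congr 3
    rcases lt_or_gt_of_ne (Fin.succAbove_ne a b) with h | h
    · rw [if_pos h, if_neg (not_lt_of_gt h)]; grind
    · rw [if_pos h, if_neg (not_lt_of_gt h)]; grind
  · congr 3; grind
  · congr 3; grind

/-- The coboundary of linear maps commutes with the action of `𝐱`. -/
theorem linearCoboundary_lie {dx : Fin (N + 1) → ZMod 2} {d : Fin (N + 2) → ZMod 2}
    {x : Fin (N + 1) → g} {y : Fin (N + 2) → g} (hx : ∀ a, x a ∈ 𝒢 (dx a))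
    (hy : ∀ a, y a ∈ 𝒢 (d a)) (e : ZMod 2) {φ : g → V} (hφ : IsLinearMap K φ) :
    sgn ((∑ b, dx b) * e) • R.rho x (linearCoboundary R e φ d y) -
      ∑ b, sgn ((∑ b, dx b) * ∑ k ∈ Finset.Iio b, d k) •
        linearCoboundary R e φ (Function.update d b (d b + ∑ b, dx b))
          (Function.update y b ((actions R x).1 (y b))) =
      linearCoboundary R (e + ∑ b, dx b)
        (fun z => sgn ((∑ b, dx b) * e) • R.rho x (φ z) - φ ((actions R x).1 z)) d y := by
  -- The module axiom does not reach the term `φ([y_1, …, y_n])`; the Filippov identity does.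
  have h : φ ((actions R x).1 (L.bracket y)) = ∑ b, sgn ((∑ b, dx b) * ∑ k ∈ Finset.Iio b, d k) •
      φ (L.bracket (Function.update y b ((actions R x).1 (y b)))) := by
    rw [filippov_tupleDeriv R hx hy]
    exact map_tupleDeriv (IsLinearMap.mk' φ hφ) _ _ _ _ _
  simp only [linearCoboundary_eq, ← linearCoboundary_lie_term R hx hy, h]
  simp only [map_sub, map_sum, smul_sub, Finset.smul_sum, Finset.sum_sub_distrib]
  rw [Finset.sum_comm]
  abel

/-- The axiom for `ρ(x, [y_1, …, y_n])`, read as a cocycle condition: with `ε` in the role of the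
degree of `v`, the map `z ↦ sgn (ε|z|) ρ(x, z) v`, taken in degree `ε + |x|`, has zero coboundary.
-/
theorem linearCoboundary_inner_term {dx : Fin N → ZMod 2} {d : Fin (N + 2) → ZMod 2}
    {x : Fin N → g} {y : Fin (N + 2) → g} (hx : ∀ a, x a ∈ 𝒢 (dx a))
    (hy : ∀ a, y a ∈ 𝒢 (d a)) (ε : ZMod 2) (v : V) :
    ∑ b, linearCoboundarySign b (ε + ∑ k, dx k) d • R.rho (fun k => y (b.succAbove k))
        (sgn (ε * d b) • R.rho (Fin.snoc (α := fun _ => g) x (y b)) v) =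
      sgn (ε * ∑ b, d b) • R.rho (Fin.snoc (α := fun _ => g) x (L.bracket y)) v := by
  rw [R.rho_bracket dx d x y hx hy, LinearMap.sum_apply, Finset.smul_sum]
  refine Finset.sum_congr rfl fun b _ => ?_
  have e2 : ∀ (u : ℤˣ) (T : Module.End K V) (v : V), (u • T) v = u • T v := fun _ _ _ => rfl
  rw [map_units_smul, e2, Module.End.mul_apply, smul_smul, smul_smul]
  congr 1
  rw [linearCoboundarySign, sum_succAbove_eq, sum_eq_Iio_add_Ioi b]
  have m1 : ∀ (u : ℤˣ) (a b c : ZMod 2), sgn a * (u * sgn b * sgn c) = u * sgn (a + b + c) := by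
    intro u a b c; simp only [sgn_add]; ac_rfl
  have m3 : ∀ (u : ℤˣ) (a b : ZMod 2), u * sgn a * sgn b = u * sgn (a + b) := by
    intro u a b; simp only [sgn_add]; ac_rfl
  rw [m1, m3]
  congr 2
  grind

end Base

/-! ### Cartan formula, equivariance of the coboundary, and `δ² = 0` -/

section Square

variable {K : Type*} [Field K] {g : Type*} [AddCommGroup g] [Module K g]
  {V : Type*} [AddCommGroup V] [Module K V] {N : ℕ}
  {𝒢 : ZMod 2 → Submodule K g} {𝒱 : ZMod 2 → Submodule K V} [DirectSum.Decomposition 𝒢]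
  {L : FirstClassNLieSuperalgebra K N 𝒢} (R : GradedRep L 𝒱)

/-- The coboundary operator on functions of degree `e`. -/
def homCoboundary {m : ℕ} (e : ZMod 2) : PreCochain N g V m →ₗ[K] PreCochain N g V (m + 1) where
  toFun f := extend 𝒢 fun d c => recFormula R m e f d c
  map_add' f f' := by
    funext x z
    simp only [extend, recFormula_add, Pi.add_apply, Finset.sum_add_distrib]
  map_smul' r f := by
    funext x z
    simp only [extend, recFormula_smul, Pi.smul_apply, Finset.smul_sum, RingHom.id_apply]

theorem homCoboundary_mem {m : ℕ} (e : ZMod 2) {f : PreCochain N g V m}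
    (hf : f ∈ multilinearCochains K N g V m) :
    homCoboundary R e f ∈ multilinearCochains K N g V (m + 1) :=
  extend_mem 𝒢 fun d c => recFormula_mem R e hf d c

theorem homCoboundary_apply {m : ℕ} (e : ZMod 2) {f : PreCochain N g V m}
    (hf : f ∈ multilinearCochains K N g V m) {d : Fin (m + 1) → Fin (N + 1) → ZMod 2} {c : ZMod 2}
    {x : Fin (m + 1) → Fin (N + 1) → g} {z : g} (hx : ∀ i a, x i a ∈ 𝒢 (d i a)) (hz : z ∈ 𝒢 c) :
    homCoboundary R e f x z = recFormula R m e f d c x z :=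
  extend_apply 𝒢 (fun d c => recFormula_mem R e hf d c) hx hz

/-- The Cartan formula. -/
theorem insertFirst_homCoboundary {m : ℕ} (e : ZMod 2) {f : PreCochain N g V (m + 1)}
    (hf : f ∈ multilinearCochains K N g V (m + 1)) {d : Fin (N + 1) → ZMod 2}
    {y : Fin (N + 1) → g} (hy : ∀ a, y a ∈ 𝒢 (d a)) :
    insertFirst K y (homCoboundary R e f) =
      -homCoboundary R (e + ∑ b, d b) (insertFirst K y f) +
        lieDerivative 𝒢 (∑ b, d b) (actions R y) e f := by
  refine multilinear_ext 𝒢 (insertFirst_mem (homCoboundary_mem R e hf) y)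
    (Submodule.add_mem _ (Submodule.neg_mem _ (homCoboundary_mem R _ (insertFirst_mem hf y)))
      (lieDerivative_mem 𝒢 _ _ _ hf))
    fun d' c x z hx hz => ?_
  rw [insertFirst_apply, homCoboundary_apply R e hf (cons_mem 𝒢 hy hx) hz, Pi.add_apply,
    Pi.add_apply, Pi.neg_apply, Pi.neg_apply,
    homCoboundary_apply R _ (insertFirst_mem hf y) hx hz, lieDerivative_apply 𝒢 _ _ _ hf hx hz]
  simp only [recFormula, Fin.cons_zero, Fin.tail_cons]

theorem homCoboundary_zero_apply (e : ZMod 2) {f : PreCochain N g V 0}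
    (hf : f ∈ multilinearCochains K N g V 0) {d : Fin (N + 1) → ZMod 2} {c : ZMod 2}
    {y : Fin (N + 1) → g} {z : g} (hy : ∀ a, y a ∈ 𝒢 (d a)) (hz : z ∈ 𝒢 c)
    (x : Fin 0 → Fin (N + 1) → g) :
    insertFirst K y (homCoboundary R e f) x z = linearCoboundary R e (f Fin.elim0)
      (Fin.snoc (α := fun _ => ZMod 2) d c) (Fin.snoc (α := fun _ => g) y z) := by
  rw [insertFirst_apply, homCoboundary_apply R e hf
    (cons_mem 𝒢 hy (d' := Fin.elim0) fun i => i.elim0) hz]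
  rfl

/-- The coboundary operator commutes with the action of `𝐱`. -/
theorem lieDerivative_homCoboundary {dx : Fin (N + 1) → ZMod 2} {x : Fin (N + 1) → g}
    (hx : ∀ a, x a ∈ 𝒢 (dx a)) {m : ℕ} (e : ZMod 2) {f : PreCochain N g V m}
    (hf : f ∈ multilinearCochains K N g V m) :
    lieDerivative 𝒢 (∑ a, dx a) (actions R x) e (homCoboundary R e f) =
      homCoboundary R (e + ∑ a, dx a) (lieDerivative 𝒢 (∑ a, dx a) (actions R x) e f) := by
  have hdeg := actions_hasDegree R hx
  refine multilinear_ext_insertFirst 𝒢 (lieDerivative_mem 𝒢 _ _ _ (homCoboundary_mem R _ hf))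
    (homCoboundary_mem R _ (lieDerivative_mem 𝒢 _ _ _ hf)) fun d y hy => ?_
  rw [insertFirst_lieDerivative 𝒢 _ _ _ (homCoboundary_mem R e hf) hy]
  induction m generalizing e d y with
  | zero =>
    refine multilinear_ext 𝒢 (Submodule.sub_mem _ (units_smul_mem _ _ (lieDerivative_mem 𝒢 _ _ _
        (insertFirst_mem (homCoboundary_mem R e hf) y)))
        (Submodule.sum_mem _ fun a _ => units_smul_mem _ _
          (insertFirst_mem (homCoboundary_mem R e hf) _)))
      (insertFirst_mem (homCoboundary_mem R _ (lieDerivative_mem 𝒢 _ _ _ hf)) _)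
      fun d' c x' z _ hz => ?_
    -- Equivariance for linear maps at the `n`-tuple `(y, z)`. The last summand, with `x` acting on
    -- `z`, belongs to the Lie derivative of the contracted cochain; the others form the derivation
    -- of `y`.
    have h := linearCoboundary_lie R hx (snoc_mem hy hz) e (hf.2 Fin.elim0)
    rw [Fin.sum_univ_castSucc (n := N + 1)] at h
    have e2 : Finset.Iio (Fin.last (N + 1)) = Finset.univ.map Fin.castSuccEmb := by
      ext k; induction k using Fin.lastCases <;> simp
    simp only [Fin.sum_Iio_castSucc, e2, Finset.sum_map, Fin.coe_castSuccEmb, Fin.snoc_castSucc,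
      Fin.snoc_last, ← Fin.snoc_update, Fin.update_snoc_last] at h
    have h0 : lieDerivative 𝒢 (∑ a, dx a) (actions R x) e f Fin.elim0 = fun z =>
        sgn ((∑ b, dx b) * e) • R.rho x (f Fin.elim0 z) - f Fin.elim0 ((actions R x).1 z) := by
      funext z
      rw [lieDerivative_zero_apply 𝒢 _ _ _ hf, actions_snd]
    rw [homCoboundary_zero_apply R _ (lieDerivative_mem 𝒢 _ _ _ hf) hy hz, h0, ← h,
      Pi.sub_apply, Pi.sub_apply, Pi.smul_apply, Pi.smul_apply,
      lieDerivative_zero_apply 𝒢 _ _ _ (insertFirst_mem (homCoboundary_mem R e hf) y),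
      actions_snd, homCoboundary_zero_apply R e hf hy hz,
      homCoboundary_zero_apply R e hf hy (hdeg c z hz)]
    have h1 : tupleDeriv (∑ a, dx a) (actions R x).1 d
        (fun y => insertFirst K y (homCoboundary R e f)) y x' z =
        ∑ a, sgn ((∑ b, dx b) * ∑ k ∈ Finset.Iio a, d k) •
          linearCoboundary R e (f Fin.elim0)
            (Fin.snoc (α := fun _ => ZMod 2) (Function.update d a (d a + ∑ b, dx b)) c)
            (Fin.snoc (α := fun _ => g) (Function.update y a ((actions R x).1 (y a))) z) := by
      simp only [tupleDeriv, Finset.sum_apply, Pi.smul_apply]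
      refine Finset.sum_congr rfl fun a _ => ?_
      rw [homCoboundary_zero_apply R e hf (hdeg.update_mem hy a) hz]
    rw [h1, smul_sub, sgn_smul_sgn_smul]
    have s1 : (∑ a, dx a) * ∑ b, d b + (∑ a, dx a) * (e + ∑ b, d b) = (∑ a, dx a) * e := by grind
    rw [s1]
    abel
  | succ m ih =>
    -- The induction hypothesis is available in contracted form; this puts it back as an equality of
    -- cochains.
    have hh : homCoboundary R (e + ∑ b, d b + ∑ a, dx a)
          (lieDerivative 𝒢 (∑ a, dx a) (actions R x) (e + ∑ b, d b) (insertFirst K y f)) =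
        lieDerivative 𝒢 (∑ a, dx a) (actions R x) (e + ∑ b, d b)
          (homCoboundary R (e + ∑ b, d b) (insertFirst K y f)) := by
      refine (multilinear_ext_insertFirst 𝒢
        (lieDerivative_mem 𝒢 _ _ _ (homCoboundary_mem R _ (insertFirst_mem hf y)))
        (homCoboundary_mem R _ (lieDerivative_mem 𝒢 _ _ _ (insertFirst_mem hf y)))
        fun d' y' hy' => ?_).symm
      rw [insertFirst_lieDerivative 𝒢 _ _ _ (homCoboundary_mem R _ (insertFirst_mem hf y)) hy']
      exact ih _ (insertFirst_mem hf y) d' y' hy'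
    -- The Cartan formula in each summand of `x · y`. By linearity in the operators the Lie
    -- derivatives add up to that of `x · y`, which `actions_comm` and `lieDerivative_comm` convert
    -- into a commutator of `L_x` and `L_y`.
    have h1 : tupleDeriv (∑ a, dx a) (actions R x).1 d
        (fun y => insertFirst K y (homCoboundary R e f)) y =
        -homCoboundary R (e + ∑ b, d b + ∑ a, dx a)
          (tupleDeriv (∑ a, dx a) (actions R x).1 d (fun y => insertFirst K y f) y) +
        lieDerivative 𝒢 (∑ a, dx a + ∑ b, d b)
          (tupleDeriv (∑ a, dx a) (actions R x).1 d (actions R) y) e f := by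
      have h2 := map_tupleDeriv
        (IsLinearMap.mk' _ (isLinearMap_lieDerivative 𝒢 (∑ a, dx a + ∑ b, d b) e hf))
        (∑ a, dx a) (actions R x).1 d (actions R) y
      rw [IsLinearMap.mk'_apply] at h2
      rw [h2, map_tupleDeriv]
      simp only [tupleDeriv]
      rw [← Finset.sum_neg_distrib, ← Finset.sum_add_distrib]
      refine Finset.sum_congr rfl fun a _ => ?_
      rw [insertFirst_homCoboundary R e hf (hdeg.update_mem hy a), sum_update_add,
        if_pos (Finset.mem_univ a), smul_add, smul_neg, IsLinearMap.mk'_apply, add_assoc,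
        add_comm (∑ a, dx a)]
    rw [h1, insertFirst_homCoboundary R e hf hy,
      insertFirst_homCoboundary R _ (lieDerivative_mem 𝒢 _ _ _ hf) hy,
      insertFirst_lieDerivative 𝒢 _ _ _ hf hy, ← actions_comm R hx hy,
      ← lieDerivative_comm 𝒢 _ _ _ _ hdeg (actions_hasDegree R hy) e hf, map_sub,
      map_units_smul, map_add, map_neg, add_right_comm e (∑ a, dx a), hh, smul_add, smul_neg]
    abel

/-- Isolates the factor `sgn (ε * c)`, the only part of the sign that depends on the degree of `z`,
as `linearCoboundary_inner_term` requires. -/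
theorem mixedBracket_castSucc_snoc (a : Fin (N + 1)) (ε c : ZMod 2) (d : Fin (N + 1) → ZMod 2)
    (x : Fin (N + 1) → g) (z : g) (v : V) :
    R.mixedBracket a.castSucc ε (Fin.snoc (α := fun _ => ZMod 2) d c)
        (Fin.snoc (α := fun _ => g) x z) v =
      ((-1 : ℤˣ) ^ (N + 1 - (a : ℕ)) * sgn (ε * ∑ k ∈ Finset.Ioi a, d k)) •
        sgn (ε * c) • R.rho (Fin.snoc (α := fun _ => g) (fun k => x (a.succAbove k)) z) v := by
  have h1 : (fun k => Fin.snoc (α := fun _ => g) x z (a.castSucc.succAbove k)) =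
      Fin.snoc (α := fun _ => g) (fun k => x (a.succAbove k)) z := by
    funext k
    induction k using Fin.lastCases with
    | last => simp
    | cast k => simp
  have h2 : ∑ k ∈ Finset.Ioi a.castSucc, Fin.snoc (α := fun _ => ZMod 2) d c k =
      ∑ k ∈ Finset.Ioi a, d k + c := by
    have : Finset.Ioi a.castSucc =
        insert (Fin.last (N + 1)) ((Finset.Ioi a).map Fin.castSuccEmb) := by
      ext k
      induction k using Fin.lastCases <;> simp [Fin.le_last]
    rw [this, Finset.sum_insert (by simp), Finset.sum_map]
    simp [add_comm]
  rw [GradedRep.mixedBracket, h1, h2, mul_add, sgn_add, smul_smul, mul_assoc, Fin.val_castSucc]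

/-- The coboundary operator squares to zero. -/
theorem homCoboundary_homCoboundary {m : ℕ} (e : ZMod 2) {f : PreCochain N g V m}
    (hf : f ∈ multilinearCochains K N g V m) :
    homCoboundary R e (homCoboundary R e f) = 0 := by
  have hδ : ∀ {m : ℕ} (e : ZMod 2) {f : PreCochain N g V m},
      f ∈ multilinearCochains K N g V m → homCoboundary R e f ∈ _ :=
    fun e f hf => homCoboundary_mem R e hf
  refine multilinear_ext_insertFirst 𝒢 (hδ _ (hδ _ hf)) (Submodule.zero_mem _) fun d y hy => ?_
  rw [insertFirst_homCoboundary R e (hδ e hf) hy, lieDerivative_homCoboundary R hy e hf, map_zero]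
  -- What remains is `-δ(ι_y δ f) + δ(L_y f) = 0`.
  induction m generalizing e d y with
  | succ m ih =>
    have h : homCoboundary R (e + ∑ b, d b) (homCoboundary R (e + ∑ b, d b) (insertFirst K y f))
        = 0 := by
      refine multilinear_ext_insertFirst 𝒢 (hδ _ (hδ _ (insertFirst_mem hf y)))
        (Submodule.zero_mem _) fun d' y' hy' => ?_
      rw [insertFirst_homCoboundary R _ (hδ _ (insertFirst_mem hf y)) hy',
        lieDerivative_homCoboundary R hy' _ (insertFirst_mem hf y), map_zero]
      exact ih _ (insertFirst_mem hf y) d' y' hy'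
    rw [insertFirst_homCoboundary R e hf hy, map_add, map_neg, h]
    abel
  | zero =>
    rw [neg_add_eq_sub, ← map_sub]
    -- In this difference `y · f(z)` and `f(y · z)` cancel, so only the terms in which `f` is
    -- evaluated at an entry of `y` survive.
    set ψ := lieDerivative 𝒢 (∑ b, d b) (actions R y) e f -
      insertFirst K y (homCoboundary R e f) with hψ
    have hψm : ψ ∈ multilinearCochains K N g V 0 := Submodule.sub_mem _
      (lieDerivative_mem 𝒢 _ _ _ hf) (insertFirst_mem (hδ _ hf) _)
    have hval : ∀ (c : ZMod 2) (z : g), z ∈ 𝒢 c → ψ Fin.elim0 z =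
        -∑ a : Fin (N + 1), (sgn (e * ∑ b ∈ Finset.Iio a, d b) *
          ((-1 : ℤˣ) ^ (N + 1 - (a : ℕ)) * sgn ((e + d a) * ∑ k ∈ Finset.Ioi a, d k))) •
          sgn ((e + d a) * c) • R.rho (Fin.snoc (α := fun _ => g) (fun k => y (a.succAbove k)) z)
            (f Fin.elim0 (y a)) := by
      intro c z hz
      have e2 : Finset.Iio (Fin.last (N + 1)) = Finset.univ.map Fin.castSuccEmb := by
        ext k; induction k using Fin.lastCases <;> simp
      rw [hψ, Pi.sub_apply, Pi.sub_apply, lieDerivative_zero_apply 𝒢 _ _ _ hf,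
        homCoboundary_zero_apply R e hf hy hz, linearCoboundary,
        Fin.sum_univ_castSucc (n := N + 1)]
      simp only [Fin.snoc_castSucc, mixedBracket_castSucc_snoc, Fin.snoc_last, e2,
        Finset.sum_map, Fin.coe_castSuccEmb, Fin.sum_Iio_castSucc, smul_smul, mul_assoc]
      have e3 : R.mixedBracket (Fin.last (N + 1)) (e + c) (Fin.snoc (α := fun _ => ZMod 2) d c)
          (Fin.snoc (α := fun _ => g) y z) (f Fin.elim0 z) = R.rho y (f Fin.elim0 z) := by
        have : Finset.Ioi (Fin.last (N + 1)) = ∅ := by ext k; simp [Fin.le_last]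
        simp [GradedRep.mixedBracket, this]
      rw [e3, actions_snd, actions_fst_apply, mul_comm e]
      abel
    refine multilinear_ext_insertFirst 𝒢 (hδ _ hψm) (Submodule.zero_mem _) fun d' y' hy' => ?_
    refine multilinear_ext 𝒢 (insertFirst_mem (hδ _ hψm) _) (Submodule.zero_mem _)
      fun _ c x z _ hz => ?_
    change _ = (0 : V)
    rw [homCoboundary_zero_apply R _ hψm hy' hz, linearCoboundary_eq,
      hval _ _ (L.bracket_mem _ _ (snoc_mem hy' hz))]
    have h1 : ∀ b, ψ Fin.elim0 (Fin.snoc (α := fun _ => g) y' z b) = _ :=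
      fun b => hval _ _ (snoc_mem hy' hz b)
    simp only [h1, map_neg, map_sum, map_units_smul, smul_neg, Finset.sum_neg_distrib,
      Finset.smul_sum]
    rw [Finset.sum_comm, sub_eq_zero, neg_inj]
    refine Finset.sum_congr rfl fun a _ => ?_
    -- For fixed `a` this is applied with `v = f(y_a)` and `ε = e + d a`; adding the degrees of the
    -- other entries of `y` gives `e + |y|`, the degree in which the coboundary of `ψ` is taken.
    rw [← linearCoboundary_inner_term R (fun k => hy (a.succAbove k)) (snoc_mem hy' hz),
      Finset.smul_sum]
    refine Finset.sum_congr rfl fun b _ => ?_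
    rw [add_assoc e (d a), ← Fin.sum_univ_succAbove d a, smul_comm, map_units_smul]

end Square

/-! ### Agreement of the explicit coboundary formula with the recursion -/

section Formula

variable {K : Type*} [Field K] {g : Type*} [AddCommGroup g] [Module K g]
  {V : Type*} [AddCommGroup V] [Module K V] {N : ℕ}

theorem sum_Iio_succ {M : Type*} [AddCommMonoid M] {n : ℕ} (f : Fin (n + 1) → M) (a : Fin n) :
    ∑ i ∈ Finset.Iio a.succ, f i = f 0 + ∑ i ∈ Finset.Iio a, f i.succ := by
  have : Finset.Iio a.succ = insert 0 ((Finset.Iio a).map (Fin.succEmb n)) := by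
    ext k
    induction k using Fin.cases <;> simp
  rw [this, Finset.sum_insert (by simp), Finset.sum_map]
  rfl

theorem sum_Ioo_zero_succ {M : Type*} [AddCommMonoid M] {n : ℕ} (f : Fin (n + 1) → M)
    (a : Fin n) : ∑ i ∈ Finset.Ioo 0 a.succ, f i = ∑ i ∈ Finset.Iio a, f i.succ := by
  have : Finset.Ioo 0 a.succ = (Finset.Iio a).map (Fin.succEmb n) := by
    ext k
    induction k using Fin.cases <;> simp
  rw [this, Finset.sum_map]
  rfl

theorem update_tail {m : ℕ} {α : Type*} (x : Fin (m + 1) → α) (j : Fin m) (u : α) :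
    Fin.cons (x 0) (Function.update (Fin.tail x) j u) = Function.update x j.succ u := by
  rw [Fin.cons_update, Fin.cons_self_tail]

/-- The recursion unrolled. In the recursive call the degree shift by `|x_1|` contributes to the
first term a sign that the outer factor cancels, whereas in the other terms the outer factors
accumulate. -/
theorem lieFormula_eq_sum (p : ZMod 2) (T : Module.End K g × Module.End K V) {m : ℕ} (e : ZMod 2)
    (f : PreCochain N g V m) (d : Fin m → Fin (N + 1) → ZMod 2) (x : Fin m → Fin (N + 1) → g)
    (z : g) :
    lieFormula p T m e f d x z = sgn (p * e) • T.2 (f x z) -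
      (∑ j, ∑ a, (sgn (p * ∑ k ∈ Finset.Iio j, ∑ b, d k b) * sgn (p * ∑ b ∈ Finset.Iio a, d j b)) •
        f (Function.update x j (Function.update (x j) a (T.1 (x j a)))) z) -
      sgn (p * ∑ k, ∑ b, d k b) • f x (T.1 z) := by
  induction m generalizing e with
  | zero => simp [lieFormula]
  | succ m ih =>
    have h0 : tupleDeriv p T.1 (d 0) (fun y => insertFirst K y f) (x 0) (Fin.tail x) z =
        ∑ a, (sgn (p * ∑ k ∈ Finset.Iio 0, ∑ b, d k b) * sgn (p * ∑ b ∈ Finset.Iio a, d 0 b)) •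
        f (Function.update x 0 (Function.update (x 0) a (T.1 (x 0 a)))) z := by
      have : ∀ u, (Fin.cons u (Fin.tail x) : Fin (m + 1) → Fin (N + 1) → g) =
          Function.update x 0 u := by
        intro u
        conv_rhs => rw [← Fin.cons_self_tail x, Fin.update_cons_zero]
      have h : Finset.Iio (0 : Fin (m + 1)) = ∅ := by ext k; simp
      simp only [tupleDeriv, Finset.sum_apply, Pi.smul_apply, insertFirst_apply, this, h,
        Finset.sum_empty, mul_zero, sgn_zero, one_mul]
    have e1 : ∀ u, insertFirst K (x 0) f (Fin.tail x) u = f x u := fun u =>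
      insertFirst_tail (K := K) x f u
    have s1 : sgn (p * ∑ b, d 0 b) * (sgn (p * e) * sgn (p * ∑ b, d 0 b)) = sgn (p * e) := by
      rw [mul_left_comm, sgn_mul_self, mul_one]
    rw [lieFormula]
    dsimp only
    rw [h0, ih, Fin.sum_univ_succ (fun j => ∑ a, _ • f (Function.update x j _) z),
      Fin.sum_univ_succ (fun k => ∑ b, d k b)]
    simp only [e1, insertFirst_apply, smul_sub, s1, update_tail,
      Finset.smul_sum, sum_Iio_succ, mul_add, sgn_add, smul_smul, mul_assoc]
    simp only [Fin.tail]
    abel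

variable {𝒢 : ZMod 2 → Submodule K g} {𝒱 : ZMod 2 → Submodule K V}
  {L : FirstClassNLieSuperalgebra K N 𝒢} (R : GradedRep L 𝒱)

/-- The summands with `i = 0` are the Lie action of the first tuple. In all the others that tuple is
a spectator, so they form the formula for the contracted cochain; the shift of `i`, or of `m` in the
last term, produces the minus sign. -/
theorem coboundaryFormula_eq {m : ℕ} (e : ZMod 2) (f : PreCochain N g V m)
    (d : Fin (m + 1) → Fin (N + 1) → ZMod 2) (c : ZMod 2) (x : Fin (m + 1) → Fin (N + 1) → g)
    (z : g) : coboundaryFormula R e f d c x z = recFormula R m e f d c x z := by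
  induction m generalizing e with
  | zero =>
    have e0 : ∀ y : Fin 0 → Fin (N + 1) → g, f y = f Fin.elim0 := fun y => by
      rw [Subsingleton.elim y]
    have e2 : Finset.Iio (Fin.last (N + 1)) = Finset.univ.map Fin.castSuccEmb := by
      ext k; induction k using Fin.lastCases <;> simp
    have h3 : Finset.Ioi (Fin.last (N + 1)) = ∅ := by ext k; simp [Fin.le_last]
    have h4 : Finset.Iio (0 : Fin 1) = ∅ := by ext k; simp
    have h5 : Finset.Ioi (0 : Fin 1) = ∅ := by
      ext k
      simp [Subsingleton.elim k 0]
    rw [recFormula]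
    dsimp only
    rw [linearCoboundary, Fin.sum_univ_castSucc (n := N + 1)]
    simp only [coboundaryFormula, Fin.sum_univ_succ (n := 0), e0, h4, h5, e2, h3,
      GradedRep.mixedBracket, Fin.snoc_castSucc, Fin.snoc_last, Fin.sum_Iio_castSucc,
      Finset.sum_map, Fin.coe_castSuccEmb, Finset.univ_eq_empty, Finset.sum_empty, add_zero,
      mul_zero, sgn_zero, pow_zero, one_smul, mul_one, Fin.succAbove_last, Fin.val_last,
      Nat.sub_self, Fin.isValue, Fin.val_zero, zero_add, pow_one, mul_comm _ e]
    have h6 : Fin.last 0 = 0 := rfl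
    simp only [h6, FirstClassNLieSuperalgebra.act]
    simp
    abel
  | succ m ih =>
    rw [recFormula]
    dsimp only
    rw [← ih, lieFormula_eq_sum, coboundaryFormula, coboundaryFormula,
      Fin.sum_univ_succ (fun i : Fin (m + 2) => ∑ j ∈ Finset.Ioi i, _),
      Fin.sum_univ_succ (fun i : Fin (m + 2) => _ • f _ (L.act (x i) z)),
      Fin.sum_univ_succ (fun i : Fin (m + 2) => _ • R.rho (x i) _)]
    -- Index `0` marks the summands `i = 0`, matched with the three parts `L1`, `L2`, `L3` of
    -- `lieFormula_eq_sum`; primes mark the formula for the contracted cochain.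
    have key : ∀ {A0 A A' B0 B B' C0 C C' D D' L1 L2 L3 : V}, A0 = -L2 → A = -A' → B0 = -L3 →
        B = -B' → C0 = L1 → C = -C' → D = -D' →
        A0 + A + (B0 + B) + (C0 + C) + D = -(A' + B' + C' + D') + (L1 - L2 - L3) := by
      rintro A0 A A' B0 B B' C0 C C' D D' L1 L2 L3 rfl rfl rfl rfl rfl rfl rfl; abel
    have hs : ∀ i : Fin (m + 1), (fun k => x (i.succ.succAbove k)) =
        Fin.cons (x 0) (fun k => Fin.tail x (i.succAbove k)) := by
      intro i; funext k
      induction k using Fin.cases with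
      | zero => simp
      | succ k => simp [Fin.tail]
    have hp : ∀ k : ℕ, (-1 : ℤˣ) ^ (k + 1) = -(-1) ^ k := fun k => by rw [pow_succ, mul_neg_one]
    refine key ?_ ?_ ?_ ?_ ?_ ?_ ?_
    · rw [Fin.sum_Ioi_zero, ← Finset.sum_neg_distrib]
      refine Finset.sum_congr rfl fun j _ => ?_
      rw [← Finset.sum_neg_distrib]
      refine Finset.sum_congr rfl fun a _ => ?_
      have : (fun k => Function.update x j.succ (Function.update (x j.succ) a
          (L.act (x 0) (x j.succ a))) ((0 : Fin (m + 2)).succAbove k)) =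
          Function.update (Fin.tail x) j (Function.update (Fin.tail x j) a
            ((actions R (x 0)).1 (Fin.tail x j a))) := by
        funext k
        by_cases h : k = j
        · subst h; simp [Fin.tail]; rfl
        · simp [h, Fin.tail]
      rw [this, sum_Ioo_zero_succ, Fin.val_zero, zero_add, pow_one]
      simp only [neg_mul, one_mul, Units.neg_smul, Fin.tail]
    · rw [← Finset.sum_neg_distrib]
      refine Finset.sum_congr rfl fun i _ => ?_
      rw [Fin.sum_Ioi_succ, ← Finset.sum_neg_distrib]
      refine Finset.sum_congr rfl fun j _ => ?_
      rw [← Finset.sum_neg_distrib]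
      refine Finset.sum_congr rfl fun a _ => ?_
      have : (fun k => Function.update x j.succ (Function.update (x j.succ) a
          (L.act (x i.succ) (x j.succ a))) (i.succ.succAbove k)) =
          Fin.cons (x 0) (fun k => Function.update (Fin.tail x) j (Function.update (Fin.tail x j) a
            (L.act (Fin.tail x i) (Fin.tail x j a))) (i.succAbove k)) := by
        funext k
        induction k using Fin.cases with
        | zero => simp [Function.update_of_ne (Fin.succ_ne_zero j).symm]
        | succ k =>
          by_cases h : i.succAbove k = j
          · subst h; simp [Fin.tail]
          · simp [h, Fin.tail]
      rw [this, Fin.sum_Ioo_succ, insertFirst_apply, Fin.val_succ, hp]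
      simp only [neg_mul, Units.neg_smul, Fin.tail]
    · rw [Fin.sum_Ioi_zero, Fin.val_zero, zero_add, pow_one]
      simp only [neg_mul, one_mul, Units.neg_smul, Fin.tail, Fin.zero_succAbove]
      rfl
    · rw [← Finset.sum_neg_distrib]
      refine Finset.sum_congr rfl fun i _ => ?_
      rw [Fin.sum_Ioi_succ, hs, insertFirst_apply, Fin.val_succ, hp]
      simp only [neg_mul, Units.neg_smul, Fin.tail]
    · have h4 : Finset.Iio (0 : Fin (m + 2)) = ∅ := by ext k; simp
      rw [h4, Fin.val_zero, zero_add]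
      simp only [Finset.sum_empty, add_zero, even_two, Even.neg_pow, one_pow, one_mul,
        Fin.zero_succAbove, actions_snd]
      rfl
    · rw [← Finset.sum_neg_distrib]
      refine Finset.sum_congr rfl fun i _ => ?_
      rw [sum_Iio_succ, hs, insertFirst_apply, Fin.val_succ, add_right_comm, hp, add_assoc e]
      simp only [neg_mul, Units.neg_smul, Fin.tail]
    · rw [hp, Units.neg_smul]
      have h1 : ∑ k : Fin (m + 1), ∑ b, d k.castSucc b =
          ∑ b, d 0 b + ∑ k : Fin m, ∑ b, Fin.tail d k.castSucc b := by
        rw [Fin.sum_univ_succ]; rfl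
      have h2 : (fun k : Fin (m + 1) => x k.castSucc) =
          Fin.cons (x 0) (fun k : Fin m => Fin.tail x k.castSucc) := by
        funext k
        induction k using Fin.cases <;> rfl
      have h3 : Fin.last (m + 1) = (Fin.last m).succ := rfl
      rw [h1, h2, ← add_assoc e, h3]
      rfl

end Formula

/-! ### Degrees of cochains and compatibility of the coboundary with components -/

section Grading

variable {K : Type*} [Field K] {g : Type*} [AddCommGroup g] [Module K g]
  {V : Type*} [AddCommGroup V] [Module K V] {N m : ℕ}
  {𝒢 : ZMod 2 → Submodule K g} {𝒱 : ZMod 2 → Submodule K V}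

theorem insertFirst_mem_homogeneous {e : ZMod 2} {f : PreCochain N g V (m + 1)}
    (hf : f ∈ homogeneous N 𝒢 𝒱 (m + 1) e) {d : Fin (N + 1) → ZMod 2} {y : Fin (N + 1) → g}
    (hy : ∀ a, y a ∈ 𝒢 (d a)) : insertFirst K y f ∈ homogeneous N 𝒢 𝒱 m (e + ∑ a, d a) := by
  intro d' c x z hx hz
  have := hf _ c _ z (cons_mem 𝒢 hy hx) hz
  rw [Fin.sum_univ_succ] at this
  rw [insertFirst_apply]
  simpa only [Fin.cons_zero, Fin.cons_succ, add_assoc] using this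

theorem mem_homogeneous_of_insertFirst {e : ZMod 2} {f : PreCochain N g V (m + 1)}
    (h : ∀ (d : Fin (N + 1) → ZMod 2) (y : Fin (N + 1) → g), (∀ a, y a ∈ 𝒢 (d a)) →
      insertFirst K y f ∈ homogeneous N 𝒢 𝒱 m (e + ∑ a, d a)) :
    f ∈ homogeneous N 𝒢 𝒱 (m + 1) e := by
  intro d c x z hx hz
  have := h (d 0) (x 0) (hx 0) (Fin.tail d) c (Fin.tail x) z (fun i => hx i.succ) hz
  rw [insertFirst_tail] at this
  rw [Fin.sum_univ_succ, ← add_assoc]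
  exact this

section

variable [DirectSum.Decomposition 𝒢]

theorem lieDerivative_mem_homogeneous {p : ZMod 2} {T : Module.End K g × Module.End K V}
    (hT : HasDegree 𝒢 p T.1) (hT' : HasDegree 𝒱 p T.2) {e : ZMod 2} {f : PreCochain N g V m}
    (hf : f ∈ multilinearCochains K N g V m) (hfe : f ∈ homogeneous N 𝒢 𝒱 m e) :
    lieDerivative 𝒢 p T e f ∈ homogeneous N 𝒢 𝒱 m (e + p) := by
  induction m generalizing e with
  | zero =>
    intro d c x z hx hz
    rw [lieDerivative_zero_apply 𝒢 p T e hf]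
    refine Submodule.sub_mem _ (units_smul_mem _ _ ?_) ?_
    · have := hT' _ _ (hfe d c x z hx hz)
      convert this using 2
      ring
    · have := hfe d _ x _ hx (hT _ _ hz)
      convert this using 2
      ring
  | succ m ih =>
    refine mem_homogeneous_of_insertFirst fun d y hy => ?_
    rw [insertFirst_lieDerivative 𝒢 p T e hf hy]
    refine Submodule.sub_mem _ (units_smul_mem _ _ ?_)
      (Submodule.sum_mem _ fun a _ => units_smul_mem _ _ ?_)
    · have := ih (insertFirst_mem hf y) (insertFirst_mem_homogeneous hfe hy)
      rwa [add_right_comm] at this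
    · have := insertFirst_mem_homogeneous hfe (hT.update_mem hy a)
      rwa [sum_update_add, if_pos (Finset.mem_univ a), add_comm _ p, ← add_assoc] at this

variable {L : FirstClassNLieSuperalgebra K N 𝒢} (R : GradedRep L 𝒱)

theorem linearCoboundary_mem_homogeneous {e : ZMod 2} {φ : g → V}
    (hφ : ∀ c, ∀ z ∈ 𝒢 c, φ z ∈ 𝒱 (e + c)) {d : Fin (N + 2) → ZMod 2} {y : Fin (N + 2) → g}
    (hy : ∀ a, y a ∈ 𝒢 (d a)) : linearCoboundary R e φ d y ∈ 𝒱 (e + ∑ a, d a) := by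
  rw [linearCoboundary_eq]
  refine Submodule.sub_mem _ (Submodule.sum_mem _ fun a _ => units_smul_mem _ _ ?_)
    (hφ _ _ (L.bracket_mem _ _ hy))
  have := R.rho_mem _ _ (fun k => hy (a.succAbove k)) _ _ (hφ _ _ (hy a))
  rwa [add_assoc, ← Fin.sum_univ_succAbove d a] at this

theorem homCoboundary_mem_homogeneous {e : ZMod 2} {f : PreCochain N g V m}
    (hf : f ∈ multilinearCochains K N g V m) (hfe : f ∈ homogeneous N 𝒢 𝒱 m e) :
    homCoboundary R e f ∈ homogeneous N 𝒢 𝒱 (m + 1) e := by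
  induction m generalizing e with
  | zero =>
    refine mem_homogeneous_of_insertFirst fun d y hy d' c x z hx hz => ?_
    rw [homCoboundary_zero_apply R e hf hy hz]
    have := linearCoboundary_mem_homogeneous R (e := e) (φ := f Fin.elim0) (fun c z hz => by
      simpa using hfe Fin.elim0 c Fin.elim0 z (fun i => i.elim0) hz) (snoc_mem hy hz)
    rw [Fin.sum_univ_castSucc (n := N + 1)] at this
    simpa only [Fin.snoc_castSucc, Fin.snoc_last, Finset.univ_eq_empty, Finset.sum_empty, add_zero,
      add_assoc] using this
  | succ m ih =>
    refine mem_homogeneous_of_insertFirst fun d y hy => ?_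
    rw [insertFirst_homCoboundary R e hf hy]
    refine Submodule.add_mem _ (Submodule.neg_mem _
      (ih (insertFirst_mem hf y) (insertFirst_mem_homogeneous hfe hy)))
      (lieDerivative_mem_homogeneous (actions_hasDegree R hy) ?_ hf hfe)
    intro c v hv
    exact R.rho_mem d y hy c v hv

end

variable (𝒢 𝒱) [DirectSum.Decomposition 𝒢] [DirectSum.Decomposition 𝒱]

theorem component_comp_left_mem (α : ZMod 2) {f : PreCochain N g V m}
    (hf : f ∈ multilinearCochains K N g V m) :
    (fun x z => component 𝒱 α (f x z)) ∈ multilinearCochains K N g V m := by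
  refine ⟨fun x z i a => ⟨fun u v => ?_, fun r u => ?_⟩, fun x => ⟨fun u v => ?_, fun r u => ?_⟩⟩
  · dsimp only
    rw [(hf.1 x z i a).map_add, component_add]
  · dsimp only
    rw [(hf.1 x z i a).map_smul, component_smul]
  · dsimp only
    rw [(hf.2 x).map_add, component_add]
  · dsimp only
    rw [(hf.2 x).map_smul, component_smul]

theorem cochainComponent_eq_extend (e : ZMod 2) (f : PreCochain N g V m) :
    cochainComponent 𝒢 𝒱 e f = extend 𝒢 fun d c x z =>
      component 𝒱 (e + (∑ i, ∑ a, d i a) + c) (f x z) := rfl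

theorem cochainComponent_mem (e : ZMod 2) {f : PreCochain N g V m}
    (hf : f ∈ multilinearCochains K N g V m) :
    cochainComponent 𝒢 𝒱 e f ∈ multilinearCochains K N g V m := by
  rw [cochainComponent_eq_extend]
  exact extend_mem 𝒢 fun d c => component_comp_left_mem 𝒱 _ hf

theorem cochainComponent_apply (e : ZMod 2) {f : PreCochain N g V m}
    (hf : f ∈ multilinearCochains K N g V m) {d : Fin m → Fin (N + 1) → ZMod 2} {c : ZMod 2}
    {x : Fin m → Fin (N + 1) → g} {z : g} (hx : ∀ i a, x i a ∈ 𝒢 (d i a)) (hz : z ∈ 𝒢 c) :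
    cochainComponent 𝒢 𝒱 e f x z = component 𝒱 (e + (∑ i, ∑ a, d i a) + c) (f x z) := by
  rw [cochainComponent_eq_extend]
  exact extend_apply 𝒢 (fun d c => component_comp_left_mem 𝒱 _ hf) hx hz

theorem cochainComponent_mem_homogeneous (e : ZMod 2) {f : PreCochain N g V m}
    (hf : f ∈ multilinearCochains K N g V m) :
    cochainComponent 𝒢 𝒱 e f ∈ homogeneous N 𝒢 𝒱 m e := by
  intro d c x z hx hz
  rw [cochainComponent_apply 𝒢 𝒱 e hf hx hz]
  exact component_mem 𝒱 _ _

theorem sum_cochainComponent {f : PreCochain N g V m}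
    (hf : f ∈ multilinearCochains K N g V m) : ∑ e, cochainComponent 𝒢 𝒱 e f = f := by
  refine multilinear_ext 𝒢 (Submodule.sum_mem _ fun e _ => cochainComponent_mem 𝒢 𝒱 e hf) hf
    fun d c x z hx hz => ?_
  simp only [Finset.sum_apply, cochainComponent_apply 𝒢 𝒱 _ hf hx hz, add_assoc]
  -- For fixed degrees of the arguments, `e` and the degree of the value differ by a constant, so
  -- every component of the value occurs exactly once.
  exact (Equiv.sum_comp (Equiv.addRight (∑ i, ∑ a, d i a + c)) fun e =>
    component 𝒱 e (f x z)).trans (sum_component 𝒱 _)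

theorem cochainComponent_of_mem {e : ZMod 2} {f : PreCochain N g V m}
    (hf : f ∈ multilinearCochains K N g V m) (hfe : f ∈ homogeneous N 𝒢 𝒱 m e) :
    cochainComponent 𝒢 𝒱 e f = f := by
  refine multilinear_ext 𝒢 (cochainComponent_mem 𝒢 𝒱 e hf) hf fun d c x z hx hz => ?_
  rw [cochainComponent_apply 𝒢 𝒱 e hf hx hz, component_of_mem 𝒱 (hfe d c x z hx hz)]

theorem cochainComponent_of_mem_ne {e e' : ZMod 2} {f : PreCochain N g V m}
    (hf : f ∈ multilinearCochains K N g V m) (hfe : f ∈ homogeneous N 𝒢 𝒱 m e) (h : e ≠ e') :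
    cochainComponent 𝒢 𝒱 e' f = 0 := by
  refine multilinear_ext 𝒢 (cochainComponent_mem 𝒢 𝒱 e' hf) (Submodule.zero_mem _)
    fun d c x z hx hz => ?_
  rw [cochainComponent_apply 𝒢 𝒱 e' hf hx hz, component_of_mem_ne 𝒱 (hfe d c x z hx hz)]
  · rfl
  · simpa using h

variable {𝒢 𝒱} in
theorem eq_zero_of_homogeneous {e e' : ZMod 2} {f : PreCochain N g V m}
    (hf : f ∈ multilinearCochains K N g V m) (hfe : f ∈ homogeneous N 𝒢 𝒱 m e)
    (hfe' : f ∈ homogeneous N 𝒢 𝒱 m e') (h : e ≠ e') : f = 0 := by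
  rw [← cochainComponent_of_mem 𝒢 𝒱 hf hfe', cochainComponent_of_mem_ne 𝒢 𝒱 hf hfe h]

/-- A subspace of multilinear functions is graded if it contains the components of its members. -/
theorem isGraded_of_cochainComponent_mem {W : Submodule K (PreCochain N g V m)}
    (hW : W ≤ multilinearCochains K N g V m)
    (h : ∀ f ∈ W, ∀ e, cochainComponent 𝒢 𝒱 e f ∈ W) : IsGraded 𝒢 𝒱 W := by
  rw [IsGraded, DirectSum.isInternal_submodule_iff_isCompl (degreePart 𝒢 𝒱 W)
    (i := 0) (j := 1) (by decide) (by ext k; revert k; decide)]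
  constructor
  · rw [Submodule.disjoint_def]
    intro f hf0 hf1
    exact Subtype.ext (eq_zero_of_homogeneous (hW f.2) hf0 hf1 (by decide))
  · rw [codisjoint_iff, Submodule.eq_top_iff']
    intro f
    have hs := sum_cochainComponent 𝒢 𝒱 (hW f.2)
    refine Submodule.mem_sup.2 ⟨⟨_, h f f.2 0⟩, cochainComponent_mem_homogeneous 𝒢 𝒱 0 (hW f.2),
      ⟨_, h f f.2 1⟩, cochainComponent_mem_homogeneous 𝒢 𝒱 1 (hW f.2), Subtype.ext ?_⟩
    conv_rhs => rw [← hs]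
    exact (Fin.sum_univ_two (M := PreCochain N g V m)
      fun e : ZMod 2 => cochainComponent 𝒢 𝒱 e f.1).symm

variable {𝒢 𝒱}
variable {L : FirstClassNLieSuperalgebra K N 𝒢} (R : GradedRep L 𝒱)

theorem cochainComponent_add (e : ZMod 2) (f f' : PreCochain N g V m) :
    cochainComponent 𝒢 𝒱 e (f + f') =
      cochainComponent 𝒢 𝒱 e f + cochainComponent 𝒢 𝒱 e f' := by
  funext x z
  simp only [cochainComponent, Pi.add_apply, component_add, Finset.sum_add_distrib]

/-- Links the operator of the statement to the operators of fixed degree, for which the Cartan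
calculus was developed. -/
theorem coboundary_eq_sum (f : PreCochain N g V m) :
    coboundary R m f = ∑ e, homCoboundary R e (cochainComponent 𝒢 𝒱 e f) := by
  funext x z
  simp only [coboundary, LinearMap.coe_mk, AddHom.coe_mk, coboundaryFormula_eq, Finset.sum_apply]
  rfl

theorem coboundary_eq_homCoboundary {e : ZMod 2} {f : PreCochain N g V m}
    (hf : f ∈ multilinearCochains K N g V m) (hfe : f ∈ homogeneous N 𝒢 𝒱 m e) :
    coboundary R m f = homCoboundary R e f := by
  rw [coboundary_eq_sum, Finset.sum_eq_single e]
  · rw [cochainComponent_of_mem 𝒢 𝒱 hf hfe]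
  · intro e' _ h
    rw [cochainComponent_of_mem_ne 𝒢 𝒱 hf hfe h.symm, map_zero]
  · simp

theorem coboundary_mem {f : PreCochain N g V m} (hf : f ∈ multilinearCochains K N g V m) :
    coboundary R m f ∈ multilinearCochains K N g V (m + 1) := by
  rw [coboundary_eq_sum]
  exact Submodule.sum_mem _ fun e _ => homCoboundary_mem R e (cochainComponent_mem 𝒢 𝒱 e hf)

theorem coboundary_mem_homogeneous {e : ZMod 2} {f : PreCochain N g V m}
    (hf : f ∈ multilinearCochains K N g V m) (hfe : f ∈ homogeneous N 𝒢 𝒱 m e) :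
    coboundary R m f ∈ homogeneous N 𝒢 𝒱 (m + 1) e := by
  rw [coboundary_eq_homCoboundary R hf hfe]
  exact homCoboundary_mem_homogeneous R hf hfe

/-- On a homogeneous component of degree `e` both applications of `δ` use the same `δ_e`, because
the coboundary preserves degrees. -/
theorem coboundary_coboundary {f : PreCochain N g V m}
    (hf : f ∈ multilinearCochains K N g V m) :
    coboundary R (m + 1) (coboundary R m f) = 0 := by
  rw [← sum_cochainComponent 𝒢 𝒱 hf, map_sum, map_sum]
  refine Finset.sum_eq_zero fun e _ => ?_
  have h1 := cochainComponent_mem 𝒢 𝒱 e hf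
  have h2 := cochainComponent_mem_homogeneous 𝒢 𝒱 e hf
  rw [coboundary_eq_homCoboundary R (coboundary_mem R h1) (coboundary_mem_homogeneous R h1 h2),
    coboundary_eq_homCoboundary R h1 h2, homCoboundary_homCoboundary R e h1]

/-- The coboundary operator commutes with the projections to the components. -/
theorem cochainComponent_coboundary (e : ZMod 2) {f : PreCochain N g V m}
    (hf : f ∈ multilinearCochains K N g V m) :
    cochainComponent 𝒢 𝒱 e (coboundary R m f) =
      coboundary R m (cochainComponent 𝒢 𝒱 e f) := by
  have hmem := fun e => cochainComponent_mem 𝒢 𝒱 e hf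
  have hhom := fun e => cochainComponent_mem_homogeneous 𝒢 𝒱 e hf
  conv_lhs => rw [← sum_cochainComponent 𝒢 𝒱 hf, map_sum]
  refine (map_sum (AddMonoidHom.mk' (cochainComponent 𝒢 𝒱 e) (cochainComponent_add e)) _ _).trans ?_
  rw [Finset.sum_eq_single e]
  · exact cochainComponent_of_mem 𝒢 𝒱 (coboundary_mem R (hmem e))
      (coboundary_mem_homogeneous R (hmem e) (hhom e))
  · intro e' _ h
    exact cochainComponent_of_mem_ne 𝒢 𝒱 (coboundary_mem R (hmem e'))
      (coboundary_mem_homogeneous R (hmem e') (hhom e')) h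
  · simp

end Grading

/-! ### Super-skew-symmetry under exchange of neighbouring entries -/

section SkewTuples

variable {K : Type*} [Field K] {g : Type*} [AddCommGroup g] [Module K g]
  {W : Type*} [AddCommGroup W] [Module K W]
  (𝒢 : ZMod 2 → Submodule K g)

/-- Super-skew-symmetry in two arguments follows from the case where all arguments are
homogeneous. -/
theorem skew_of_homogeneous [DirectSum.Decomposition 𝒢] {ι : Type*} [Fintype ι] [DecidableEq ι]
    (G : MultilinearMap K (fun _ : ι => g) W) {s t : ι}
    (h : ∀ (d : ι → ZMod 2) (w : ι → g), (∀ i, w i ∈ 𝒢 (d i)) →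
      G w = -(sgn (d s * d t) • G (w ∘ Equiv.swap s t)))
    {w : ι → g} {p q : ZMod 2} (hs : w s ∈ 𝒢 p) (ht : w t ∈ 𝒢 q) :
    G w = -(sgn (p * q) • G (w ∘ Equiv.swap s t)) := by
  have h1 : ∀ w : ι → g, G w = ∑ d : ι → ZMod 2, G fun i => component 𝒢 (d i) (w i) := by
    intro w
    have := G.map_sum fun i (c : ZMod 2) => component 𝒢 c (w i)
    simpa only [sum_component] using this
  -- The degree patterns on the right are permuted together with the arguments, so that both sides
  -- are compared pattern by pattern.
  rw [h1 w, h1 (w ∘ Equiv.swap s t), Finset.smul_sum, ← Finset.sum_neg_distrib,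
    ← Equiv.sum_comp (Equiv.arrowCongr (Equiv.swap s t) (Equiv.refl (ZMod 2)))
      (fun d => -(sgn (p * q) • G fun i => component 𝒢 (d i) ((w ∘ Equiv.swap s t) i)))]
  refine Finset.sum_congr rfl fun d _ => ?_
  have h2 : (fun i => component 𝒢 ((Equiv.arrowCongr (Equiv.swap s t) (Equiv.refl (ZMod 2))) d i)
      ((w ∘ Equiv.swap s t) i)) = (fun i => component 𝒢 (d i) (w i)) ∘ Equiv.swap s t := by
    funext i
    simp [Equiv.arrowCongr]
  rw [h2]
  -- A pattern that disagrees with the degrees `p` and `q` of the two arguments contributes zero to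
  -- both sides.
  by_cases hds : d s = p
  · by_cases hdt : d t = q
    · rw [← hds, ← hdt]
      exact h d _ fun i => component_mem 𝒢 _ _
    · have h0 : component 𝒢 (d t) (w t) = 0 := component_of_mem_ne 𝒢 ht (Ne.symm hdt)
      rw [G.map_coord_zero t h0, G.map_coord_zero s (by simpa using h0), smul_zero, neg_zero]
  · have h0 : component 𝒢 (d s) (w s) = 0 := component_of_mem_ne 𝒢 hs (Ne.symm hds)
    rw [G.map_coord_zero s h0, G.map_coord_zero t (by simpa using h0), smul_zero, neg_zero]

/-- Only the two exchanged entries see a different set of predecessors: one gains the other. In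
characteristic 2 a loss is also an addition, so both cases have the same form. -/
theorem sum_Iio_swap {n : ℕ} (i : Fin n) (d : Fin (n + 1) → ZMod 2) (a : Fin (n + 1)) :
    ∑ k ∈ Finset.Iio (Equiv.swap i.castSucc i.succ a), d (Equiv.swap i.castSucc i.succ k) =
      ∑ k ∈ Finset.Iio a, d k +
        if a = i.castSucc then d i.succ else if a = i.succ then d i.castSucc else 0 := by
  have h : ∀ (c : Fin (n + 1)) (f : Fin (n + 1) → ZMod 2),
      ∑ k ∈ Finset.Iio c, f k = ∑ k, if k < c then f k else 0 := by
    intro c f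
    rw [← Finset.sum_filter]
    congr 1
    ext k; simp
  have hlt : i.castSucc < i.succ := Fin.castSucc_lt_succ
  have h3 : (if a = i.castSucc then d i.succ else if a = i.succ then d i.castSucc else 0) =
      ∑ k, if a = i.castSucc then (if k = i.succ then d k else 0)
        else if a = i.succ then (if k = i.castSucc then d k else 0) else 0 := by
    split_ifs <;> simp
  rw [h, h, h3, ← Finset.sum_add_distrib, ← Equiv.sum_comp (Equiv.swap i.castSucc i.succ)]
  refine Finset.sum_congr rfl fun k _ => ?_
  have hv1 : (i.castSucc : ℕ) = i := rfl
  have hv2 : (i.succ : ℕ) = i + 1 := rfl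
  have hk := Equiv.swap_apply_self i.castSucc i.succ k
  rw [hk]
  simp only [Equiv.swap_apply_def, Fin.ext_iff, Fin.lt_def, Fin.val_castSucc, Fin.val_succ]
  split_ifs <;> first
    | omega
    | exact (CharTwo.add_self_eq_zero _).symm
    | simp

theorem sum_comp_swap {n : ℕ} (s t : Fin n) (d : Fin n → ZMod 2) :
    ∑ k, d (Equiv.swap s t k) = ∑ k, d k := Equiv.sum_comp _ d

variable {𝒢}

theorem swap_mem {n : ℕ} {d : Fin n → ZMod 2} {y : Fin n → g} (hy : ∀ a, y a ∈ 𝒢 (d a))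
    (s t : Fin n) : ∀ a, (y ∘ Equiv.swap s t) a ∈ 𝒢 ((d ∘ Equiv.swap s t) a) := fun _ => hy _

theorem update_swap {n : ℕ} {α : Type*} (y : Fin n → α) (s t a : Fin n) (u : α) :
    Function.update (y ∘ Equiv.swap s t) (Equiv.swap s t a) u =
      Function.update y a u ∘ Equiv.swap s t := by
  funext k
  by_cases h : Equiv.swap s t k = a
  · subst h; simp
  · have : k ≠ Equiv.swap s t a := by
      rintro rfl
      simp at h
    simp [h, this]

/-- The action of an operator preserves super-skew-symmetry. -/
theorem tupleDeriv_skew {n : ℕ} {i : Fin n} {F : (Fin (n + 1) → g) → W}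
    (hF : ∀ (d : Fin (n + 1) → ZMod 2) (y : Fin (n + 1) → g), (∀ a, y a ∈ 𝒢 (d a)) →
      F y = -(sgn (d i.castSucc * d i.succ) • F (y ∘ Equiv.swap i.castSucc i.succ)))
    {p : ZMod 2} {A : Module.End K g} (hA : HasDegree 𝒢 p A)
    {d : Fin (n + 1) → ZMod 2} {y : Fin (n + 1) → g} (hy : ∀ a, y a ∈ 𝒢 (d a)) :
    tupleDeriv p A d F y = -(sgn (d i.castSucc * d i.succ) •
      tupleDeriv p A (d ∘ Equiv.swap i.castSucc i.succ) F
        (y ∘ Equiv.swap i.castSucc i.succ)) := by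
  rw [tupleDeriv, tupleDeriv, Finset.smul_sum, ← Finset.sum_neg_distrib,
    ← Equiv.sum_comp (Equiv.swap i.castSucc i.succ)
    (fun a => -(sgn (d i.castSucc * d i.succ) • _))]
  refine Finset.sum_congr rfl fun a _ => ?_
  have h1 : (y ∘ Equiv.swap i.castSucc i.succ) (Equiv.swap i.castSucc i.succ a) = y a := by simp
  rw [hF _ _ (hA.update_mem hy a), h1, update_swap, smul_neg, sgn_smul_sgn_smul,
    sgn_smul_sgn_smul]
  simp only [Function.comp_apply, sum_Iio_swap]
  congr 3
  have hne : i.castSucc ≠ i.succ := (Fin.castSucc_lt_succ).ne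
  by_cases hs : a = i.castSucc
  · subst hs
    rw [Function.update_self, Function.update_of_ne hne.symm, if_pos rfl]; ring
  · by_cases ht : a = i.succ
    · subst ht
      rw [Function.update_self, Function.update_of_ne hne, if_neg hne.symm, if_pos rfl]; ring
    · rw [Function.update_of_ne (Ne.symm hs), Function.update_of_ne (Ne.symm ht), if_neg hs,
        if_neg ht]; ring

end SkewTuples

/-! ### Super-skew-symmetry of the coboundary of a linear map -/

section LinearCoboundary

variable {K : Type*} [Field K] {g : Type*} [AddCommGroup g] [Module K g]
  {V : Type*} [AddCommGroup V] [Module K V] {N : ℕ}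
  {𝒢 : ZMod 2 → Submodule K g} {𝒱 : ZMod 2 → Submodule K V}
  {L : FirstClassNLieSuperalgebra K N 𝒢} (R : GradedRep L 𝒱)

/-- Reduces the degrees after a position to the total and the degrees before it, so that
`sum_Iio_swap` alone controls the effect of an exchange. -/
theorem sum_Ioi_eq {n : ℕ} (d : Fin (n + 1) → ZMod 2) (a : Fin (n + 1)) :
    ∑ k ∈ Finset.Ioi a, d k = ∑ k, d k + d a + ∑ k ∈ Finset.Iio a, d k := by
  rw [sum_eq_Iio_add_Ioi a d]
  grind

theorem swap_comp_succAbove_castSucc {n : ℕ} (i : Fin n) (y : Fin (n + 1) → g) :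
    (fun k => (y ∘ Equiv.swap i.castSucc i.succ) (i.castSucc.succAbove k)) =
      fun k => y (i.succ.succAbove k) := by
  funext k
  simp only [Function.comp_apply]
  congr 1
  simp only [Equiv.swap_apply_def, Fin.succAbove, Fin.lt_def, Fin.ext_iff]
  split_ifs <;> simp_all <;> omega

theorem swap_comp_succAbove_succ {n : ℕ} (i : Fin n) (y : Fin (n + 1) → g) :
    (fun k => (y ∘ Equiv.swap i.castSucc i.succ) (i.succ.succAbove k)) =
      fun k => y (i.castSucc.succAbove k) := by
  have := swap_comp_succAbove_castSucc i (y ∘ Equiv.swap i.castSucc i.succ)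
  rw [← this]
  funext k
  simp

/-- The term at `a` on the left corresponds to the term at `σ a` on the right. If `a` is one of the
two exchanged positions, the factor `-1` comes from the position sign and the degree factor from the
predecessors; otherwise the exchange takes place inside `ρ`. The term `φ([y_1, …, y_n])` is covered
by skew-symmetry of the bracket. -/
theorem linearCoboundary_skew (e : ZMod 2) (φ : g → V) {d : Fin (N + 2) → ZMod 2}
    {y : Fin (N + 2) → g} (hφ : IsLinearMap K φ) (hy : ∀ a, y a ∈ 𝒢 (d a)) (i : Fin (N + 1)) :
    linearCoboundary R e φ d y = -(sgn (d i.castSucc * d i.succ) •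
      linearCoboundary R e φ (d ∘ Equiv.swap i.castSucc i.succ)
        (y ∘ Equiv.swap i.castSucc i.succ)) := by
  set σ := Equiv.swap i.castSucc i.succ with hσ
  have hl : φ (L.bracket y) = -(sgn (d i.castSucc * d i.succ) • φ (L.bracket (y ∘ σ))) := by
    rw [L.bracket_skew y i _ _ (hy _) (hy _), hφ.map_neg]
    exact congrArg _ (map_units_smul (IsLinearMap.mk' _ hφ) _ _)
  have hne : i.castSucc ≠ i.succ := (Fin.castSucc_lt_succ).ne
  have hS : ∑ a, linearCoboundarySign a e d • R.rho (fun k => y (a.succAbove k)) (φ (y a)) =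
      -(sgn (d i.castSucc * d i.succ) • ∑ a, linearCoboundarySign a e (d ∘ σ) •
        R.rho (fun k => (y ∘ σ) (a.succAbove k)) (φ ((y ∘ σ) a))) := by
    rw [Finset.smul_sum, ← Finset.sum_neg_distrib,
      ← Equiv.sum_comp σ (fun a => -(sgn (d i.castSucc * d i.succ) • _))]
    refine Finset.sum_congr rfl fun a _ => ?_
    have h1 : (y ∘ σ) (σ a) = y a := by simp [hσ]
    have h2 : (d ∘ σ) (σ a) = d a := by simp [hσ]
    have h3 : linearCoboundarySign (σ a) e (d ∘ σ) = (-1 : ℤˣ) ^ (N + 1 - (σ a : ℕ)) *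
        sgn (e * ∑ b ∈ Finset.Iio a, d b + (e + d a) * ∑ b ∈ Finset.Ioi a, d b +
          if a = i.castSucc ∨ a = i.succ then d i.castSucc * d i.succ else 0) := by
      rw [linearCoboundarySign, sum_Ioi_eq, h2, sum_Ioi_eq d a]
      simp only [Function.comp_apply]
      rw [sum_comp_swap, sum_Iio_swap]
      congr 2
      by_cases hs : a = i.castSucc
      · subst hs
        simp only [if_true, true_or]
        grind
      · by_cases ht : a = i.succ
        · subst ht
          simp only [if_neg hne.symm, if_true, or_true]
          grind
        · simp [hs, ht]
    have hi : N + 1 - (i : ℕ) = N + 1 - (i + 1 : ℕ) + 1 := by omega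
    rw [h1, h3, linearCoboundarySign]
    by_cases hs : a = i.castSucc
    · subst hs
      have h4 : σ i.castSucc = i.succ := by simp [hσ]
      rw [h4, swap_comp_succAbove_succ, if_pos (Or.inl rfl), smul_smul, mul_left_comm, ← sgn_add,
        add_comm (d _ * d _), add_assoc (_ + _), CharTwo.add_self_eq_zero, add_zero,
        Fin.val_castSucc, Fin.val_succ, hi, pow_succ, mul_neg_one, neg_mul, Units.neg_smul]
    · by_cases ht : a = i.succ
      · subst ht
        have h4 : σ i.succ = i.castSucc := by simp [hσ]
        rw [h4, swap_comp_succAbove_castSucc, if_pos (Or.inr rfl), smul_smul, mul_left_comm,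
          ← sgn_add, add_comm (d _ * d _), add_assoc (_ + _), CharTwo.add_self_eq_zero, add_zero,
          Fin.val_castSucc, Fin.val_succ, hi, pow_succ, mul_neg_one, neg_mul, Units.neg_smul,
          neg_neg]
      · have h4 : σ a = a := Equiv.swap_apply_of_ne_of_ne hs ht
        -- Both exchanged positions differ from `a`, so they stay neighbours after `a` is removed;
        -- `j` is their position in the shorter tuple.
        obtain ⟨j, hj1, hj2⟩ : ∃ j : Fin N, a.succAbove j.castSucc = i.castSucc ∧
            a.succAbove j.succ = i.succ := by
          obtain ⟨s', hs'⟩ := Fin.exists_succAbove_eq (Ne.symm hs)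
          obtain ⟨t', ht'⟩ := Fin.exists_succAbove_eq (Ne.symm ht)
          have hst : (t' : ℕ) = s' + 1 := by
            simp only [Fin.succAbove, Fin.lt_def, Fin.ext_iff] at hs' ht' hs ht
            split_ifs at hs' ht' <;> simp_all <;> omega
          have hsN : (s' : ℕ) < N := by omega
          refine ⟨⟨s', hsN⟩, ?_, ?_⟩
          · rw [← hs']; rfl
          · rw [← ht']; congr 1; ext; simp [hst]
        have h5 : (fun k => (y ∘ σ) (a.succAbove k)) =
            (fun k => y (a.succAbove k)) ∘ Equiv.swap j.castSucc j.succ := by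
          funext k
          simp only [Function.comp_apply, hσ, ← hj1, ← hj2]
          congr 1
          simp only [Equiv.swap_apply_def, Fin.succAbove_right_inj]
          split_ifs <;> rfl
        rw [h4, h5, if_neg (by tauto), add_zero,
          R.rho_skew _ j _ _ (hy (a.succAbove j.castSucc)) (hy (a.succAbove j.succ)), hj1, hj2,
          LinearMap.neg_apply, smul_neg]
        rw [smul_comm]
        rfl
  rw [linearCoboundary_eq, linearCoboundary_eq, hS, hl, smul_sub]
  abel

end LinearCoboundary

/-! ### The coboundary of a supercochain is a supercochain -/

section Supercochains

variable {K : Type*} [Field K] {g : Type*} [AddCommGroup g] [Module K g]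
  {V : Type*} [AddCommGroup V] [Module K V] {N m : ℕ}
  {𝒢 : ZMod 2 → Submodule K g} {𝒱 : ZMod 2 → Submodule K V} [DirectSum.Decomposition 𝒢]

/-- It is enough to check super-skew-symmetry on homogeneous arguments. -/
theorem mem_supercochains_of_homogeneous {f : PreCochain N g V m}
    (hf : f ∈ multilinearCochains K N g V m)
    (h1 : ∀ (d : Fin m → Fin (N + 1) → ZMod 2) (c : ZMod 2) (x : Fin m → Fin (N + 1) → g) (z : g),
      (∀ i a, x i a ∈ 𝒢 (d i a)) → z ∈ 𝒢 c → ∀ (i : Fin m) (a : Fin N),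
        f x z = -(sgn (d i a.castSucc * d i a.succ) •
          f (Function.update x i (x i ∘ Equiv.swap a.castSucc a.succ)) z))
    (h2 : ∀ (d : Fin m → Fin (N + 1) → ZMod 2) (c : ZMod 2) (x : Fin m → Fin (N + 1) → g) (z : g),
      (∀ i a, x i a ∈ 𝒢 (d i a)) → z ∈ 𝒢 c → ∀ i : Fin m, (i : ℕ) + 1 = m →
        f x z = -(sgn (d i (Fin.last N) * c) •
          f (Function.update x i (Function.update (x i) (Fin.last N) z)) (x i (Fin.last N)))) :
    f ∈ supercochains N 𝒢 V m := by
  have e1 : ∀ (w : Option (Fin m × Fin (N + 1)) → g) (i : Fin m) (a : Fin N),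
      toMultilinearMap f hf (w ∘ Equiv.swap (some (i, a.castSucc)) (some (i, a.succ))) =
        f (Function.update (fun i a => w (some (i, a))) i
          ((fun a => w (some (i, a))) ∘ Equiv.swap a.castSucc a.succ)) (w none) := by
    intro w i a
    rw [toMultilinearMap_apply]
    congr 1
    funext j b
    by_cases hj : j = i
    · subst hj
      simp only [Function.comp_apply, Function.update_self, Equiv.swap_apply_def,
        Option.some.injEq, Prod.mk.injEq, true_and]
      split_ifs <;> rfl
    · simp [hj, Equiv.swap_apply_def]
  have e2 : ∀ (w : Option (Fin m × Fin (N + 1)) → g) (i : Fin m),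
      toMultilinearMap f hf (w ∘ Equiv.swap (some (i, Fin.last N)) none) =
        f (Function.update (fun i a => w (some (i, a))) i
          (Function.update (fun a => w (some (i, a))) (Fin.last N) (w none)))
            (w (some (i, Fin.last N))) := by
    intro w i
    rw [toMultilinearMap_apply]
    congr 1
    · funext j b
      by_cases hj : j = i
      · subst hj
        by_cases hb : b = Fin.last N
        · subst hb; simp
        · simp [hb, Equiv.swap_apply_def]
      · simp [hj, Equiv.swap_apply_def]
  refine ⟨hf.1, hf.2, fun x z i a p q hp hq => ?_, fun x z i p q hi hp hq => ?_⟩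
  · let w : Option (Fin m × Fin (N + 1)) → g := fun o => o.elim z fun p => x p.1 p.2
    have := skew_of_homogeneous 𝒢 (toMultilinearMap f hf) (s := some (i, a.castSucc))
      (t := some (i, a.succ)) (w := w) (fun d w hw => by
        rw [e1]
        exact h1 (fun i a => d (some (i, a))) (d none) _ _ (fun i a => hw _) (hw _) i a) hp hq
    rw [e1] at this
    exact this
  · let w : Option (Fin m × Fin (N + 1)) → g := fun o => o.elim z fun p => x p.1 p.2
    have := skew_of_homogeneous 𝒢 (toMultilinearMap f hf) (s := some (i, Fin.last N))
      (t := none) (w := w) (fun d w hw => by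
        rw [e2]
        exact h2 (fun i a => d (some (i, a))) (d none) _ _ (fun i a => hw _) (hw _) i hi) hp hq
    rw [e2] at this
    exact this

theorem mem_supercochains_zero {f : PreCochain N g V 0}
    (hf : f ∈ multilinearCochains K N g V 0) : f ∈ supercochains N 𝒢 V 0 :=
  ⟨hf.1, hf.2, fun _ _ i => i.elim0, fun _ _ i => i.elim0⟩

/-- The exchange with `z` involves only the last tuple. It is therefore a condition on the first
tuple only when `m = 0`, and is inherited from the contractions otherwise. -/
theorem mem_supercochains_of_insertFirst {f : PreCochain N g V (m + 1)}
    (hf : f ∈ multilinearCochains K N g V (m + 1))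
    (h : ∀ (d : Fin (N + 1) → ZMod 2) (y : Fin (N + 1) → g), (∀ a, y a ∈ 𝒢 (d a)) →
      insertFirst K y f ∈ supercochains N 𝒢 V m)
    (h1 : ∀ (d : Fin (N + 1) → ZMod 2) (y : Fin (N + 1) → g), (∀ a, y a ∈ 𝒢 (d a)) →
      ∀ a : Fin N, insertFirst K y f = -(sgn (d a.castSucc * d a.succ) •
        insertFirst K (y ∘ Equiv.swap a.castSucc a.succ) f))
    (h2 : m = 0 → ∀ (d : Fin (N + 1) → ZMod 2) (c : ZMod 2) (y : Fin (N + 1) → g)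
      (x : Fin m → Fin (N + 1) → g) (z : g), (∀ a, y a ∈ 𝒢 (d a)) → z ∈ 𝒢 c →
      insertFirst K y f x z = -(sgn (d (Fin.last N) * c) •
        insertFirst K (Function.update y (Fin.last N) z) f x (y (Fin.last N)))) :
    f ∈ supercochains N 𝒢 V (m + 1) := by
  have e0 : ∀ (x : Fin (m + 1) → Fin (N + 1) → g) u,
      (Fin.cons u (Fin.tail x) : Fin (m + 1) → Fin (N + 1) → g) = Function.update x 0 u := by
    intro x u
    conv_rhs => rw [← Fin.cons_self_tail x, Fin.update_cons_zero]
  refine mem_supercochains_of_homogeneous hf (fun d c x z hx hz i a => ?_)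
    (fun d c x z hx hz i hi => ?_)
  · induction i using Fin.cases with
    | zero =>
      have := congrFun (congrFun (h1 _ _ (hx 0) a) (Fin.tail x)) z
      simp only [Pi.neg_apply, Pi.smul_apply, insertFirst_apply, e0, Function.update_eq_self] at this
      exact this
    | succ i =>
      have := (h _ _ (hx 0)).2.2.1 (Fin.tail x) z i a _ _ (hx i.succ _) (hx i.succ _)
      simp only [insertFirst_apply, update_tail, Fin.cons_self_tail] at this
      exact this
  · induction i using Fin.cases with
    | zero =>
      have := h2 (by simpa using hi.symm) _ c _ (Fin.tail x) z (hx 0) hz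
      simp only [insertFirst_apply, e0, Function.update_eq_self] at this
      exact this
    | succ i =>
      have := (h _ _ (hx 0)).2.2.2 (Fin.tail x) z i _ _ (by simpa using hi) (hx i.succ _) hz
      simp only [insertFirst_apply, update_tail, Fin.cons_self_tail] at this
      exact this

theorem insertFirst_mem_supercochains {f : PreCochain N g V (m + 1)}
    (hf : f ∈ supercochains N 𝒢 V (m + 1)) (y : Fin (N + 1) → g) :
    insertFirst K y f ∈ supercochains N 𝒢 V m := by
  have hm := insertFirst_mem (supercochains_le_multilinear 𝒢 hf) y
  refine ⟨hm.1, hm.2, fun x z i a p q hp hq => ?_, fun x z i p q hi hp hq => ?_⟩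
  · have := hf.2.2.1 (Fin.cons y x) z i.succ a p q hp hq
    simpa only [insertFirst_apply, Fin.cons_update, Fin.cons_succ] using this
  · have := hf.2.2.2 (Fin.cons y x) z i.succ p q (by simpa using hi) hp hq
    simpa only [insertFirst_apply, Fin.cons_update, Fin.cons_succ] using this

theorem insertFirst_skew {f : PreCochain N g V (m + 1)}
    (hf : f ∈ supercochains N 𝒢 V (m + 1)) {d : Fin (N + 1) → ZMod 2} {y : Fin (N + 1) → g}
    (hy : ∀ a, y a ∈ 𝒢 (d a)) (a : Fin N) :
    insertFirst K y f = -(sgn (d a.castSucc * d a.succ) •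
        insertFirst K (y ∘ Equiv.swap a.castSucc a.succ) f) := by
  funext x z
  have := hf.2.2.1 (Fin.cons y x) z 0 a _ _ (hy _) (hy _)
  simpa only [insertFirst_apply, Fin.update_cons_zero, Fin.cons_zero, Pi.neg_apply,
    Pi.smul_apply] using this

/-- A function of `𝐱_1` and `z`, as a function of `n` arguments. -/
def uncurryLast (f : PreCochain N g V 1) (y : Fin (N + 2) → g) : V :=
  f (fun _ => Fin.init (α := fun _ => g) y) (y (Fin.last (N + 1)))

theorem insertFirst_eq_uncurryLast (f : PreCochain N g V 1) (y : Fin (N + 1) → g)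
    (x : Fin 0 → Fin (N + 1) → g) (z : g) :
    insertFirst K y f x z = uncurryLast f (Fin.snoc (α := fun _ => g) y z) := by
  rw [insertFirst_apply, uncurryLast, Fin.init_snoc, Fin.snoc_last]
  congr 1
  funext i
  rw [Fin.fin_one_eq_zero i]
  rfl

theorem snoc_comp_swap_last {α : Type*} (y : Fin (N + 1) → α) (z : α) :
    Fin.snoc (α := fun _ => α) y z ∘ Equiv.swap (Fin.last N).castSucc (Fin.last N).succ =
      Fin.snoc (α := fun _ => α) (Function.update y (Fin.last N) z) (y (Fin.last N)) := by
  funext k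
  rw [Fin.succ_last]
  induction k using Fin.lastCases with
  | last => simp
  | cast k =>
    by_cases h : k = Fin.last N
    · subst h; simp
    · have h1 : k.castSucc ≠ (Fin.last N).castSucc := by simpa using h
      have h2 : k.castSucc ≠ Fin.last (N + 1) := (Fin.castSucc_lt_last k).ne
      rw [Function.comp_apply, Equiv.swap_apply_of_ne_of_ne h1 h2]
      simp [h]

theorem snoc_comp_swap_castSucc {α : Type*} (y : Fin (N + 1) → α) (z : α) (a : Fin N) :
    Fin.snoc (α := fun _ => α) y z ∘ Equiv.swap a.castSucc.castSucc a.castSucc.succ =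
      Fin.snoc (α := fun _ => α) (y ∘ Equiv.swap a.castSucc a.succ) z := by
  funext k
  rw [Fin.succ_castSucc]
  induction k using Fin.lastCases with
  | last =>
    rw [Function.comp_apply, Equiv.swap_apply_of_ne_of_ne (Fin.castSucc_lt_last _).ne'
      (Fin.castSucc_lt_last _).ne']
    simp
  | cast k =>
    simp only [Function.comp_apply, Fin.snoc_castSucc, Equiv.swap_apply_def,
      Fin.castSucc_inj]
    split_ifs <;> simp only [Fin.snoc_castSucc]

theorem uncurryLast_skew {f : PreCochain N g V 1} (hf : f ∈ supercochains N 𝒢 V 1)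
    {d : Fin (N + 2) → ZMod 2} {y : Fin (N + 2) → g} (hy : ∀ a, y a ∈ 𝒢 (d a)) :
    uncurryLast f y = -(sgn (d (Fin.last N).castSucc * d (Fin.last N).succ) •
      uncurryLast f (y ∘ Equiv.swap (Fin.last N).castSucc (Fin.last N).succ)) := by
  have h := hf.2.2.2 (fun _ => Fin.init (α := fun _ => g) y) (y (Fin.last (N + 1))) 0 _ _ rfl
    (hy (Fin.last N).castSucc) (hy (Fin.last (N + 1)))
  have e := snoc_comp_swap_last (Fin.init (α := fun _ => g) y) (y (Fin.last (N + 1)))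
  rw [Fin.snoc_init_self] at e
  rw [e, uncurryLast, uncurryLast, Fin.init_snoc, Fin.snoc_last, Fin.succ_last]
  refine h.trans ?_
  congr 3
  funext i
  rw [Fin.fin_one_eq_zero i, Function.update_self]

/-- Symmetry within the first tuple comes from `tupleDeriv_skew`, and symmetry in the later tuples
from the induction. With a single tuple, `z` has to be treated as the `n`-th entry. -/
theorem lieDerivative_mem_supercochains {p : ZMod 2} {T : Module.End K g × Module.End K V}
    (hT : HasDegree 𝒢 p T.1) (e : ZMod 2) {f : PreCochain N g V m}
    (hf : f ∈ supercochains N 𝒢 V m) : lieDerivative 𝒢 p T e f ∈ supercochains N 𝒢 V m := by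
  have hfm := supercochains_le_multilinear 𝒢 hf
  induction m generalizing e with
  | zero => exact mem_supercochains_zero (lieDerivative_mem 𝒢 p T e hfm)
  | succ m ih =>
    refine mem_supercochains_of_insertFirst (lieDerivative_mem 𝒢 p T e hfm)
      (fun d y hy => ?_) (fun d y hy a => ?_) ?_
    · rw [insertFirst_lieDerivative 𝒢 p T e hfm hy]
      exact Submodule.sub_mem _ (units_smul_mem _ _
        (ih _ (insertFirst_mem_supercochains hf y) (insertFirst_mem hfm y)))
        (Submodule.sum_mem _ fun a _ => units_smul_mem _ _ (insertFirst_mem_supercochains hf _))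
    · have h := tupleDeriv_skew (fun d y hy => insertFirst_skew hf hy a) hT hy
      rw [insertFirst_lieDerivative 𝒢 p T e hfm hy, h,
        insertFirst_lieDerivative 𝒢 p T e hfm (swap_mem hy a.castSucc a.succ),
        insertFirst_skew hf hy a, map_neg, map_units_smul]
      simp only [Function.comp_apply, sum_comp_swap, smul_sub, smul_neg]
      rw [smul_comm]
      abel
    · rintro rfl d c y x z hy hz
      -- As a function of `n` arguments the Lie derivative involves one derivation over all `n`
      -- entries, `z` included, so `tupleDeriv_skew` also covers the exchange with `z`.
      have hq : ∀ {d : Fin (N + 2) → ZMod 2} {y : Fin (N + 2) → g}, (∀ a, y a ∈ 𝒢 (d a)) →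
          uncurryLast (lieDerivative 𝒢 p T e f) y =
            sgn (p * e) • T.2 (uncurryLast f y) - tupleDeriv p T.1 d (uncurryLast f) y := by
        intro d y hy
        have e2 : Finset.Iio (Fin.last (N + 1)) = Finset.univ.map Fin.castSuccEmb := by
          ext k; induction k using Fin.lastCases <;> simp
        have hy' : ∀ a, Fin.init (α := fun _ => g) y a ∈
            𝒢 (Fin.init (α := fun _ => ZMod 2) d a) := fun a => hy _
        rw [← Fin.snoc_init_self y, ← insertFirst_eq_uncurryLast (K := K) _ _ Fin.elim0,
          insertFirst_lieDerivative 𝒢 p T e hfm hy', Pi.sub_apply, Pi.sub_apply, Pi.smul_apply,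
          Pi.smul_apply, lieDerivative_zero_apply 𝒢 _ _ _ (insertFirst_mem hfm _),
          insertFirst_eq_uncurryLast, insertFirst_eq_uncurryLast, smul_sub, sgn_smul_sgn_smul,
          tupleDeriv, tupleDeriv, Fin.sum_univ_castSucc (n := N + 1), e2, Finset.sum_map,
          Finset.sum_apply, Finset.sum_apply]
        simp only [Pi.smul_apply, insertFirst_eq_uncurryLast, Fin.sum_Iio_castSucc,
          Fin.snoc_castSucc, Fin.snoc_last, ← Fin.snoc_update, Fin.update_snoc_last,
          Fin.coe_castSuccEmb]
        have s1 : ∀ s : ZMod 2, p * s + p * (e + s) = p * e := by intro s; grind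
        rw [s1]
        simp only [Fin.init]
        abel
      have hY := snoc_mem hy hz
      have h := tupleDeriv_skew (fun d y hy => uncurryLast_skew hf (d := d) (y := y) hy) hT hY
      have hd : ∀ a b : ZMod 2, Fin.snoc (α := fun _ => ZMod 2) d c (Fin.last N).castSucc *
          Fin.snoc (α := fun _ => ZMod 2) d c (Fin.last N).succ = d (Fin.last N) * c := by
        intros
        rw [Fin.succ_last, Fin.snoc_castSucc, Fin.snoc_last]
      rw [insertFirst_eq_uncurryLast, insertFirst_eq_uncurryLast, hq hY, h,
        ← snoc_comp_swap_last, hq (swap_mem hY (Fin.last N).castSucc (Fin.last N).succ),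
        uncurryLast_skew hf hY, hd 0 0, map_neg, map_units_smul]
      simp only [smul_sub, smul_neg]
      rw [smul_comm]
      abel

variable {L : FirstClassNLieSuperalgebra K N 𝒢} (R : GradedRep L 𝒱)

theorem actions_skew {d : Fin (N + 1) → ZMod 2} {y : Fin (N + 1) → g}
    (hy : ∀ a, y a ∈ 𝒢 (d a)) (a : Fin N) :
    actions R y = -(sgn (d a.castSucc * d a.succ) •
      actions R (y ∘ Equiv.swap a.castSucc a.succ)) := by
  refine Prod.ext ?_ (R.rho_skew y a _ _ (hy _) (hy _))
  ext z
  have h := L.bracket_skew (Fin.snoc (α := fun _ => g) y z) a.castSucc (d a.castSucc) (d a.succ)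
    (by simpa using hy a.castSucc) (by rw [Fin.succ_castSucc, Fin.snoc_castSucc]; exact hy a.succ)
  rw [snoc_comp_swap_castSucc] at h
  exact h

/-- By the Cartan formula, the dependence on the first tuple is through a contraction and through
its operators, both of which are super-skew-symmetric. The case `m = 0` is `linearCoboundary_skew`.
-/
theorem homCoboundary_mem_supercochains (e : ZMod 2) {f : PreCochain N g V m}
    (hf : f ∈ supercochains N 𝒢 V m) : homCoboundary R e f ∈ supercochains N 𝒢 V (m + 1) := by
  have hfm := supercochains_le_multilinear 𝒢 hf
  induction m generalizing e with
  | zero =>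
    refine mem_supercochains_of_insertFirst (homCoboundary_mem R e hfm)
      (fun d y hy => mem_supercochains_zero (insertFirst_mem (homCoboundary_mem R e hfm) y))
      (fun d y hy a => ?_) fun _ d c y x z hy hz => ?_
    · refine multilinear_ext 𝒢 (insertFirst_mem (homCoboundary_mem R e hfm) y)
        (Submodule.neg_mem _ (units_smul_mem _ _ (insertFirst_mem (homCoboundary_mem R e hfm) _)))
        fun _ c x z _ hz => ?_
      have h := linearCoboundary_skew R e (f Fin.elim0) (hfm.2 _) (snoc_mem hy hz) a.castSucc
      rw [snoc_comp_swap_castSucc, snoc_comp_swap_castSucc, Fin.succ_castSucc, Fin.snoc_castSucc,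
        Fin.snoc_castSucc] at h
      rw [Pi.neg_apply, Pi.neg_apply, Pi.smul_apply, Pi.smul_apply,
        homCoboundary_zero_apply R e hfm hy hz, h,
        homCoboundary_zero_apply R e hfm (swap_mem hy a.castSucc a.succ) hz]
    · have h := linearCoboundary_skew R e (f Fin.elim0) (hfm.2 _) (snoc_mem hy hz) (Fin.last N)
      have hy' : ∀ a, Function.update y (Fin.last N) z a ∈
          𝒢 (Function.update d (Fin.last N) c a) := by
        intro a
        by_cases ha : a = Fin.last N
        · subst ha; simpa using hz
        · simpa [ha] using hy a
      rw [snoc_comp_swap_last, snoc_comp_swap_last, Fin.succ_last, Fin.snoc_castSucc,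
        Fin.snoc_last] at h
      rw [homCoboundary_zero_apply R e hfm hy hz, h,
        homCoboundary_zero_apply R e hfm hy' (hy (Fin.last N))]
  | succ m ih =>
    refine mem_supercochains_of_insertFirst (homCoboundary_mem R e hfm)
      (fun d y hy => ?_) (fun d y hy a => ?_) fun h => absurd h (Nat.succ_ne_zero m)
    · rw [insertFirst_homCoboundary R e hfm hy]
      exact Submodule.add_mem _ (Submodule.neg_mem _
        (ih _ (insertFirst_mem_supercochains hf y) (insertFirst_mem hfm y)))
        (lieDerivative_mem_supercochains (actions_hasDegree R hy) e hf)
    · have hl := isLinearMap_lieDerivative 𝒢 (∑ a, d a) e hfm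
      have h := map_units_smul (IsLinearMap.mk' _ hl)
      simp only [IsLinearMap.mk'_apply] at h
      rw [insertFirst_homCoboundary R e hfm hy,
        insertFirst_homCoboundary R e hfm (swap_mem hy a.castSucc a.succ),
        insertFirst_skew hf hy a, actions_skew R hy a, hl.map_neg, h, map_neg, map_units_smul]
      simp only [Function.comp_apply, sum_comp_swap, smul_add, smul_neg]
      abel

end Supercochains

/-! ### Gradings on cochains, cocycles, coboundaries and cohomology -/

section Cohomology

variable {K : Type*} [Field K] {g : Type*} [AddCommGroup g] [Module K g]
  {V : Type*} [AddCommGroup V] [Module K V] {N m : ℕ}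
  {𝒢 : ZMod 2 → Submodule K g} {𝒱 : ZMod 2 → Submodule K V} [DirectSum.Decomposition 𝒢]
  [DirectSum.Decomposition 𝒱]

/-- Exchanging arguments does not change their total degree, so both sides of a skew-symmetry
relation are projected to the same component of `V`. -/
theorem cochainComponent_mem_supercochains (e : ZMod 2) {f : PreCochain N g V m}
    (hf : f ∈ supercochains N 𝒢 V m) : cochainComponent 𝒢 𝒱 e f ∈ supercochains N 𝒢 V m := by
  have hfm := supercochains_le_multilinear 𝒢 hf
  have hc : ∀ (α : ZMod 2) (u : ℤˣ) (v : V), component 𝒱 α (-(u • v)) =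
      -(u • component 𝒱 α v) := by
    intro α u v
    let G : V →+ V := AddMonoidHom.mk' (component 𝒱 α) (component_add 𝒱 α)
    exact (map_neg G _).trans (congrArg _ (map_units_smul G u v))
  refine mem_supercochains_of_homogeneous (cochainComponent_mem 𝒢 𝒱 e hfm)
    (fun d c x z hx hz i a => ?_) (fun d c x z hx hz i hi => ?_)
  · have hx' : ∀ j b, Function.update x i (x i ∘ Equiv.swap a.castSucc a.succ) j b ∈
        𝒢 (Function.update d i (d i ∘ Equiv.swap a.castSucc a.succ) j b) := by
      intro j b
      by_cases hj : j = i
      · subst hj; simpa using hx j _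
      · simpa [hj] using hx j b
    have hs : ∀ j, ∑ b, Function.update d i (d i ∘ Equiv.swap a.castSucc a.succ) j b =
        ∑ b, d j b := by
      intro j
      by_cases hj : j = i
      · subst hj
        simp only [Function.update_self, Function.comp_apply, sum_comp_swap]
      · simp [hj]
    rw [cochainComponent_apply 𝒢 𝒱 e hfm hx hz, cochainComponent_apply 𝒢 𝒱 e hfm hx' hz,
      hf.2.2.1 x z i a _ _ (hx i _) (hx i _), hc]
    simp only [hs]
  · have hx' : ∀ j b, Function.update x i (Function.update (x i) (Fin.last N) z) j b ∈
        𝒢 (Function.update d i (Function.update (d i) (Fin.last N) c) j b) := by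
      intro j b
      by_cases hj : j = i
      · subst hj
        by_cases hb : b = Fin.last N
        · subst hb; simpa using hz
        · simpa [hb] using hx j b
      · simpa [hj] using hx j b
    have hs : ∑ j, ∑ b, Function.update d i (Function.update (d i) (Fin.last N) c) j b +
        d i (Fin.last N) = ∑ j, ∑ b, d j b + c := by
      rw [← Finset.add_sum_erase _ _ (Finset.mem_univ i),
        ← Finset.add_sum_erase Finset.univ (fun j => ∑ b, d j b) (Finset.mem_univ i)]
      have h1 : ∑ j ∈ Finset.univ.erase i, ∑ b,
          Function.update d i (Function.update (d i) (Fin.last N) c) j b =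
          ∑ j ∈ Finset.univ.erase i, ∑ b, d j b :=
        Finset.sum_congr rfl fun j hj => by rw [Function.update_of_ne (Finset.ne_of_mem_erase hj)]
      rw [h1, Function.update_self, Fin.sum_univ_castSucc (n := N), Fin.sum_univ_castSucc (n := N)]
      simp only [Function.update_self, ne_eq, (Fin.castSucc_lt_last _).ne, not_false_eq_true,
        Function.update_of_ne]
      ring
    rw [cochainComponent_apply 𝒢 𝒱 e hfm hx hz, cochainComponent_apply 𝒢 𝒱 e hfm hx' (hx i _),
      hf.2.2.2 x z i _ _ hi (hx i _) hz, hc, add_assoc, add_assoc, hs]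

variable {L : FirstClassNLieSuperalgebra K N 𝒢} (R : GradedRep L 𝒱)

theorem coboundary_mem_supercochains {f : PreCochain N g V m}
    (hf : f ∈ supercochains N 𝒢 V m) : coboundary R m f ∈ supercochains N 𝒢 V (m + 1) := by
  rw [coboundary_eq_sum]
  exact Submodule.sum_mem _ fun e _ =>
    homCoboundary_mem_supercochains R e (cochainComponent_mem_supercochains e hf)

theorem cocycles_le_multilinear : cocycles R m ≤ multilinearCochains K N g V m :=
  inf_le_left.trans (supercochains_le_multilinear 𝒢)

theorem coboundaries_le_cocycles : coboundaries R m ≤ cocycles R m := by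
  cases m with
  | zero => exact bot_le
  | succ m =>
    rintro _ ⟨f, hf, rfl⟩
    exact ⟨coboundary_mem_supercochains R hf,
      coboundary_coboundary R (supercochains_le_multilinear 𝒢 hf)⟩

theorem cochainComponent_mem_cocycles {f : PreCochain N g V m} (hf : f ∈ cocycles R m)
    (e : ZMod 2) : cochainComponent 𝒢 𝒱 e f ∈ cocycles R m := by
  refine ⟨cochainComponent_mem_supercochains e hf.1, ?_⟩
  have h0 : coboundary R m f = 0 := hf.2
  rw [SetLike.mem_coe, LinearMap.mem_ker, ← cochainComponent_coboundary R e
    (cocycles_le_multilinear R hf), h0]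
  exact cochainComponent_of_mem 𝒢 𝒱 (Submodule.zero_mem _) (Submodule.zero_mem _)

theorem cochainComponent_mem_coboundaries {f : PreCochain N g V m} (hf : f ∈ coboundaries R m)
    (e : ZMod 2) : cochainComponent 𝒢 𝒱 e f ∈ coboundaries R m := by
  cases m with
  | zero =>
    have h0 : f = 0 := hf
    rw [h0, cochainComponent_of_mem 𝒢 𝒱 (Submodule.zero_mem _) (Submodule.zero_mem _)]
    exact Submodule.zero_mem _
  | succ m =>
    obtain ⟨f, hf, rfl⟩ := hf
    rw [cochainComponent_coboundary R e (supercochains_le_multilinear 𝒢 hf)]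
    exact ⟨_, cochainComponent_mem_supercochains e hf, rfl⟩

/-- The two parts span because the cocycles are graded, and they meet only in zero because the
coboundaries are. -/
theorem isInternal_cohomologyPart (m : ℕ) : DirectSum.IsInternal (cohomologyPart R m) := by
  rw [DirectSum.isInternal_submodule_iff_isCompl (cohomologyPart R m)
    (i := 0) (j := 1) (by decide) (by ext k; revert k; decide)]
  constructor
  · rw [Submodule.disjoint_def]
    rintro _ ⟨z, hz, rfl⟩ ⟨w, hw, hwz⟩
    have hzm := cocycles_le_multilinear R z.2
    have hwm := cocycles_le_multilinear R w.2
    rw [Submodule.mkQ_apply, Submodule.mkQ_apply, Submodule.Quotient.eq] at hwz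
    have h1 : w.1 - z.1 ∈ coboundaries R m := hwz
    -- Here `z` is an even and `w` an odd cocycle of the same class. The degree `0` component of the
    -- coboundary `z - w` is `z`, which is therefore itself a coboundary.
    have h2 := cochainComponent_mem_coboundaries R (neg_mem h1) 0
    have h3 := cochainComponent_add (𝒢 := 𝒢) (𝒱 := 𝒱) 0 (-(w.1 - z.1)) w.1
    rw [neg_sub, sub_add_cancel, cochainComponent_of_mem 𝒢 𝒱 hzm hz,
      cochainComponent_of_mem_ne 𝒢 𝒱 hwm hw (by decide), add_zero] at h3
    rw [neg_sub, ← h3] at h2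
    rw [Submodule.mkQ_apply, Submodule.Quotient.mk_eq_zero]
    exact h2
  · rw [codisjoint_iff]
    have h := isGraded_of_cochainComponent_mem 𝒢 𝒱 (cocycles_le_multilinear R (m := m))
      fun f hf e => cochainComponent_mem_cocycles R hf e
    rw [IsGraded, DirectSum.isInternal_submodule_iff_isCompl (degreePart 𝒢 𝒱 _)
      (i := 0) (j := 1) (by decide) (by ext k; revert k; decide)] at h
    rw [cohomologyPart, cohomologyPart, ← Submodule.map_sup, h.sup_eq_top, Submodule.map_top,
      Submodule.range_mkQ]

end Cohomology

end NLieSuper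

theorem mainTheorem5 {K : Type*} [Field K] {N : ℕ}
    {g : Type*} [AddCommGroup g] [Module K g]
    (𝒢 : ZMod 2 → Submodule K g) [DirectSum.Decomposition 𝒢]
    (L : NLieSuper.FirstClassNLieSuperalgebra K N 𝒢)
    {V : Type*} [AddCommGroup V] [Module K V]
    (𝒱 : ZMod 2 → Submodule K V) [DirectSum.Decomposition 𝒱]
    (R : NLieSuper.GradedRep L 𝒱) :
    -- `C^m(g, V)` is graded
    (∀ m : ℕ, NLieSuper.IsGraded 𝒢 𝒱 (NLieSuper.supercochains N 𝒢 V m)) ∧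
    -- `δ` is given by the defining formula on homogeneous cochains and arguments
    (∀ (m : ℕ) (e : ZMod 2), ∀ f ∈ NLieSuper.supercochains N 𝒢 V m,
      f ∈ NLieSuper.homogeneous N 𝒢 𝒱 m e →
      ∀ (d : Fin (m + 1) → Fin (N + 1) → ZMod 2) (c : ZMod 2)
        (x : Fin (m + 1) → Fin (N + 1) → g) (z : g),
        (∀ i a, x i a ∈ 𝒢 (d i a)) → z ∈ 𝒢 c →
          NLieSuper.coboundary R m f x z = NLieSuper.coboundaryFormula R e f d c x z) ∧
    -- `δ` maps `C^m(g, V)` to `C^{m+1}(g, V)`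
    (∀ (m : ℕ), ∀ f ∈ NLieSuper.supercochains N 𝒢 V m,
      NLieSuper.coboundary R m f ∈ NLieSuper.supercochains N 𝒢 V (m + 1)) ∧
    -- `δ` preserves degrees
    (∀ (m : ℕ) (α : ZMod 2), ∀ f ∈ NLieSuper.supercochains N 𝒢 V m,
      f ∈ NLieSuper.homogeneous N 𝒢 𝒱 m α →
        NLieSuper.coboundary R m f ∈ NLieSuper.homogeneous N 𝒢 𝒱 (m + 1) α) ∧
    -- `δ² = 0`
    (∀ (m : ℕ), ∀ f ∈ NLieSuper.supercochains N 𝒢 V m,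
      NLieSuper.coboundary R (m + 1) (NLieSuper.coboundary R m f) = 0) ∧
    -- `δ C^{m-1}(g, V)` is a graded subspace of the graded space `Z^m(g, V)`, and
    -- `H^m(g, V) = Z^m(g, V) / δ C^{m-1}(g, V)` is graded
    (∀ m : ℕ, NLieSuper.coboundaries R m ≤ NLieSuper.cocycles R m ∧
      NLieSuper.IsGraded 𝒢 𝒱 (NLieSuper.cocycles R m) ∧
      NLieSuper.IsGraded 𝒢 𝒱 (NLieSuper.coboundaries R m) ∧
      DirectSum.IsInternal (NLieSuper.cohomologyPart R m)) := by
  have hle {m : ℕ} := NLieSuper.supercochains_le_multilinear (V := V) (N := N) (m := m) 𝒢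
  refine ⟨fun m => ?_, fun m e f hf hfe d c x z hx hz => ?_,
    fun m f hf => NLieSuper.coboundary_mem_supercochains R hf,
    fun m α f hf hfα => NLieSuper.coboundary_mem_homogeneous R (hle hf) hfα,
    fun m f hf => NLieSuper.coboundary_coboundary R (hle hf),
    fun m => ⟨NLieSuper.coboundaries_le_cocycles R, ?_, ?_,
      NLieSuper.isInternal_cohomologyPart R m⟩⟩
  · exact NLieSuper.isGraded_of_cochainComponent_mem 𝒢 𝒱 hle fun f hf e =>
      NLieSuper.cochainComponent_mem_supercochains e hf
  · rw [NLieSuper.coboundary_eq_homCoboundary R (hle hf) hfe,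
      NLieSuper.homCoboundary_apply R e (hle hf) hx hz, NLieSuper.coboundaryFormula_eq]
  · exact NLieSuper.isGraded_of_cochainComponent_mem 𝒢 𝒱 (NLieSuper.cocycles_le_multilinear R)
      fun f hf e => NLieSuper.cochainComponent_mem_cocycles R hf e
  · exact NLieSuper.isGraded_of_cochainComponent_mem 𝒢 𝒱
      ((NLieSuper.coboundaries_le_cocycles R).trans (NLieSuper.cocycles_le_multilinear R))
      fun f hf e => NLieSuper.cochainComponent_mem_coboundaries R hf e
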